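/- Let $(M^{n+1},g)$ be a smooth Riemannian manifold (Hausdorff) with Levi-Civita connection $\nabla$ and curvature $R(X,Y)=\nabla_X\nabla_Y-\nabla_Y\nabla_X-\nabla_{[X,Y]}$, and let $K\subset M$ be compact (for instance $K=M$ if $M$ is compact). For $p\in K$ and an orthonormal basis $E=(E_1,\dots,E_{n+1})$ of $T_pM$ identify $\mathbb R^{n+1}$ with $T_pM$ by $x\mapsto x_iE_i$, and put $F(x)=\exp_p(x_iE_i)$. For $\rho>0$, a $C^1$ function $w:S^n\to\mathbb R$ with $|w|<1$, and a smooth local parametrization $z\mapsto\Theta(z)$ of $S^n\subset\mathbb R^{n+1}\cong T_pM$, with $z$ in an open set $U\subset\mathbb R^n$, let $$G(z)=F\big(\rho\,(1-w(\Theta(z)))\,\Theta(z)\big),$$ with image in $S_\rho(p,w)$, let $Z_i=G_*(\partial_{z^i})$, $\Theta_i=\partial_{z^i}\Theta\in T_pM$ and $w_i=\partial_{z^i}(w\circ\Theta)$, $i=1,\dots,n$. Then there is $\rho_0>0$ such that for every $p\in K$ the map $\exp_p$ is defined and smooth on the ball of radius $2\rho_0$ of $T_pM$, and there are $O$, $L^0$,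 $Q^0$ as described below such that for all $\rho\in(0,\rho_0)$, all $p\in K$, all $E$, and all $w$ and $\Theta$ as above, at every $z\in U$ and for all $1\le i,j\le n$, $$\begin{aligned}\rho^{-2}(1-w)^{-2}\,g(Z_i,Z_j)={}&g(\Theta_i,\Theta_j)+\tfrac13\,g(R(\Theta,\Theta_i)\Theta,\Theta_j)\,\rho^2(1-w)^2\\&+\tfrac16\,g((\nabla_\Theta R)(\Theta,\Theta_i)\Theta,\Theta_j)\,\rho^3(1-w)^3+(1-w)^{-2}w_iw_j\\&+\big[\,O+\rho^4L^0(w)+\rho^4Q^0(w)\,\big](\Theta_i,\Theta_j),\end{aligned}$$ where $w$ and the error terms are taken at $\Theta=\Theta(z)$, and $R$, $\nabla R$ and the metric on the right-hand side are taken at $p$. Here $O$, $L^0(w)$, $Q^0(w)$ are functions on $S^n$ with values in the bilinear forms on $\mathbb R^{n+1}$. They depend on $(\rho,p,E)$ but not on $\Theta$, and $O$ does not depend on $w$. They satisfy: * $O=\mathcal O(\rho^4)$: $O$ is smooth on $S^n$, and each of its derivatives is bounded by a constant times $\rho^4$. * $L^0(w)(\theta)=w(\theta)\,a(\theta)$,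 with $a$ smooth on $S^n$ and all of its derivatives bounded. * $Q^0(w)(\theta)=q(\theta,w(\theta))$, with $q(\theta,s)$ smooth for $\theta\in S^n$, $|s|<1$, all of its derivatives in $(\theta,s)$ bounded, and $q(\theta,0)=0=\partial_sq(\theta,0)$. Each of these bounds holds for every order of derivative with a constant independent of $\rho\in(0,\rho_0)$, $p\in K$ and $E$. -/

import Mathlib

open scoped Manifold ContDiff

noncomputable section

namespace PerturbedSphere

/-! ### Local Riemannian geometry on a Euclidean domain -/

section Local

variable {V : Type*} [NormedAddCommGroup V] [NormedSpace ℝ V]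

/-- Christoffel symbols of the metric `G` as a vector valued bilinear expression:
`G (Γ(u,v), z) = (∂_u G(v,z) + ∂_v G(u,z) - ∂_z G(u,v)) / 2` for all `z`. -/
def christoffel (G : V → V →L[ℝ] V →L[ℝ] ℝ) (y u v : V) : V :=
  ContinuousLinearMap.inverse (G y)
    ((1 / 2 : ℝ) • (fderiv ℝ G y u v + fderiv ℝ G y v u - ((fderiv ℝ G y).flip u).flip v))

/-- The Levi-Civita derivative `∇_u Y` at the point `y` of the vector field `Y`. -/
def nabla (G : V → V →L[ℝ] V →L[ℝ] ℝ) (u : V) (Y : V → V) (y : V) : V :=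
  fderiv ℝ Y y u + christoffel G y u (Y y)

/-- The Riemann curvature `R(u,v) c = ∇_u ∇_v c - ∇_v ∇_u c` at `y`, where `u`, `v`, `c` are
extended as constant (hence commuting) vector fields. -/
def riemann (G : V → V →L[ℝ] V →L[ℝ] ℝ) (y u v c : V) : V :=
  nabla G u (nabla G v (fun _ => c)) y - nabla G v (nabla G u (fun _ => c)) y

/-- The covariant derivative `(∇_a R)(u,v) c` of the curvature tensor at `y`. -/
def nablaRiemann (G : V → V →L[ℝ] V →L[ℝ] ℝ) (y a u v c : V) : V :=
  nabla G a (fun x => riemann G x u v c) y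
    - riemann G y (christoffel G y a u) v c
    - riemann G y u (christoffel G y a v) c
    - riemann G y u v (christoffel G y a c)

end Local

/-- `ℝ^d` with its Euclidean norm. -/
abbrev Eu (d : ℕ) : Type := EuclideanSpace ℝ (Fin d)

section Riemannian

variable {n : ℕ} {M : Type*} [TopologicalSpace M] [ChartedSpace (Eu (n + 1)) M]
  [IsManifold (𝓡 (n + 1)) ∞ M]

variable (n M) in
/-- Smooth Riemannian metrics on the `(n+1)`-dimensional manifold `M`. -/
abbrev RiemMetric : Type _ :=
  Bundle.ContMDiffRiemannianMetric (𝓡 (n + 1)) ∞ (Eu (n + 1))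
    (fun x : M => TangentSpace (𝓡 (n + 1)) x)

/-- The metric `g` in the preferred chart at `x₀`. -/
def chartMetric (g : RiemMetric n M) (x₀ : M) (y : Eu (n + 1)) :
    Eu (n + 1) →L[ℝ] Eu (n + 1) →L[ℝ] ℝ :=
  let q : M := (extChartAt (𝓡 (n + 1)) x₀).symm y
  let D : Eu (n + 1) →L[ℝ] TangentSpace (𝓡 (n + 1)) q :=
    mfderiv 𝓘(ℝ, Eu (n + 1)) (𝓡 (n + 1)) (extChartAt (𝓡 (n + 1)) x₀).symm y
  (D.precomp ℝ).comp ((g.inner q).comp D)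

/-- The components of a tangent vector at `p` in the preferred chart at `p`. -/
def toChart (p : M) (v : TangentSpace (𝓡 (n + 1)) p) : Eu (n + 1) :=
  mfderiv (𝓡 (n + 1)) 𝓘(ℝ, Eu (n + 1)) (extChartAt (𝓡 (n + 1)) p) p v

/-- `g(R(a,b)c, d)` at the point `p`. -/
def curv (g : RiemMetric n M) (p : M) (a b c d : TangentSpace (𝓡 (n + 1)) p) : ℝ :=
  let y := extChartAt (𝓡 (n + 1)) p p
  chartMetric g p y
    (riemann (chartMetric g p) y (toChart p a) (toChart p b) (toChart p c)) (toChart p d)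

/-- `g((∇_e R)(a,b)c, d)` at the point `p`. -/
def nablaCurv (g : RiemMetric n M) (p : M) (e a b c d : TangentSpace (𝓡 (n + 1)) p) : ℝ :=
  let y := extChartAt (𝓡 (n + 1)) p p
  chartMetric g p y
    (nablaRiemann (chartMetric g p) y (toChart p e) (toChart p a) (toChart p b) (toChart p c))
    (toChart p d)

/-- `γ` is a geodesic of `g` on the open set of times `s`. -/
def IsGeodesicOn (g : RiemMetric n M) (γ : ℝ → M) (s : Set ℝ) : Prop :=
  ContMDiffOn 𝓘(ℝ, ℝ) (𝓡 (n + 1)) 2 γ s ∧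
    ∀ t ∈ s,
      let c : ℝ → Eu (n + 1) := fun r => extChartAt (𝓡 (n + 1)) (γ t) (γ r)
      deriv (deriv c) t + christoffel (chartMetric g (γ t)) (c t) (deriv c t) (deriv c t) = 0

/-- There is a geodesic, defined on an open interval containing `[0,1]`, that starts at `p` with
velocity `v` and is at `q` at time `1`; that is, `exp_p v` is defined and equal to `q`. -/
def IsExp (g : RiemMetric n M) (p : M) (v : TangentSpace (𝓡 (n + 1)) p) (q : M) : Prop :=
  ∃ ε > (0 : ℝ), ∃ γ : ℝ → M, IsGeodesicOn g γ (Set.Ioo (-ε) (1 + ε)) ∧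
    tangentMap 𝓘(ℝ, ℝ) (𝓡 (n + 1)) γ ⟨0, (1 : ℝ)⟩ = ⟨p, v⟩ ∧ γ 1 = q

open Classical in
/-- The Riemannian exponential map at `p` (with value `p` where it is not defined). -/
def expMap (g : RiemMetric n M) (p : M) (v : TangentSpace (𝓡 (n + 1)) p) : M :=
  if h : ∃ q, IsExp g p v q then h.choose else p

/-- A point `p` of `M` with an orthonormal basis `E_1, …, E_{n+1}` of `T_p M`. -/
structure Frame (g : RiemMetric n M) where
  pt : M
  vec : Fin (n + 1) → TangentSpace (𝓡 (n + 1)) pt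
  orthonormal : ∀ i j, g.inner pt (vec i) (vec j) = if i = j then 1 else 0

variable {g : RiemMetric n M}

/-- The tangent vector `∑ x_i E_i` at `p`. -/
def Frame.tangent (P : Frame g) (x : Eu (n + 1)) : TangentSpace (𝓡 (n + 1)) P.pt :=
  ∑ i, x i • P.vec i

/-- Geodesic normal coordinates `F(x) = exp_p (∑ x_i E_i)`. -/
def Frame.normalCoord (P : Frame g) (x : Eu (n + 1)) : M :=
  expMap g P.pt (P.tangent x)

end Riemannian

/-- The unit sphere `S^n` of `ℝ^{n+1}`. -/
abbrev Sph (n : ℕ) : Type := Metric.sphere (0 : Eu (n + 1)) 1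

/-- Bilinear forms on `ℝ^d`. -/
abbrev Bil (d : ℕ) : Type := Eu d →L[ℝ] Eu d →L[ℝ] ℝ

section Sphere

variable {n : ℕ}

/-- The coordinate derivative `∂_{z^i} f` at `z`. -/
def pd {W : Type*} [NormedAddCommGroup W] [NormedSpace ℝ W] (i : Fin n) (f : Eu n → W)
    (z : Eu n) : W :=
  fderiv ℝ f z (EuclideanSpace.single i 1)

variable {M : Type*} [TopologicalSpace M] [ChartedSpace (Eu (n + 1)) M]
  [IsManifold (𝓡 (n + 1)) ∞ M] {g : RiemMetric n M}

/-- The parametrization `G(z) = F(ρ (1 - w(Θ(z))) Θ(z))` of the perturbed geodesic sphere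
`S_ρ(p,w)`. -/
def param (P : Frame g) (ρ : ℝ) (w : Sph n → ℝ) (Θ : Eu n → Sph n) (z : Eu n) : M :=
  P.normalCoord ((ρ * (1 - w (Θ z))) • (Θ z : Eu (n + 1)))

/-- The coordinate tangent vectors `Z_i = G_*(∂_{z^i})` of `S_ρ(p,w)`. -/
def tangentZ (P : Frame g) (ρ : ℝ) (w : Sph n → ℝ) (Θ : Eu n → Sph n) (i : Fin n) (z : Eu n) :
    TangentSpace (𝓡 (n + 1)) (param P ρ w Θ z) :=
  mfderiv 𝓘(ℝ, Eu n) (𝓡 (n + 1)) (param P ρ w Θ) z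
    (EuclideanSpace.single i (1 : ℝ) : Eu n)

end Sphere

/-! ### Error terms -/

section Errors

variable {ι X V : Type*} [NormedAddCommGroup X] [NormedSpace ℝ X]
  [NormedAddCommGroup V] [NormedSpace ℝ V]

/-- The functions `f k`, `k ∈ S`, are smooth at the points of `A`, and each of their derivatives
is bounded on `A` by a constant, independent of `k`, times `b k`. -/
def SmoothBounded (S : Set ι) (A : Set X) (f : ι → X → V) (b : ι → ℝ) : Prop :=
  (∀ k ∈ S, ∀ x ∈ A, ContDiffAt ℝ ∞ (f k) x) ∧
    ∀ m : ℕ, ∃ C : ℝ, ∀ k ∈ S, ∀ x ∈ A, ‖iteratedFDeriv ℝ m (f k) x‖ ≤ C * b k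

variable {n : ℕ}

/-- The functions `T k` on `S^n`, `k ∈ S`, are smooth and bounded by a constant times `b k` in the
`C^∞` topology (they are restrictions of functions smooth near `S^n` in `ℝ^{n+1}`, with such bounds on `S^n`). -/
def IsOTerm (S : Set ι) (b : ι → ℝ) (T : ι → Sph n → V) : Prop :=
  ∃ f : ι → Eu (n + 1) → V, SmoothBounded S (Metric.sphere 0 1) f b ∧
    ∀ k ∈ S, ∀ θ : Sph n, T k θ = f k θ

/-- `T k w` is an expression of the form `L^0(w)`: a linear expression in `w` (without
derivatives) whose coefficients are smooth on `S^n` and bounded in the `C^∞` topology uniformly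
in `k ∈ S`. -/
def IsLTerm (S : Set ι) (T : ι → (Sph n → ℝ) → Sph n → V) : Prop :=
  ∃ a : ι → Sph n → V, IsOTerm S (fun _ => 1) a ∧
    ∀ k ∈ S, ∀ (w : Sph n → ℝ) (θ : Sph n), T k w θ = w θ • a k θ

/-- `T k w` is, for `|w| < 1`, an expression of the form `Q^0(w)`: a nonlinear expression
`q_k(θ, w(θ))`, vanishing quadratically at `w = 0`, where `q_k(θ, s)` is smooth for `θ ∈ S^n` and
`|s| < 1`, with derivatives in `(θ, s)` bounded uniformly in `k ∈ S`. -/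
def IsQTerm (S : Set ι) (T : ι → (Sph n → ℝ) → Sph n → V) : Prop :=
  ∃ q : ι → Eu (n + 1) × ℝ → V,
    SmoothBounded S (Metric.sphere 0 1 ×ˢ Set.Ioo (-1) 1) q (fun _ => 1) ∧
    (∀ k ∈ S, ∀ θ : Sph n,
      q k (θ, 0) = 0 ∧ deriv (fun s : ℝ => q k (θ, s)) 0 = 0) ∧
    ∀ k ∈ S, ∀ w : Sph n → ℝ, (∀ θ, |w θ| < 1) → ∀ θ : Sph n, T k w θ = q k (θ, w θ)

end Errors

end PerturbedSphere

end

/-!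
In geodesic normal coordinates `F` at `p` the perturbed sphere is the image of the polar map
`z ↦ t Θ` with `t = ρ (1 - w(Θ))`. Its coordinate tangent vectors are the images under `DF` of
`t Θ_i - ρ w_i Θ`. Let `h = F^* g`. The Gauss lemma gives `h(tΘ)(Θ, ·) = ⟨Θ, ·⟩`, and `Θ_i` is
orthogonal to `Θ`, so that `g(Z_i, Z_j) = t² h(tΘ)(Θ_i, Θ_j) + ρ² w_i w_j`
(`metricAt_polar`). It remains to expand `h(tΘ)` in powers of `t`, with a remainder that is smooth
in all variables and uniformly bounded.

*Coefficients.* Along the ray `t ↦ F(tx)` the fields `t DF(tx) u` are Jacobi fields, which makes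
`k(t) = h(tx)(u, v)` a solution of `t k'' + 2 k' = 2 t ψ`, where `ψ` and `ψ'` at `0` are the
curvature terms `g(R(x,u)x, v)` and `g((∇_x R)(x,u)x, v)`. Hence the Taylor coefficients of `k` are
`⟨u, v⟩`, `0`, `ψ(0)/3` and `ψ'(0)/6` (`taylor_of_singular_ode`, `IsRadialMap.taylor`). This and the
Gauss lemma (`IsRadialMap.gauss`) are proved for metrics on open sets of a vector space, for maps
that send rays to geodesics; the transformation law of the Christoffel symbols
(`GeodesicEqAt.change`) carries them over to `M`.

*Remainder.* Short geodesics in a chart depend smoothly on their initial data, because the flow of a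
vector field with small Lipschitz constant is obtained by inverting a smooth map of a space of
continuous paths (`exists_smooth_flow`, `IsLocalMetric.exists_local_exp`). Together with uniqueness
of geodesics (`IsExp.unique`), this shows that near each point of `M` the metric in normal
coordinates is a smooth function of `x` and of the frame, whose coordinates range in a compact set
(`exists_uniform_normalMetric`). Hadamard's lemma (`exists_contDiff_eq_add_smul`), applied four
times in `t`, writes the remainder as `t⁴` times a smooth function of all variables, and
compactness bounds its derivatives (`smoothBounded_of_isCompact`, `exists_isRemainder`).
The splitting into the terms `O`, `L⁰` and `Q⁰` is the expansion of this function to first order in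
the value `s` of `w`. Finitely many of these local expansions cover `K` (`exists_hasExpansion`).
-/

namespace PerturbedSphere

open Set Filter Topology

set_option maxSynthPendingDepth 3

/-! ### Superposition operators and parameter integrals -/

section Superposition

universe u

variable {I : Type*} [TopologicalSpace I] [CompactSpace I]
variable {E F : Type u} [NormedAddCommGroup E] [NormedSpace ℝ E]
  [NormedAddCommGroup F] [NormedSpace ℝ F]

/-- Pointwise evaluation `C(I, E →L F) × C(I, E) → C(I, F)` as a continuous bilinear map. -/
noncomputable def pointwiseEval (I : Type*) [TopologicalSpace I] [CompactSpace I]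
    (E F : Type u) [NormedAddCommGroup E] [NormedSpace ℝ E]
    [NormedAddCommGroup F] [NormedSpace ℝ F] :
    C(I, E →L[ℝ] F) →L[ℝ] C(I, E) →L[ℝ] C(I, F) :=
  LinearMap.mkContinuous₂
    (LinearMap.mk₂ ℝ
      (fun (A : C(I, E →L[ℝ] F)) (h : C(I, E)) =>
        (⟨fun t => A t (h t), A.continuous.clm_apply h.continuous⟩ : C(I, F)))
      (fun _ _ _ => by ext; simp) (fun _ _ _ => by ext; simp)
      (fun _ _ _ => by ext; simp) (fun _ _ _ => by ext; simp)) 1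
    (fun A h => by
      rw [one_mul, ContinuousMap.norm_le _ (by positivity)]
      intro t
      exact ((A t).le_opNorm _).trans
        (mul_le_mul (A.norm_coe_le_norm t) (h.norm_coe_le_norm t) (norm_nonneg _)
          ((norm_nonneg _).trans (A.norm_coe_le_norm t))))

lemma hasFDerivAt_superposition {f : E → F} (hf : ContDiff ℝ 1 f) (α : C(I, E)) :
    HasFDerivAt (fun β : C(I, E) => (⟨f, hf.continuous⟩ : C(E, F)).comp β)
      (pointwiseEval I E F
        ((⟨fderiv ℝ f, hf.continuous_fderiv one_ne_zero⟩ : C(E, E →L[ℝ] F)).comp α)) α := by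
  rw [hasFDerivAt_iff_isLittleO_nhds_zero, Asymptotics.isLittleO_iff]
  intro ε hε
  have hcomp : IsCompact (range α) := isCompact_range α.continuous
  have hunif := hcomp.uniformContinuousAt_of_continuousAt (fderiv ℝ f)
    (fun a _ => (hf.continuous_fderiv one_ne_zero).continuousAt) (Metric.dist_mem_uniformity hε)
  obtain ⟨δ, hδ, hball⟩ := Metric.mem_uniformity_dist.1 hunif
  filter_upwards [Metric.ball_mem_nhds (0 : C(I, E)) hδ] with h hh
  rw [mem_ball_zero_iff] at hh
  rw [ContinuousMap.norm_le _ (by positivity)]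
  intro t
  have hht : ‖h t‖ < δ := (h.norm_coe_le_norm t).trans_lt hh
  have key := (convex_ball (α t) δ).norm_image_sub_le_of_norm_fderiv_le' (f := f) (𝕜 := ℝ)
    (C := ε) (φ := fderiv ℝ f (α t)) (x := α t) (y := α t + h t)
    (fun x _ => (hf.differentiable one_ne_zero).differentiableAt)
    (fun x hx => by
      have := hball (a := α t) (b := x) (by rw [dist_comm]; exact hx) ⟨t, rfl⟩
      have h2 : dist (fderiv ℝ f (α t)) (fderiv ℝ f x) < ε := this
      rw [dist_comm, dist_eq_norm] at h2
      exact h2.le)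
    (Metric.mem_ball_self hδ) (by simpa [dist_eq_norm] using hht)
  rw [add_sub_cancel_left] at key
  exact key.trans (mul_le_mul_of_nonneg_left (h.norm_coe_le_norm t) hε.le)

/-- The superposition operator `β ↦ f ∘ β` on `C(I, E)` is smooth: its derivative is the
superposition operator of `fderiv ℝ f` followed by a continuous linear map, so induction on the
order applies. -/
theorem contDiff_superposition {f : E → F} (hf : ContDiff ℝ ∞ f) :
    ContDiff ℝ ∞ (fun β : C(I, E) => (⟨f, hf.continuous⟩ : C(E, F)).comp β) := by
  have main : ∀ n : ℕ, ∀ (F : Type u) [NormedAddCommGroup F] [NormedSpace ℝ F] (f : E → F)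
      (hf : ContDiff ℝ ∞ f),
      ContDiff ℝ n (fun β : C(I, E) => (⟨f, hf.continuous⟩ : C(E, F)).comp β) := by
    intro n
    induction n with
    | zero =>
      intro F _ _ f hf
      exact contDiff_zero.2 (ContinuousMap.continuous_postcomp _)
    | succ n ih =>
      intro F _ _ f hf
      push_cast
      rw [contDiff_succ_iff_hasFDerivAt]
      refine ⟨_, ?_, fun α => hasFDerivAt_superposition (hf.of_le (by exact_mod_cast le_top)) α⟩
      exact (pointwiseEval I E F).contDiff.comp
        (ih (E →L[ℝ] F) (fderiv ℝ f) (hf.fderiv_right (by exact_mod_cast le_top)))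
  exact contDiff_infty.2 fun n => main n F f hf

end Superposition

section ParameterIntegral

universe u

variable {X W : Type u} [NormedAddCommGroup X] [NormedSpace ℝ X]
  [NormedAddCommGroup W] [NormedSpace ℝ W]

/-- Integration from `0` to `t` of functions on `[a, b]`, extended by constants outside `[a, b]`,
as a continuous linear map. -/
noncomputable def integralFrom (W : Type*) [NormedAddCommGroup W] [NormedSpace ℝ W] {a b : ℝ}
    (hab : a ≤ b) (t : ℝ) : C(Icc a b, W) →L[ℝ] W :=
  LinearMap.mkContinuous
    { toFun := fun α => ∫ s in (0 : ℝ)..t, α (projIcc a b hab s)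
      map_add' := fun α β => by
        simp only [ContinuousMap.add_apply]
        exact intervalIntegral.integral_add
          ((α.continuous.comp continuous_projIcc).intervalIntegrable _ _)
          ((β.continuous.comp continuous_projIcc).intervalIntegrable _ _)
      map_smul' := fun c α => by
        simp only [ContinuousMap.smul_apply, RingHom.id_apply]
        exact intervalIntegral.integral_smul _ _ } |t|
    (fun α => by
      have := intervalIntegral.norm_integral_le_of_norm_le_const (a := 0) (b := t)
        (f := fun s => α (projIcc a b hab s)) (C := ‖α‖) (fun s _ => α.norm_coe_le_norm _)
      simpa [mul_comm] using this)

/-- The integral is a continuous linear functional of the path `t ↦ f (x, t)`, which depends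
smoothly on `x` because superposition operators are smooth. -/
theorem contDiff_integral_zero_one {f : X × ℝ → W} (hf : ContDiff ℝ ∞ f) :
    ContDiff ℝ ∞ (fun x => ∫ t in (0 : ℝ)..1, f (x, t)) := by
  -- `ι x` is the path `t ↦ (x, t)` in `X × ℝ`
  have hzero : (0 : ℝ) ≤ 1 := zero_le_one
  let ι : X → C(Icc (0 : ℝ) 1, X × ℝ) := fun x => ⟨fun t => (x, (t : ℝ)), by fun_prop⟩
  have hι : ContDiff ℝ ∞ ι := by
    let L : X →L[ℝ] C(Icc (0 : ℝ) 1, X × ℝ) :=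
      LinearMap.mkContinuous
        { toFun := fun x => ContinuousMap.const _ (x, (0 : ℝ))
          map_add' := fun x y => by ext <;> simp
          map_smul' := fun c x => by ext <;> simp } 1
        (fun x => by
          rw [ContinuousMap.norm_le _ (by positivity)]
          intro t
          simp [Prod.norm_def])
    have : ι = fun x => L x + ι 0 := by
      funext x
      ext t <;> simp [ι, L]
    rw [this]
    exact L.contDiff.add contDiff_const
  have h := (integralFrom W hzero 1).contDiff.comp
    ((contDiff_superposition (I := Icc (0 : ℝ) 1) hf).comp hι)
  convert! h using 2 with x
  refine intervalIntegral.integral_congr fun t ht => ?_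
  rw [uIcc_of_le hzero] at ht
  simp [ι, projIcc_of_mem hzero ht]

/-- Hadamard's lemma with parameters: `f₁ (x, r)` is the mean over `t ∈ [0, 1]` of the derivative
of `f (x, ·)` at `t r`. -/
theorem exists_contDiff_eq_add_smul [CompleteSpace W] {f : X × ℝ → W} (hf : ContDiff ℝ ∞ f) :
    ∃ f₁ : X × ℝ → W, ContDiff ℝ ∞ f₁ ∧ ∀ x r, f (x, r) = f (x, 0) + r • f₁ (x, r) := by
  have hd : ContDiff ℝ ∞ (fun p : (X × ℝ) × ℝ =>
      fderiv ℝ f (p.1.1, p.2 * p.1.2) ((0 : X), (1 : ℝ))) := by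
    have h1 : ContDiff ℝ ∞ (fderiv ℝ f) := hf.fderiv_right (by exact_mod_cast le_top)
    exact (h1.comp (by fun_prop)).clm_apply contDiff_const
  refine ⟨_, contDiff_integral_zero_one hd, fun x r => ?_⟩
  have hderiv : ∀ t : ℝ, HasDerivAt (fun t : ℝ => f (x, t * r))
      (r • fderiv ℝ f (x, t * r) ((0 : X), (1 : ℝ))) t := by
    intro t
    have h2 : HasDerivAt (fun t : ℝ => ((x, t * r) : X × ℝ)) ((0 : X), r) t := by
      have := (hasDerivAt_const t x).prodMk ((hasDerivAt_id t).mul_const r)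
      simpa using this
    have h3 := (hf.differentiable (by simp) (x, t * r)).hasFDerivAt.comp_hasDerivAt t h2
    have h4 : ((0 : X), r) = r • ((0 : X), (1 : ℝ)) := by ext <;> simp
    rw [h4, map_smul] at h3
    exact h3
  have hcont : Continuous fun t : ℝ => r • fderiv ℝ f (x, t * r) ((0 : X), (1 : ℝ)) := by
    have := hd.continuous.comp (f := fun t : ℝ => (((x, r), t) : (X × ℝ) × ℝ)) (by fun_prop)
    exact this.const_smul r
  have hint := intervalIntegral.integral_eq_sub_of_hasDerivAt (fun t _ => hderiv t)
    (hcont.intervalIntegrable 0 1)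
  rw [intervalIntegral.integral_smul] at hint
  simp only [one_mul, zero_mul] at hint
  rw [hint]
  abel

end ParameterIntegral

/-! ### Smooth dependence of flows on the initial point -/

section Flow

variable {E : Type} [NormedAddCommGroup E] [NormedSpace ℝ E]

lemma neg_one_le_two : (-1 : ℝ) ≤ 2 := by norm_num

/-- The Volterra operator `α ↦ (t ↦ ∫ s in 0..t, α s)` on `C([-1, 2], E)`. -/
noncomputable def volterra (E : Type) [NormedAddCommGroup E] [NormedSpace ℝ E] :
    C(Icc (-1 : ℝ) 2, E) →L[ℝ] C(Icc (-1 : ℝ) 2, E) :=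
  LinearMap.mkContinuous
    { toFun := fun α =>
        ⟨fun t => ∫ s in (0 : ℝ)..t, α (projIcc (-1) 2 neg_one_le_two s),
          (intervalIntegral.continuous_primitive
            (fun a b => (α.continuous.comp continuous_projIcc).intervalIntegrable a b) 0).comp
            continuous_subtype_val⟩
      map_add' := fun α β => by
        ext t
        exact map_add (integralFrom E neg_one_le_two (t : ℝ)) α β
      map_smul' := fun c α => by
        ext t
        exact map_smul (integralFrom E neg_one_le_two (t : ℝ)) c α } 2
    (fun α => by
      rw [ContinuousMap.norm_le _ (by positivity)]
      intro t
      have h := intervalIntegral.norm_integral_le_of_norm_le_const (a := 0) (b := (t : ℝ))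
        (f := fun s => α (projIcc (-1) 2 neg_one_le_two s)) (C := ‖α‖)
        (fun s _ => α.norm_coe_le_norm _)
      have ht : |(t : ℝ) - 0| ≤ 2 := by
        rw [sub_zero, abs_le]
        exact ⟨by linarith [t.2.1], t.2.2⟩
      calc _ ≤ ‖α‖ * |(t : ℝ) - 0| := h
        _ ≤ ‖α‖ * 2 := by gcongr
        _ = 2 * ‖α‖ := mul_comm _ _)

lemma volterra_apply (α : C(Icc (-1 : ℝ) 2, E)) (t : Icc (-1 : ℝ) 2) :
    volterra E α t = ∫ s in (0 : ℝ)..t, α (projIcc (-1) 2 neg_one_le_two s) := rfl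

lemma norm_volterra_le : ‖volterra E‖ ≤ 2 := LinearMap.mkContinuous_norm_le _ (by norm_num) _

lemma exists_equiv_id_sub {B : Type*} [NormedAddCommGroup B] [NormedSpace ℝ B] [CompleteSpace B]
    {T : B →L[ℝ] B} {c : ℝ} (hc : c < 1) (hT : ∀ x, ‖T x‖ ≤ c * ‖x‖) :
    ∃ L : B ≃L[ℝ] B, (L : B →L[ℝ] B) = ContinuousLinearMap.id ℝ B - T := by
  have hn : ‖T‖ < 1 :=
    (T.opNorm_le_bound (le_max_right c 0) fun x =>
      (hT x).trans (by gcongr; exact le_max_left _ _)).trans_lt (max_lt hc one_pos)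
  exact ⟨ContinuousLinearEquiv.unitsEquiv ℝ _ (Units.oneSub _ hn), by ext; rfl⟩

/-- The flow of a bounded Lipschitz smooth vector field, with time slowed down by a small factor
`δ`, depends smoothly on the initial point. On `C([-1, 2], E)` it solves `Ψ α = x`, where
`Ψ α = α - δ ∫ f(α)` is a small Lipschitz perturbation of the identity, hence a homeomorphism, and
is smooth with invertible derivative, hence has a smooth inverse. -/
theorem exists_smooth_flow [CompleteSpace E] {f : E → E} (hf : ContDiff ℝ ∞ f) {K : NNReal}
    (hK : LipschitzWith K f) {C : ℝ} (hC : ∀ x, ‖f x‖ ≤ C) {ε : ℝ} (hε : 0 < ε) :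
    ∃ δ > (0 : ℝ), ∃ Φ : E → ℝ → E,
      (∀ t, ContDiff ℝ ∞ (fun x => Φ x t)) ∧ (∀ x, Φ x 0 = x) ∧
      (∀ x, ∀ t ∈ Ioo (-1 : ℝ) 2, HasDerivAt (Φ x) (δ • f (Φ x t)) t) ∧
      ∀ x t, ‖Φ x t - x‖ ≤ ε := by
  have hC0 : 0 ≤ C := (norm_nonneg _).trans (hC 0)
  obtain ⟨δ, hδ, hδK, hδC⟩ : ∃ δ > (0 : ℝ), δ * (2 * K) ≤ 1 / 2 ∧ δ * (2 * C) ≤ ε := by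
    refine ⟨min (1 / (4 * (K + 1))) (ε / (2 * (C + 1))), by positivity, ?_, ?_⟩
    · calc _ ≤ 1 / (4 * ((K : ℝ) + 1)) * (2 * K) := by gcongr; exact min_le_left _ _
        _ ≤ 1 / 2 := by
          rw [div_mul_eq_mul_div, div_le_div_iff₀ (by positivity) (by norm_num)]
          have := K.coe_nonneg
          linarith
    · calc _ ≤ ε / (2 * (C + 1)) * (2 * C) := by gcongr; exact min_le_right _ _
        _ ≤ ε := by
          rw [div_mul_eq_mul_div, div_le_iff₀ (by positivity)]
          nlinarith
  refine ⟨δ, hδ, ?_⟩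
  let N : C(Icc (-1 : ℝ) 2, E) → C(Icc (-1 : ℝ) 2, E) :=
    fun β => (⟨f, hf.continuous⟩ : C(E, E)).comp β
  let Ψ : C(Icc (-1 : ℝ) 2, E) → C(Icc (-1 : ℝ) 2, E) := fun α => α - δ • volterra E (N α)
  have hN : ContDiff ℝ ∞ N := contDiff_superposition hf
  have hΨ : ContDiff ℝ ∞ Ψ := contDiff_id.sub (((volterra E).contDiff.comp hN).const_smul δ)
  have happrox : ApproximatesLinearOn Ψ
      ((ContinuousLinearEquiv.refl ℝ (C(Icc (-1 : ℝ) 2, E)) : _ ≃L[ℝ] _) : _ →L[ℝ] _) univ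
      (1 / 2) := by
    intro α _ β _
    have hNl : ‖N α - N β‖ ≤ K * ‖α - β‖ := by
      rw [ContinuousMap.norm_le _ (by positivity)]
      intro t
      have h1 : ‖f (α t) - f (β t)‖ ≤ K * ‖α t - β t‖ := by
        simpa [dist_eq_norm] using hK.dist_le_mul (α t) (β t)
      exact h1.trans (by gcongr; exact (α - β).norm_coe_le_norm t)
    have h2 : Ψ α - Ψ β - (α - β) = -(δ • volterra E (N α - N β)) := by
      simp only [Ψ, map_sub, smul_sub]
      abel
    have h3 : ‖volterra E (N α - N β)‖ ≤ 2 * (K * ‖α - β‖) :=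
      ((volterra E).le_opNorm _).trans (mul_le_mul norm_volterra_le hNl (norm_nonneg _)
        (by norm_num))
    change ‖Ψ α - Ψ β - (α - β)‖ ≤ _
    rw [h2, norm_neg, norm_smul, Real.norm_of_nonneg hδ.le]
    calc δ * ‖volterra E (N α - N β)‖ ≤ δ * (2 * (K * ‖α - β‖)) := by gcongr
      _ = δ * (2 * K) * ‖α - β‖ := by ring
      _ ≤ 1 / 2 * ‖α - β‖ := by gcongr
      _ = _ := by simp
  have hsub : Subsingleton C(Icc (-1 : ℝ) 2, E) ∨ (1 / 2 : NNReal) <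
      ‖((ContinuousLinearEquiv.refl ℝ (C(Icc (-1 : ℝ) 2, E))).symm :
        C(Icc (-1 : ℝ) 2, E) →L[ℝ] C(Icc (-1 : ℝ) 2, E))‖₊⁻¹ := by
    rcases subsingleton_or_nontrivial (C(Icc (-1 : ℝ) 2, E)) with h | h
    · exact Or.inl h
    · right
      have : ‖((ContinuousLinearEquiv.refl ℝ (C(Icc (-1 : ℝ) 2, E))).symm :
        C(Icc (-1 : ℝ) 2, E) →L[ℝ] C(Icc (-1 : ℝ) 2, E))‖₊ = 1 := by
        ext
        exact ContinuousLinearMap.norm_id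
      rw [this, inv_one]
      exact NNReal.half_lt_self one_ne_zero
  let H := happrox.toHomeomorph Ψ hsub
  have hH : ∀ α, H α = Ψ α := fun α => rfl
  have hderiv : ∀ α, ∃ L : C(Icc (-1 : ℝ) 2, E) ≃L[ℝ] C(Icc (-1 : ℝ) 2, E),
      HasFDerivAt H (L : _ →L[ℝ] _) α := by
    intro α
    let A := pointwiseEval (Icc (-1 : ℝ) 2) E E
      ((⟨fderiv ℝ f, hf.continuous_fderiv (by simp)⟩ : C(E, E →L[ℝ] E)).comp α)
    have hA : ‖A‖ ≤ K := by
      refine ContinuousLinearMap.opNorm_le_bound _ K.coe_nonneg fun h => ?_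
      rw [ContinuousMap.norm_le _ (by positivity)]
      intro t
      exact ((fderiv ℝ f (α t)).le_opNorm _).trans
        (mul_le_mul (norm_fderiv_le_of_lipschitz ℝ hK) (h.norm_coe_le_norm t) (norm_nonneg _)
          K.coe_nonneg)
    obtain ⟨L, hL⟩ := exists_equiv_id_sub (T := δ • (volterra E).comp A) (c := 1 / 2) (by norm_num)
      fun h => by
        have h1 : ‖A h‖ ≤ K * ‖h‖ := (A.le_opNorm h).trans (by gcongr)
        have h2 : ‖volterra E (A h)‖ ≤ 2 * (K * ‖h‖) :=
          ((volterra E).le_opNorm _).trans (mul_le_mul norm_volterra_le h1 (norm_nonneg _)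
            (by norm_num))
        change ‖δ • volterra E (A h)‖ ≤ _
        rw [norm_smul, Real.norm_of_nonneg hδ.le]
        calc δ * ‖volterra E (A h)‖ ≤ δ * (2 * (K * ‖h‖)) := by gcongr
          _ = δ * (2 * K) * ‖h‖ := by ring
          _ ≤ 1 / 2 * ‖h‖ := by gcongr
    refine ⟨L, ?_⟩
    rw [hL]
    have h1 := hasFDerivAt_superposition (hf.of_le (by simp)) α
    exact (hasFDerivAt_id α).sub (((volterra E).hasFDerivAt.comp α h1).const_smul δ)
  choose L hL using hderiv
  have hsymm : ContDiff ℝ ∞ H.symm := H.contDiff_symm hL hΨ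
  -- the path starting at `x` is the preimage under `Ψ` of the constant path `x`
  let c : E →L[ℝ] C(Icc (-1 : ℝ) 2, E) :=
    LinearMap.mkContinuous
      { toFun := fun x => ContinuousMap.const _ x
        map_add' := fun x y => by ext; simp
        map_smul' := fun c x => by ext; simp } 1
      (fun x => by
        rw [ContinuousMap.norm_le _ (by positivity)]
        intro t
        simp)
  let a : E → C(Icc (-1 : ℝ) 2, E) := fun x => H.symm (c x)
  have ha : ContDiff ℝ ∞ a := hsymm.comp c.contDiff
  have heq : ∀ x (t : Icc (-1 : ℝ) 2), a x t =
      x + δ • ∫ s in (0 : ℝ)..t, f (a x (projIcc (-1) 2 neg_one_le_two s)) := by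
    intro x t
    have h1 : Ψ (a x) = c x := (hH _).symm.trans (H.apply_symm_apply _)
    have h2 := congrArg (fun γ : C(Icc (-1 : ℝ) 2, E) => γ t) h1
    have h3 : a x t - δ • volterra E (N (a x)) t = x := h2
    rw [volterra_apply] at h3
    exact sub_eq_iff_eq_add.1 h3
  have hcont : ∀ x, Continuous fun s : ℝ => f (a x (projIcc (-1) 2 neg_one_le_two s)) := fun x =>
    hf.continuous.comp ((a x).continuous.comp continuous_projIcc)
  refine ⟨fun x t => a x (projIcc (-1) 2 neg_one_le_two t), fun t => ?_, fun x => ?_,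
    fun x t ht => ?_, fun x t => ?_⟩
  · exact (ContinuousMap.evalCLM ℝ (projIcc (-1) 2 neg_one_le_two t)).contDiff.comp ha
  · have h0 : ((projIcc (-1 : ℝ) 2 neg_one_le_two 0 : Icc (-1 : ℝ) 2) : ℝ) = 0 := by
      rw [projIcc_of_mem neg_one_le_two (by norm_num : (0 : ℝ) ∈ Icc (-1 : ℝ) 2)]
    simp [heq x (projIcc (-1) 2 neg_one_le_two 0), h0]
  · have h1 : HasDerivAt (fun u : ℝ => x + δ •
        ∫ s in (0 : ℝ)..u, f (a x (projIcc (-1) 2 neg_one_le_two s)))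
        (δ • f (a x (projIcc (-1) 2 neg_one_le_two t))) t :=
      (((hcont x).integral_hasStrictDerivAt 0 t).hasDerivAt.const_smul δ).const_add x
    refine h1.congr_of_eventuallyEq ?_
    filter_upwards [Ioo_mem_nhds ht.1 ht.2] with u hu
    rw [heq, projIcc_of_mem neg_one_le_two (Ioo_subset_Icc_self hu)]
  · set u := projIcc (-1 : ℝ) 2 neg_one_le_two t
    change ‖a x u - x‖ ≤ ε
    rw [heq x u, add_sub_cancel_left, norm_smul, Real.norm_of_nonneg hδ.le]
    have h := intervalIntegral.norm_integral_le_of_norm_le_const (a := 0) (b := (u : ℝ))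
      (f := fun s => f (a x (projIcc (-1) 2 neg_one_le_two s))) (C := C) (fun s _ => hC _)
    have hu : |(u : ℝ) - 0| ≤ 2 := by
      rw [sub_zero, abs_le]
      exact ⟨by linarith [u.2.1], u.2.2⟩
    calc _ ≤ δ * (C * |(u : ℝ) - 0|) := by gcongr
      _ ≤ δ * (C * 2) := by gcongr
      _ ≤ ε := by linarith

end Flow

/-! ### Uniform bounds from compactness -/

section Bounds

variable {ι C X W : Type*} [NormedAddCommGroup C] [NormedSpace ℝ C]
  [NormedAddCommGroup X] [NormedSpace ℝ X] [NormedAddCommGroup W] [NormedSpace ℝ W]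

/-- A smooth function of `(c, x)`, with parameters `c` in a compact set and `x` in a compact set,
is a uniformly smoothly bounded family of functions of `x`. -/
theorem smoothBounded_of_isCompact {Ψ : C × X → W} (hΨ : ContDiff ℝ ∞ Ψ) {𝒦 : Set C}
    (h𝒦 : IsCompact 𝒦) {A A' : Set X} (hA' : IsCompact A') (hA : A ⊆ A') {S : Set ι} {c : ι → C}
    (hc : ∀ k ∈ S, c k ∈ 𝒦) :
    SmoothBounded S A (fun k x => Ψ (c k, x)) (fun _ => 1) := by
  refine ⟨fun k _ x _ => (hΨ.comp (by fun_prop : ContDiff ℝ ∞ fun x : X => (c k, x))).contDiffAt,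
    fun m => ?_⟩
  obtain ⟨B, hB⟩ := (h𝒦.prod hA').exists_bound_of_continuousOn
    (f := iteratedFDeriv ℝ m Ψ)
    (hΨ.continuous_iteratedFDeriv (by exact_mod_cast le_top)).continuousOn
  refine ⟨B * ‖ContinuousLinearMap.inr ℝ C X‖ ^ m, fun k hk x hx => ?_⟩
  have h1 : (fun x => Ψ (c k, x)) =
      (fun p => Ψ ((c k, 0) + p)) ∘ (ContinuousLinearMap.inr ℝ C X) := by
    funext x
    simp
  have h2 : ContDiff ℝ ∞ fun p => Ψ ((c k, 0) + p) := hΨ.comp (by fun_prop)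
  change ‖iteratedFDeriv ℝ m (fun x => Ψ (c k, x)) x‖ ≤ _ * 1
  rw [mul_one, h1, ContinuousLinearMap.iteratedFDeriv_comp_right _ h2 x
    (by exact_mod_cast le_top)]
  refine (ContinuousMultilinearMap.norm_compContinuousLinearMap_le _ _).trans ?_
  rw [Finset.prod_const, Finset.card_univ, Fintype.card_fin]
  gcongr
  rw [iteratedFDeriv_comp_add_left]
  simpa using hB (c k, x) ⟨hc k hk, hA hx⟩

lemma SmoothBounded.const_smul_left {S : Set ι} {A : Set X} {f : ι → X → W}
    (hf : SmoothBounded S A f (fun _ => 1)) (b : ι → ℝ) (hb : ∀ k ∈ S, 0 ≤ b k) :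
    SmoothBounded S A (fun k x => b k • f k x) b := by
  refine ⟨fun k hk x hx => contDiffAt_const.smul (hf.1 k hk x hx), fun m => ?_⟩
  obtain ⟨B, hB⟩ := hf.2 m
  refine ⟨B, fun k hk x hx => ?_⟩
  have h1 : iteratedFDeriv ℝ m (fun x => b k • f k x) x = b k • iteratedFDeriv ℝ m (f k) x :=
    iteratedFDeriv_const_smul_apply' ((hf.1 k hk x hx).of_le (by exact_mod_cast le_top))
  rw [h1, norm_smul, Real.norm_of_nonneg (hb k hk), mul_comm]
  have := hB k hk x hx
  rw [mul_one] at this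
  exact mul_le_mul_of_nonneg_right this (hb k hk)

end Bounds

/-! ### Metrics on open sets of a vector space -/

section LocalGeometry

variable {V : Type*} [NormedAddCommGroup V] [NormedSpace ℝ V]

/-- `G` is a smooth Riemannian metric on the open set `Ω`. -/
structure IsLocalMetric (G : V → V →L[ℝ] V →L[ℝ] ℝ) (Ω : Set V) : Prop where
  isOpen : IsOpen Ω
  contDiffOn : ContDiffOn ℝ ∞ G Ω
  symm : ∀ y ∈ Ω, ∀ u v, G y u v = G y v u
  pos : ∀ y ∈ Ω, ∀ v, v ≠ 0 → 0 < G y v v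

/-- Exchange of the arguments of bilinear maps, as a continuous linear map. -/
noncomputable def flipCLM (V F : Type*) [NormedAddCommGroup V] [NormedSpace ℝ V]
    [NormedAddCommGroup F] [NormedSpace ℝ F] : (V →L[ℝ] V →L[ℝ] F) →L[ℝ] (V →L[ℝ] V →L[ℝ] F) :=
  (ContinuousLinearMap.flipₗᵢ ℝ V V F).toContinuousLinearEquiv.toContinuousLinearMap

@[simp] lemma flipCLM_apply {F : Type*} [NormedAddCommGroup F] [NormedSpace ℝ F]
    (B : V →L[ℝ] V →L[ℝ] F) : flipCLM V F B = B.flip := rfl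

/-- The Christoffel symbols `christoffel G y` as a continuous bilinear map, so that their
dependence on `y` can be differentiated. -/
noncomputable def christoffelL (G : V → V →L[ℝ] V →L[ℝ] ℝ) (y : V) : V →L[ℝ] V →L[ℝ] V :=
  (1 / 2 : ℝ) • (ContinuousLinearMap.compL ℝ V (V →L[ℝ] ℝ) V
      (ContinuousLinearMap.inverse (G y))).comp
    (fderiv ℝ G y + (fderiv ℝ G y).flip -
      (flipCLM V ℝ).comp (fderiv ℝ G y).flip)

lemma christoffelL_apply (G : V → V →L[ℝ] V →L[ℝ] ℝ) (y u v : V) :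
    christoffelL G y u v = christoffel G y u v := by
  simp [christoffelL, christoffel, smul_sub, smul_add]

/-- The curvature tensor as a continuous trilinear map, in terms of the Christoffel symbols. -/
noncomputable def riemannL (G : V → V →L[ℝ] V →L[ℝ] ℝ) (y : V) : V →L[ℝ] V →L[ℝ] V →L[ℝ] V :=
  (fderiv ℝ (christoffelL G) y + (ContinuousLinearMap.compL ℝ V V V).bilinearComp
      (christoffelL G y) (christoffelL G y)) -
    (fderiv ℝ (christoffelL G) y + (ContinuousLinearMap.compL ℝ V V V).bilinearComp
      (christoffelL G y) (christoffelL G y)).flip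

lemma riemannL_apply (G : V → V →L[ℝ] V →L[ℝ] ℝ) (y u v c : V) :
    riemannL G y u v c =
      fderiv ℝ (christoffelL G) y u v c + christoffelL G y u (christoffelL G y v c) -
        (fderiv ℝ (christoffelL G) y v u c + christoffelL G y v (christoffelL G y u c)) := by
  simp [riemannL]

/-- The derivative of `t ↦ B (γ t) (a t) (b t)` for a field `B` of bilinear maps along `γ`. -/
lemma HasDerivAt.bilin {F : Type*} [NormedAddCommGroup F] [NormedSpace ℝ F]
    {B : V → V →L[ℝ] V →L[ℝ] F} {γ a b : ℝ → V} {γ' a' b' : V} {t : ℝ}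
    (hB : DifferentiableAt ℝ B (γ t)) (hγ : HasDerivAt γ γ' t) (ha : HasDerivAt a a' t)
    (hb : HasDerivAt b b' t) :
    HasDerivAt (fun r => B (γ r) (a r) (b r))
      (fderiv ℝ B (γ t) γ' (a t) (b t) + B (γ t) a' (b t) + B (γ t) (a t) b') t := by
  have h := ((hB.hasFDerivAt.comp_hasDerivAt t hγ).clm_apply ha).clm_apply hb
  simpa using h

lemma hasDerivAt_apply {E F : Type*} [NormedAddCommGroup E] [NormedSpace ℝ E]
    [NormedAddCommGroup F] [NormedSpace ℝ F] {A : ℝ → E →L[ℝ] F} {A' : E →L[ℝ] F} {t : ℝ}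
    (hA : HasDerivAt A A' t) (v : E) : HasDerivAt (fun s => A s v) (A' v) t := by
  simpa using hA.clm_apply (hasDerivAt_const t v)

lemma hasFDerivAt_apply_apply {F : Type*} [NormedAddCommGroup F] [NormedSpace ℝ F]
    {B : V → V →L[ℝ] V →L[ℝ] F} {B' : V →L[ℝ] V →L[ℝ] V →L[ℝ] F} {y : V}
    (hB : HasFDerivAt B B' y) (u v : V) :
    HasFDerivAt (fun x => B x u v) ((B'.flip u).flip v) y := by
  have h := (hB.clm_apply (hasFDerivAt_const u y)).clm_apply (hasFDerivAt_const v y)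
  convert! h using 1
  ext w
  simp

variable {G : V → V →L[ℝ] V →L[ℝ] ℝ} {Ω : Set V}

lemma riemannL_swap (y a b c : V) : riemannL G y a b c = -riemannL G y b a c := by
  rw [riemannL_apply, riemannL_apply]
  abel

namespace IsLocalMetric

lemma contDiffAt (hG : IsLocalMetric G Ω) {y : V} (hy : y ∈ Ω) : ContDiffAt ℝ ∞ G y :=
  hG.contDiffOn.contDiffAt (hG.isOpen.mem_nhds hy)

lemma differentiableAt (hG : IsLocalMetric G Ω) {y : V} (hy : y ∈ Ω) : DifferentiableAt ℝ G y :=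
  (hG.contDiffAt hy).differentiableAt (by simp)

lemma eq_of_forall (hG : IsLocalMetric G Ω) {y : V} (hy : y ∈ Ω) {a b : V}
    (h : ∀ z, G y a z = G y b z) : a = b := by
  by_contra hab
  have := hG.pos y hy (a - b) (sub_ne_zero.2 hab)
  simp [h] at this

variable [FiniteDimensional ℝ V]

lemma isInvertible (hG : IsLocalMetric G Ω) {y : V} (hy : y ∈ Ω) : (G y).IsInvertible := by
  have hinj : Function.Injective (G y) := fun a b h => hG.eq_of_forall hy fun z => by rw [h]
  have hfin : Module.finrank ℝ V = Module.finrank ℝ (V →L[ℝ] ℝ) := by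
    rw [← (LinearMap.toContinuousLinearMap (𝕜 := ℝ) (E := V) (F' := ℝ)).finrank_eq]
    exact (Subspace.dual_finrank_eq (K := ℝ) (V := V)).symm
  let e := (LinearEquiv.ofInjectiveOfFinrankEq (G y : V →ₗ[ℝ] V →L[ℝ] ℝ) hinj hfin)
  exact ⟨e.toContinuousLinearEquiv, by ext v w; rfl⟩

lemma contDiffOn_christoffelL (hG : IsLocalMetric G Ω) :
    ContDiffOn ℝ ∞ (christoffelL G) Ω := by
  rw [contDiffOn_clm_apply]
  intro u
  rw [contDiffOn_clm_apply]
  intro v y hy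
  refine ContDiffAt.contDiffWithinAt ?_
  have hfun : (fun x => christoffelL G x u v) = fun x => christoffel G x u v :=
    funext fun x => christoffelL_apply G x u v
  rw [hfun]
  have hD : ContDiffAt ℝ ∞ (fderiv ℝ G) y :=
    (hG.contDiffAt hy).fderiv_right (by exact_mod_cast le_top)
  obtain ⟨e, he⟩ := hG.isInvertible hy
  have hinv : ContDiffAt ℝ ∞ (fun x => ContinuousLinearMap.inverse (G x)) y := by
    have h0 : ContDiffAt ℝ ∞ ContinuousLinearMap.inverse (G y) := he ▸ contDiffAt_map_inverse e
    exact h0.comp y (hG.contDiffAt hy)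
  refine hinv.clm_apply (ContDiffAt.const_smul _ ?_)
  refine ((hD.clm_apply contDiffAt_const).clm_apply contDiffAt_const).add
    ((hD.clm_apply contDiffAt_const).clm_apply contDiffAt_const) |>.sub ?_
  have h1 : ContDiffAt ℝ ∞ (fun x => ((fderiv ℝ G x).flip u).flip v) y := by
    let F1 := flipCLM V (V →L[ℝ] ℝ)
    let F2 := flipCLM V ℝ
    exact ((F2.contDiff.contDiffAt).comp y
      (((F1.contDiff.contDiffAt).comp y hD).clm_apply contDiffAt_const)).clm_apply
      contDiffAt_const
  exact h1

lemma contDiffAt_christoffelL (hG : IsLocalMetric G Ω) {y : V} (hy : y ∈ Ω) :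
    ContDiffAt ℝ ∞ (christoffelL G) y :=
  hG.contDiffOn_christoffelL.contDiffAt (hG.isOpen.mem_nhds hy)

lemma differentiableAt_christoffelL (hG : IsLocalMetric G Ω) {y : V} (hy : y ∈ Ω) :
    DifferentiableAt ℝ (christoffelL G) y :=
  (hG.contDiffAt_christoffelL hy).differentiableAt (by simp)

lemma contDiffAt_riemannL (hG : IsLocalMetric G Ω) {y : V} (hy : y ∈ Ω) :
    ContDiffAt ℝ ∞ (riemannL G) y := by
  have happ : ∀ {y : V}, y ∈ Ω → ∀ a b c, ContDiffAt ℝ ∞ (fun x => riemannL G x a b c) y := by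
    intro y hy a b c
    have hΓ := hG.contDiffAt_christoffelL hy
    have hD : ContDiffAt ℝ ∞ (fderiv ℝ (christoffelL G)) y :=
      hΓ.fderiv_right (by exact_mod_cast le_top)
    simp only [riemannL_apply]
    have h1 : ∀ a b, ContDiffAt ℝ ∞ (fun x => fderiv ℝ (christoffelL G) x a b c +
        christoffelL G x a (christoffelL G x b c)) y := fun a b =>
      (((hD.clm_apply contDiffAt_const).clm_apply contDiffAt_const).clm_apply
        contDiffAt_const).add ((hΓ.clm_apply contDiffAt_const).clm_apply
          ((hΓ.clm_apply contDiffAt_const).clm_apply contDiffAt_const))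
    exact (h1 a b).sub (h1 b a)
  have hon : ContDiffOn ℝ ∞ (riemannL G) Ω :=
    contDiffOn_clm_apply.2 fun a => contDiffOn_clm_apply.2 fun b =>
      contDiffOn_clm_apply.2 fun c x hx => (happ hx a b c).contDiffWithinAt
  exact hon.contDiffAt (hG.isOpen.mem_nhds hy)

omit [FiniteDimensional ℝ V] in
lemma fderiv_symm (hG : IsLocalMetric G Ω) {y : V} (hy : y ∈ Ω) (a u v : V) :
    fderiv ℝ G y a u v = fderiv ℝ G y a v u := by
  have h := fun u v => hasFDerivAt_apply_apply (hG.differentiableAt hy).hasFDerivAt u v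
  have heq : (fun x => G x u v) =ᶠ[𝓝 y] fun x => G x v u := by
    filter_upwards [hG.isOpen.mem_nhds hy] with x hx using hG.symm x hx u v
  have := ((h u v).congr_of_eventuallyEq heq.symm).unique (h v u)
  exact congrArg (fun L : V →L[ℝ] ℝ => L a) this

lemma christoffel_spec (hG : IsLocalMetric G Ω) {y : V} (hy : y ∈ Ω) (u v z : V) :
    G y (christoffelL G y u v) z =
      (fderiv ℝ G y u v z + fderiv ℝ G y v u z - fderiv ℝ G y z u v) / 2 := by
  rw [christoffelL_apply, christoffel, (hG.isInvertible hy).self_apply_inverse]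
  simp
  ring

lemma christoffel_symm (hG : IsLocalMetric G Ω) {y : V} (hy : y ∈ Ω) (u v : V) :
    christoffelL G y u v = christoffelL G y v u := by
  refine hG.eq_of_forall hy fun z => ?_
  rw [hG.christoffel_spec hy, hG.christoffel_spec hy, hG.fderiv_symm hy z u v]
  ring

/-- The Levi-Civita connection is compatible with the metric. -/
lemma fderiv_eq (hG : IsLocalMetric G Ω) {y : V} (hy : y ∈ Ω) (a u v : V) :
    fderiv ℝ G y a u v = G y (christoffelL G y a u) v + G y u (christoffelL G y a v) := by
  rw [hG.symm y hy u, hG.christoffel_spec hy, hG.christoffel_spec hy, hG.fderiv_symm hy a v u]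
  ring

lemma riemannL_eq_riemann (hG : IsLocalMetric G Ω) {y : V} (hy : y ∈ Ω) (u v c : V) :
    riemannL G y u v c = riemann G y u v c := by
  have hn : ∀ v, nabla G v (fun _ => c) = fun x => christoffelL G x v c := by
    intro v
    funext x
    simp [nabla, christoffelL_apply]
  have hf : ∀ u v, fderiv ℝ (fun x => christoffelL G x v c) y u =
      fderiv ℝ (christoffelL G) y u v c := by
    intro u v
    have h := hasFDerivAt_apply_apply (hG.differentiableAt_christoffelL hy).hasFDerivAt v c
    exact congrArg (fun L : V →L[ℝ] V => L u) h.fderiv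
  rw [riemann, hn, hn, nabla, nabla, hf, hf, riemannL_apply, ← christoffelL_apply,
    ← christoffelL_apply]

/-! ### Symmetries of the curvature tensor -/

lemma fderiv_christoffel_symm (hG : IsLocalMetric G Ω) {y : V} (hy : y ∈ Ω) (a u v : V) :
    fderiv ℝ (christoffelL G) y a u v = fderiv ℝ (christoffelL G) y a v u := by
  have h := fun u v =>
    hasFDerivAt_apply_apply (hG.differentiableAt_christoffelL hy).hasFDerivAt u v
  have heq : (fun x => christoffelL G x u v) =ᶠ[𝓝 y] fun x => christoffelL G x v u := by
    filter_upwards [hG.isOpen.mem_nhds hy] with x hx using hG.christoffel_symm hx u v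
  have := ((h u v).congr_of_eventuallyEq heq.symm).unique (h v u)
  exact congrArg (fun L : V →L[ℝ] V => L a) this

lemma bianchi (hG : IsLocalMetric G Ω) {y : V} (hy : y ∈ Ω) (a b c : V) :
    riemannL G y a b c + riemannL G y b c a + riemannL G y c a b = 0 := by
  simp only [riemannL_apply]
  rw [hG.fderiv_christoffel_symm hy a c b, hG.fderiv_christoffel_symm hy b a c,
    hG.fderiv_christoffel_symm hy c b a, hG.christoffel_symm hy c b,
    hG.christoffel_symm hy a c, hG.christoffel_symm hy b a]
  abel

/-- The derivative of `x ↦ G x (A x) (B x)`, written with covariant derivatives. -/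
lemma hasDerivAt_metric (hG : IsLocalMetric G Ω) {γ A B : ℝ → V} {γ' A' B' : V} {t : ℝ}
    (ht : γ t ∈ Ω) (hγ : HasDerivAt γ γ' t) (hA : HasDerivAt A A' t) (hB : HasDerivAt B B' t) :
    HasDerivAt (fun r => G (γ r) (A r) (B r))
      (G (γ t) (A' + christoffelL G (γ t) γ' (A t)) (B t) +
        G (γ t) (A t) (B' + christoffelL G (γ t) γ' (B t))) t := by
  convert! HasDerivAt.bilin (hG.differentiableAt ht) hγ hA hB using 1
  rw [hG.fderiv_eq ht]
  simp only [map_add, add_apply]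
  ring

/-- Skew-symmetry of `R(a,b)`: two covariant derivatives of the scalar `G(c,d)` commute. -/
lemma riemannL_skew (hG : IsLocalMetric G Ω) {y : V} (hy : y ∈ Ω) (a b c d : V) :
    G y (riemannL G y a b c) d = -G y c (riemannL G y a b d) := by
  have hG2 : ContDiffAt ℝ 2 G y := (hG.contDiffAt hy).of_le ENat.LEInfty.out
  have hsym : fderiv ℝ (fderiv ℝ G) y a b = fderiv ℝ (fderiv ℝ G) y b a :=
    (hG2.isSymmSndFDerivAt (by simp)) a b
  have hD : DifferentiableAt ℝ (fderiv ℝ G) y :=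
    ((hG.contDiffAt hy).fderiv_right (m := ∞) (by exact_mod_cast le_top)).differentiableAt
      (by simp)
  have hΓ := hG.differentiableAt_christoffelL hy
  -- the derivative in direction `a` of the metric compatibility identity in direction `b`
  have key : ∀ a b, fderiv ℝ (fderiv ℝ G) y a b c d =
      G y (fderiv ℝ (christoffelL G) y a b c + christoffelL G y a (christoffelL G y b c)) d +
      G y (christoffelL G y b c) (christoffelL G y a d) +
      (G y (christoffelL G y a c) (christoffelL G y b d) +
      G y c (fderiv ℝ (christoffelL G) y a b d + christoffelL G y a (christoffelL G y b d))) := by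
    intro a b
    have hl : HasDerivAt (fun s : ℝ => y + s • a) a 0 := by
      simpa using ((hasDerivAt_id (0 : ℝ)).smul_const a).const_add y
    have hy0 : y + (0 : ℝ) • a = y := by simp
    have hΓd : ∀ c, HasDerivAt (fun s : ℝ => christoffelL G (y + s • a) b c)
        (fderiv ℝ (christoffelL G) y a b c) 0 := by
      intro c
      exact hasDerivAt_apply (hasDerivAt_apply
        (hΓ.hasFDerivAt.comp_hasDerivAt_of_eq (0 : ℝ) hl hy0.symm) b) c
    have h1 : HasDerivAt (fun s : ℝ => fderiv ℝ G (y + s • a) b c d)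
        (fderiv ℝ (fderiv ℝ G) y a b c d) 0 := by
      exact hasDerivAt_apply (hasDerivAt_apply (hasDerivAt_apply
        (hD.hasFDerivAt.comp_hasDerivAt_of_eq (0 : ℝ) hl hy0.symm) b) c) d
    have h2 := hG.hasDerivAt_metric (t := 0) (γ := fun s : ℝ => y + s • a) (by rwa [hy0]) hl
      (hΓd c) (hasDerivAt_const 0 d)
    have h3 := hG.hasDerivAt_metric (t := 0) (γ := fun s : ℝ => y + s • a) (by rwa [hy0]) hl
      (hasDerivAt_const 0 c) (hΓd d)
    have h4 := h2.add h3
    have heq : (fun s : ℝ => fderiv ℝ G (y + s • a) b c d) =ᶠ[𝓝 0]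
        (fun s : ℝ => G (y + s • a) (christoffelL G (y + s • a) b c) d) +
        fun s : ℝ => G (y + s • a) c (christoffelL G (y + s • a) b d) := by
      have hmem : ∀ᶠ s : ℝ in 𝓝 0, y + s • a ∈ Ω :=
        hl.continuousAt.eventually_mem (by simpa using hG.isOpen.mem_nhds hy)
      filter_upwards [hmem] with s hs
      exact hG.fderiv_eq hs b c d
    have h5 := h1.unique (h4.congr_of_eventuallyEq heq)
    rw [h5]
    simp only [hy0, zero_add]
  have e1 := key a b
  have e2 := key b a
  rw [hsym, e2] at e1
  rw [riemannL_apply, riemannL_apply]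
  simp only [map_add, map_sub, add_apply, sub_apply]
    at e1 ⊢
  linarith

/-- The pair symmetry of the curvature tensor. -/
lemma riemannL_pair (hG : IsLocalMetric G Ω) {y : V} (hy : y ∈ Ω) (a b c d : V) :
    G y (riemannL G y a b c) d = G y (riemannL G y c d a) b := by
  have sk1 : ∀ a b c d, G y (riemannL G y a b c) d = -G y (riemannL G y b a c) d := by
    intro a b c d
    rw [riemannL_swap, map_neg, neg_apply]
  have sk2 : ∀ a b c d, G y (riemannL G y a b c) d = -G y (riemannL G y a b d) c := by
    intro a b c d
    rw [hG.riemannL_skew hy, hG.symm y hy]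
  have bi : ∀ a b c d, G y (riemannL G y a b c) d + G y (riemannL G y b c a) d +
      G y (riemannL G y c a b) d = 0 := by
    intro a b c d
    have := congrArg (fun w => G y w d) (hG.bianchi hy a b c)
    simpa using this
  -- the octahedron argument: the four Bianchi identities, and skew-symmetry in both pairs
  linarith [bi a b c d, bi b c d a, bi c d a b, bi d a b c, sk1 a b c d, sk2 a b c d,
    sk1 c d a b, sk2 c d a b, sk1 b c a d, sk2 b c a d, sk1 c a b d, sk2 c a b d, sk1 b d a c,
    sk2 b d c a, sk1 d a b c, sk2 d a b c, sk1 a c d b, sk2 a c d b, sk1 d b a c, sk2 d b a c,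
    sk1 a d b c, sk2 a d b c, sk2 b c d a, sk1 c d b a, sk2 c d b a, sk2 b d a c, sk1 d a c b,
    sk2 d a c b, sk1 d b c a, sk1 a b d c, sk1 b d c a]

end IsLocalMetric

end LocalGeometry

/-! ### Maps sending rays to geodesics -/

section Radial

variable {X V : Type*} [NormedAddCommGroup X] [NormedSpace ℝ X]
  [NormedAddCommGroup V] [NormedSpace ℝ V]

/-- The smooth map `e : B → Ω` sends the segments of lines through `0` to geodesics of `G`, that
is, it is an exponential map up to the choice of a linear map at the origin. -/
structure IsRadialMap (G : V → V →L[ℝ] V →L[ℝ] ℝ) (Ω : Set V) (e : X → V) (B : Set X) : Prop where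
  isOpen : IsOpen B
  contDiffOn : ContDiffOn ℝ ∞ e B
  mapsTo : ∀ x ∈ B, e x ∈ Ω
  geodesic : ∀ x (t : ℝ), t • x ∈ B → fderiv ℝ (fderiv ℝ e) (t • x) x x +
    christoffelL G (e (t • x)) (fderiv ℝ e (t • x) x) (fderiv ℝ e (t • x) x) = 0

lemma hasDerivAt_comp_smul {F : Type*} [NormedAddCommGroup F] [NormedSpace ℝ F] {f : X → F}
    {x : X} {t : ℝ} (hf : DifferentiableAt ℝ f (t • x)) :
    HasDerivAt (fun r : ℝ => f (r • x)) (fderiv ℝ f (t • x) x) t :=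
  hf.hasFDerivAt.comp_hasDerivAt t (by simpa using (hasDerivAt_id t).smul_const x)

lemma hasDerivAt_comp_smul_add {F : Type*} [NormedAddCommGroup F] [NormedSpace ℝ F] {f : X → F}
    {x : X} {t : ℝ} (u : X) (hf : DifferentiableAt ℝ f (t • x)) :
    HasDerivAt (fun s : ℝ => f (t • (x + s • u))) (t • fderiv ℝ f (t • x) u) 0 := by
  have hl : HasDerivAt (fun s : ℝ => t • (x + s • u)) (t • u) 0 := by
    have h := ((hasDerivAt_id (0 : ℝ)).smul_const u).const_add x
    rw [one_smul] at h
    exact h.const_smul t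
  have := hf.hasFDerivAt.comp_hasDerivAt_of_eq (0 : ℝ) hl (by simp)
  rwa [map_smul] at this

namespace IsRadialMap

variable {G : V → V →L[ℝ] V →L[ℝ] ℝ} {Ω : Set V} {e : X → V} {B : Set X}

lemma contDiffAt (he : IsRadialMap G Ω e B) {y : X} (hy : y ∈ B) : ContDiffAt ℝ ∞ e y :=
  he.contDiffOn.contDiffAt (he.isOpen.mem_nhds hy)

lemma contDiffAt₁ (he : IsRadialMap G Ω e B) {y : X} (hy : y ∈ B) :
    ContDiffAt ℝ ∞ (fderiv ℝ e) y :=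
  (he.contDiffAt hy).fderiv_right (by exact_mod_cast le_top)

lemma contDiffAt₂ (he : IsRadialMap G Ω e B) {y : X} (hy : y ∈ B) :
    ContDiffAt ℝ ∞ (fderiv ℝ (fderiv ℝ e)) y :=
  (he.contDiffAt₁ hy).fderiv_right (by exact_mod_cast le_top)

lemma hasDerivAt₀ (he : IsRadialMap G Ω e B) {x : X} {t : ℝ} (ht : t • x ∈ B) :
    HasDerivAt (fun r : ℝ => e (r • x)) (fderiv ℝ e (t • x) x) t :=
  hasDerivAt_comp_smul ((he.contDiffAt ht).differentiableAt (by simp))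

lemma hasDerivAt₁ (he : IsRadialMap G Ω e B) {x : X} {t : ℝ} (ht : t • x ∈ B) (u : X) :
    HasDerivAt (fun r : ℝ => fderiv ℝ e (r • x) u) (fderiv ℝ (fderiv ℝ e) (t • x) x u) t :=
  hasDerivAt_apply (hasDerivAt_comp_smul ((he.contDiffAt₁ ht).differentiableAt (by simp))) u

lemma hasDerivAt₂ (he : IsRadialMap G Ω e B) {x : X} {t : ℝ} (ht : t • x ∈ B) (u v : X) :
    HasDerivAt (fun r : ℝ => fderiv ℝ (fderiv ℝ e) (r • x) u v)
      (fderiv ℝ (fderiv ℝ (fderiv ℝ e)) (t • x) x u v) t :=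
  hasDerivAt_apply (hasDerivAt_apply
    (hasDerivAt_comp_smul ((he.contDiffAt₂ ht).differentiableAt (by simp))) u) v

lemma symm₂ (he : IsRadialMap G Ω e B) {y : X} (hy : y ∈ B) (a b : X) :
    fderiv ℝ (fderiv ℝ e) y a b = fderiv ℝ (fderiv ℝ e) y b a :=
  ((he.contDiffAt hy).of_le (ENat.LEInfty.out : (2 : ℕ∞ω) ≤ ∞)).isSymmSndFDerivAt (by simp) a b

lemma symm₃ (he : IsRadialMap G Ω e B) {y : X} (hy : y ∈ B) (x u : X) :
    fderiv ℝ (fderiv ℝ (fderiv ℝ e)) y u x x = fderiv ℝ (fderiv ℝ (fderiv ℝ e)) y x x u := by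
  have h1 : fderiv ℝ (fderiv ℝ (fderiv ℝ e)) y u x = fderiv ℝ (fderiv ℝ (fderiv ℝ e)) y x u :=
    ((he.contDiffAt₁ hy).of_le (ENat.LEInfty.out : (2 : ℕ∞ω) ≤ ∞)).isSymmSndFDerivAt (by simp) u x
  rw [h1]
  have h := fun u v => hasFDerivAt_apply_apply
    ((he.contDiffAt₂ hy).differentiableAt (by simp)).hasFDerivAt u v
  have heq : (fun z => fderiv ℝ (fderiv ℝ e) z u x) =ᶠ[𝓝 y]
      fun z => fderiv ℝ (fderiv ℝ e) z x u := by
    filter_upwards [he.isOpen.mem_nhds hy] with z hz using he.symm₂ hz u x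
  have := ((h u x).congr_of_eventuallyEq heq.symm).unique (h x u)
  exact congrArg (fun L : X →L[ℝ] V => L x) this

variable [FiniteDimensional ℝ V]

/-- The linearized geodesic equation, obtained by differentiating the geodesic equation with
respect to the direction of the ray. -/
lemma linearized (he : IsRadialMap G Ω e B) (hG : IsLocalMetric G Ω) {x : X} {t : ℝ}
    (ht : t • x ∈ B) (u : X) :
    t • fderiv ℝ (fderiv ℝ (fderiv ℝ e)) (t • x) x x u +
      (2 : ℝ) • fderiv ℝ (fderiv ℝ e) (t • x) x u +
      t • fderiv ℝ (christoffelL G) (e (t • x)) (fderiv ℝ e (t • x) u) (fderiv ℝ e (t • x) x)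
        (fderiv ℝ e (t • x) x) +
      (2 : ℝ) • christoffelL G (e (t • x)) (fderiv ℝ e (t • x) x)
        (t • fderiv ℝ (fderiv ℝ e) (t • x) x u + fderiv ℝ e (t • x) u) = 0 := by
  have hl : HasDerivAt (fun s : ℝ => x + s • u) u 0 := by
    simpa using ((hasDerivAt_id (0 : ℝ)).smul_const u).const_add x
  have hx0 : x + (0 : ℝ) • u = x := by simp
  have h0 := hasDerivAt_comp_smul_add u ((he.contDiffAt ht).differentiableAt (by simp))
  have h1 := hasDerivAt_comp_smul_add u ((he.contDiffAt₁ ht).differentiableAt (by simp))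
  have h2 := hasDerivAt_comp_smul_add u ((he.contDiffAt₂ ht).differentiableAt (by simp))
  have hq := h1.clm_apply hl
  have hacc := (h2.clm_apply hl).clm_apply hl
  have hΓ := HasDerivAt.bilin (B := christoffelL G) (γ := fun s : ℝ => e (t • (x + s • u)))
    (t := 0) (by rw [hx0]; exact hG.differentiableAt_christoffelL (he.mapsTo _ ht)) h0 hq hq
  have hsum := hacc.add hΓ
  have hzero : (fun s : ℝ => fderiv ℝ (fderiv ℝ e) (t • (x + s • u)) (x + s • u) (x + s • u)) +
      (fun s : ℝ => christoffelL G (e (t • (x + s • u)))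
        (fderiv ℝ e (t • (x + s • u)) (x + s • u)) (fderiv ℝ e (t • (x + s • u)) (x + s • u)))
      =ᶠ[𝓝 0] fun _ => 0 := by
    have hmem : ∀ᶠ s : ℝ in 𝓝 0, t • (x + s • u) ∈ B :=
      (hl.const_smul t).continuousAt.eventually_mem (by simpa using he.isOpen.mem_nhds ht)
    filter_upwards [hmem] with s hs
    exact he.geodesic (x + s • u) t hs
  have key := (hsum.congr_of_eventuallyEq hzero.symm).unique (hasDerivAt_const (0 : ℝ) (0 : V))
  simp only [hx0, map_smul, add_apply, smul_apply] at key
  rw [he.symm₂ ht u x, he.symm₃ ht] at key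
  rw [hG.christoffel_symm (he.mapsTo _ ht) (t • _ + _)] at key
  rw [← key]
  module

/-- The covariant derivative, along the ray through `x`, of the field `r ↦ De(r x) u`. -/
noncomputable def covDeriv (G : V → V →L[ℝ] V →L[ℝ] ℝ) (e : X → V) (x u : X) (t : ℝ) : V :=
  fderiv ℝ (fderiv ℝ e) (t • x) x u +
    christoffelL G (e (t • x)) (fderiv ℝ e (t • x) x) (fderiv ℝ e (t • x) u)

/-- The Jacobi equation for the field `J(t) = t De(t x) u` along the ray through `x`, written for
`De(t x) u = J(t) / t`. -/
lemma jacobi (he : IsRadialMap G Ω e B) (hG : IsLocalMetric G Ω) {x : X} {t : ℝ}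
    (ht : t • x ∈ B) (u : X) :
    HasDerivAt (covDeriv G e x u) (deriv (covDeriv G e x u) t) t ∧
    t • (deriv (covDeriv G e x u) t +
        christoffelL G (e (t • x)) (fderiv ℝ e (t • x) x) (covDeriv G e x u t)) +
      (2 : ℝ) • covDeriv G e x u t =
      t • riemannL G (e (t • x)) (fderiv ℝ e (t • x) x) (fderiv ℝ e (t • x) u)
        (fderiv ℝ e (t • x) x) := by
  have hΩ := he.mapsTo _ ht
  have h := (he.hasDerivAt₂ ht x u).add (HasDerivAt.bilin (B := christoffelL G)
    (hG.differentiableAt_christoffelL hΩ) (he.hasDerivAt₀ ht) (he.hasDerivAt₁ ht x)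
    (he.hasDerivAt₁ ht u))
  have h' : HasDerivAt (covDeriv G e x u) _ t := h
  refine ⟨h'.differentiableAt.hasDerivAt, ?_⟩
  rw [h'.deriv, covDeriv, riemannL_apply]
  have hlin := he.linearized hG ht u
  have hgeo := eq_neg_of_add_eq_zero_left (he.geodesic x t ht)
  rw [hgeo]
  rw [hG.fderiv_christoffel_symm hΩ (fderiv ℝ e (t • x) x) (fderiv ℝ e (t • x) u),
    hG.christoffel_symm hΩ (fderiv ℝ e (t • x) u) (fderiv ℝ e (t • x) x),
    hG.christoffel_symm hΩ (fderiv ℝ e (t • x) u) (christoffelL G _ _ _)]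
  simp only [map_add, map_smul, map_neg, neg_apply] at hlin ⊢
  rw [← sub_eq_zero]
  rw [← hlin]
  module

/-- The Gauss lemma. -/
theorem gauss (he : IsRadialMap G Ω e B) (hG : IsLocalMetric G Ω) {x : X}
    (hx : ∀ t ∈ Icc (0 : ℝ) 1, t • x ∈ B) (u : X) :
    G (e x) (fderiv ℝ e x x) (fderiv ℝ e x u) = G (e 0) (fderiv ℝ e 0 x) (fderiv ℝ e 0 u) := by
  -- `f` is the inner product of the velocity with `De(t x) u`, and `t² f'` is constant
  let f : ℝ → ℝ := fun t => G (e (t • x)) (fderiv ℝ e (t • x) x) (fderiv ℝ e (t • x) u)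
  let f' : ℝ → ℝ := fun t => G (e (t • x)) (fderiv ℝ e (t • x) x) (covDeriv G e x u t)
  have hf : ∀ t ∈ Icc (0 : ℝ) 1, HasDerivAt f (f' t) t := by
    intro t ht
    have h := hG.hasDerivAt_metric (he.mapsTo _ (hx t ht)) (he.hasDerivAt₀ (hx t ht))
      (he.hasDerivAt₁ (hx t ht) x) (he.hasDerivAt₁ (hx t ht) u)
    rw [he.geodesic x t (hx t ht)] at h
    simpa [f, f', covDeriv] using h
  have hf2 : ∀ t ∈ Icc (0 : ℝ) 1, HasDerivAt (fun t => t ^ 2 * f' t) 0 t := by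
    intro t ht
    obtain ⟨hd, hj⟩ := he.jacobi hG (hx t ht) u
    have h := hG.hasDerivAt_metric (he.mapsTo _ (hx t ht)) (he.hasDerivAt₀ (hx t ht))
      (he.hasDerivAt₁ (hx t ht) x) hd
    rw [he.geodesic x t (hx t ht)] at h
    have hR : G (e (t • x)) (fderiv ℝ e (t • x) x) (riemannL G (e (t • x)) (fderiv ℝ e (t • x) x)
        (fderiv ℝ e (t • x) u) (fderiv ℝ e (t • x) x)) = 0 := by
      have h1 := hG.riemannL_skew (he.mapsTo _ (hx t ht)) (fderiv ℝ e (t • x) x)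
        (fderiv ℝ e (t • x) u) (fderiv ℝ e (t • x) x) (fderiv ℝ e (t • x) x)
      rw [hG.symm _ (he.mapsTo _ (hx t ht))] at h1
      linarith
    have hj' := congrArg (G (e (t • x)) (fderiv ℝ e (t • x) x)) hj
    rw [map_smul, hR] at hj'
    simp only [map_add, map_smul, smul_eq_mul] at hj'
    convert! ((hasDerivAt_pow 2 t).mul h) using 1
    simp only [map_add, map_zero, zero_apply]
    linear_combination (-t) * hj'
  have hf'0 : ∀ t ∈ Icc (0 : ℝ) 1, f' t = 0 := by
    intro t ht
    rcases ht.1.eq_or_lt with rfl | hpos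
    · obtain ⟨-, hj⟩ := he.jacobi hG (hx 0 ht) u
      simp only [zero_smul, zero_add] at hj
      have : covDeriv G e x u 0 = 0 := (smul_eq_zero.1 hj).resolve_left (by norm_num)
      simp [f', this]
    · have hc := constant_of_has_deriv_right_zero (f := fun t => t ^ 2 * f' t) (a := 0) (b := 1)
        (fun s hs => (hf2 s hs).continuousAt.continuousWithinAt)
        (fun s hs => (hf2 s (Ico_subset_Icc_self hs)).hasDerivWithinAt) t ht
      have : t ^ 2 * f' t = 0 := by simpa using hc
      exact (mul_eq_zero.1 this).resolve_left (by positivity)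
  have hc := constant_of_has_deriv_right_zero (f := f) (a := 0) (b := 1)
    (fun s hs => (hf s hs).continuousAt.continuousWithinAt)
    (fun s hs => by
      have := (hf s (Ico_subset_Icc_self hs)).hasDerivWithinAt (s := Ici s)
      rwa [hf'0 s (Ico_subset_Icc_self hs)] at this) 1 ⟨zero_le_one, le_rfl⟩
  simpa [f] using hc

end IsRadialMap

end Radial

/-! ### Taylor coefficients of the metric in normal coordinates -/

section Taylor

/-- A smooth solution `k` of `t k'' + 2 k' = 2 t ψ` has Taylor coefficients `k₁ = 0`,
`k₂ = ψ(0) / 3` and `k₃ = ψ'(0) / 6` at `0`. -/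
lemma taylor_of_singular_ode {k k' k'' ψ K₁ K₂ K₃ : ℝ → ℝ} {ψ₁ : ℝ}
    (hk : ∀ᶠ t in 𝓝 0, HasDerivAt k (k' t) t) (hk' : ∀ᶠ t in 𝓝 0, HasDerivAt k' (k'' t) t)
    (hode : ∀ᶠ t in 𝓝 0, t * k'' t + 2 * k' t = 2 * (t * ψ t)) (hψ : HasDerivAt ψ ψ₁ 0)
    (hK₁ : ContDiff ℝ ∞ K₁) (hK₂ : ContDiff ℝ ∞ K₂) (hK₃ : ContDiff ℝ ∞ K₃)
    (e₁ : ∀ᶠ t in 𝓝 0, k t = k 0 + t * K₁ t) (e₂ : ∀ t, K₁ t = K₁ 0 + t * K₂ t)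
    (e₃ : ∀ t, K₂ t = K₂ 0 + t * K₃ t) :
    K₁ 0 = 0 ∧ K₂ 0 = ψ 0 / 3 ∧ K₃ 0 = ψ₁ / 6 := by
  have d : ∀ {f : ℝ → ℝ}, ContDiff ℝ ∞ f → ∀ t, HasDerivAt f (deriv f t) t := fun hf t =>
    (hf.differentiable (by simp) t).hasDerivAt
  have dd : ∀ {f : ℝ → ℝ}, ContDiff ℝ ∞ f → ContDiff ℝ ∞ (deriv f) := fun hf =>
    (contDiff_infty_iff_deriv.1 hf).2
  have f1 : ∀ᶠ t in 𝓝 (0 : ℝ), k' t = K₁ t + t * deriv K₁ t := by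
    filter_upwards [e₁.eventually_nhds, hk] with t ht hkt
    have h := (((hasDerivAt_id t).mul (d hK₁ t)).const_add (k 0)).congr_of_eventuallyEq ht
    rw [hkt.unique h]
    simp
  have f2 : ∀ᶠ t in 𝓝 (0 : ℝ), k'' t = 2 * deriv K₁ t + t * deriv (deriv K₁) t := by
    filter_upwards [f1.eventually_nhds, hk'] with t ht hkt
    have h := ((d hK₁ t).add ((hasDerivAt_id t).mul (d (dd hK₁) t))).congr_of_eventuallyEq ht
    rw [hkt.unique h]
    simp
    ring
  have hK10 : K₁ 0 = 0 := by
    have h1 := hode.self_of_nhds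
    have h2 := f1.self_of_nhds
    simp only [zero_mul, zero_add, mul_zero, add_zero] at h1 h2
    linarith
  have g1 : ∀ t, deriv K₁ t = K₂ t + t * deriv K₂ t := by
    intro t
    have h : HasDerivAt K₁ _ t := (((hasDerivAt_id t).mul (d hK₂ t)).const_add (K₁ 0)
      ).congr_of_eventuallyEq (Eventually.of_forall e₂)
    rw [h.deriv]
    simp
  have g2 : ∀ t, deriv (deriv K₁) t = 2 * deriv K₂ t + t * deriv (deriv K₂) t := by
    intro t
    have h : HasDerivAt (deriv K₁) _ t := ((d hK₂ t).add ((hasDerivAt_id t).mul (d (dd hK₂) t))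
      ).congr_of_eventuallyEq (Eventually.of_forall g1)
    rw [h.deriv]
    simp
    ring
  have hder : deriv K₂ 0 = K₃ 0 := by
    have h : HasDerivAt K₂ _ 0 := (((hasDerivAt_id 0).mul (d hK₃ 0)).const_add (K₂ 0)
      ).congr_of_eventuallyEq (Eventually.of_forall e₃)
    rw [h.deriv]
    simp
  -- the equation divided by `t`, with `k''` and `k'` written in terms of `K₂`
  let Λ : ℝ → ℝ := fun t => 6 * K₂ t + 6 * (t * deriv K₂ t) + t ^ 2 * deriv (deriv K₂) t
  have hΛd : HasDerivAt Λ (12 * deriv K₂ 0) 0 := by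
    have h := (((d hK₂ 0).const_mul 6).add (((hasDerivAt_id 0).mul (d (dd hK₂) 0)).const_mul 6)).add
      ((hasDerivAt_pow 2 0).mul (d (dd (dd hK₂)) 0))
    convert! h using 1
    simp
    ring
  have hne : ∀ᶠ t in 𝓝[≠] (0 : ℝ), Λ t = 2 * ψ t := by
    filter_upwards [hode.filter_mono nhdsWithin_le_nhds, f1.filter_mono nhdsWithin_le_nhds,
      f2.filter_mono nhdsWithin_le_nhds, self_mem_nhdsWithin] with t h1 h2 h3 h4
    have h4 : t ≠ 0 := h4
    rw [h2, h3, g2, g1, e₂, hK10] at h1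
    refine mul_left_cancel₀ h4 ?_
    simp only [Λ]
    linarith
  have h0 : Λ 0 = 2 * ψ 0 :=
    tendsto_nhds_unique ((hΛd.continuousAt.tendsto.mono_left nhdsWithin_le_nhds).congr' hne)
      ((hψ.continuousAt.const_mul 2).tendsto.mono_left nhdsWithin_le_nhds)
  have hall : Λ =ᶠ[𝓝 0] fun t => 2 * ψ t := by
    rw [← nhdsNE_sup_pure, EventuallyEq, eventually_sup]
    exact ⟨hne, by simpa using h0⟩
  have h12 := hΛd.unique ((hψ.const_mul 2).congr_of_eventuallyEq hall)
  refine ⟨hK10, ?_, ?_⟩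
  · simp [Λ] at h0
    linarith
  · rw [hder] at h12
    linarith

variable {X V : Type*} [NormedAddCommGroup X] [NormedSpace ℝ X]
  [NormedAddCommGroup V] [NormedSpace ℝ V] [FiniteDimensional ℝ V]
  {G : V → V →L[ℝ] V →L[ℝ] ℝ} {Ω : Set V} {e : X → V} {B : Set X}

/-- The covariant derivative of the curvature, applied to vector fields along a curve with given
covariant derivatives. -/
lemma IsLocalMetric.hasDerivAt_curvature (hG : IsLocalMetric G Ω) {γ a b c d : ℝ → V}
    {γ' a' b' c' d' : V} {t : ℝ} (ht : γ t ∈ Ω) (hγ : HasDerivAt γ γ' t)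
    (ha : HasDerivAt a a' t) (hb : HasDerivAt b b' t) (hc : HasDerivAt c c' t)
    (hd : HasDerivAt d d' t)
    (ha0 : a' + christoffelL G (γ t) γ' (a t) = 0) (hb0 : b' + christoffelL G (γ t) γ' (b t) = 0)
    (hc0 : c' + christoffelL G (γ t) γ' (c t) = 0) (hd0 : d' + christoffelL G (γ t) γ' (d t) = 0) :
    HasDerivAt (fun r => G (γ r) (riemannL G (γ r) (a r) (b r) (c r)) (d r))
      (G (γ t) (nablaRiemann G (γ t) γ' (a t) (b t) (c t)) (d t)) t := by
  have hR := (hG.contDiffAt_riemannL ht).differentiableAt (by simp)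
  have h1 := (HasDerivAt.bilin (B := riemannL G) hR hγ ha hb).clm_apply hc
  have h2 := hG.hasDerivAt_metric ht hγ h1 hd
  rw [hd0, map_zero, add_zero] at h2
  convert! h2 using 1
  have hf : fderiv ℝ (fun x => riemann G x (a t) (b t) (c t)) (γ t) γ' =
      fderiv ℝ (riemannL G) (γ t) γ' (a t) (b t) (c t) := by
    have heq : (fun x => riemann G x (a t) (b t) (c t)) =ᶠ[𝓝 (γ t)]
        fun x => riemannL G x (a t) (b t) (c t) := by
      filter_upwards [hG.isOpen.mem_nhds ht] with x hx using (hG.riemannL_eq_riemann hx _ _ _).symm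
    rw [heq.fderiv_eq]
    have h := (hasFDerivAt_apply_apply hR.hasFDerivAt (a t) (b t)).clm_apply
      (hasFDerivAt_const (c t) (γ t))
    rw [h.fderiv]
    simp
  rw [nablaRiemann, nabla, hf]
  simp only [← hG.riemannL_eq_riemann ht, ← christoffelL_apply]
  rw [eq_neg_of_add_eq_zero_left ha0, eq_neg_of_add_eq_zero_left hb0,
    eq_neg_of_add_eq_zero_left hc0]
  congr 2
  simp only [map_neg, neg_apply, add_apply]
  abel

/-- The expansion of the metric in normal coordinates along a ray, up to third order. By the Jacobi
equation the coefficient `k` of the metric satisfies `t k'' + 2 k' = 2 t ψ`, where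
`ψ = g(R(p, j_u) p, j_v) + g(∇j_u, ∇j_v)` with `p` the velocity of the ray and `j_u = De(t x) u`;
the second term vanishes to second order at `0`, so `ψ` and `ψ'` are given there by `R` and `∇R`. -/
theorem IsRadialMap.taylor (he : IsRadialMap G Ω e B) (hG : IsLocalMetric G Ω) (h0 : (0 : X) ∈ B)
    (x u v : X) {k K₁ K₂ K₃ : ℝ → ℝ}
    (hk : ∀ᶠ t : ℝ in 𝓝 0, k t = G (e (t • x)) (fderiv ℝ e (t • x) u) (fderiv ℝ e (t • x) v))
    (hK₁ : ContDiff ℝ ∞ K₁) (hK₂ : ContDiff ℝ ∞ K₂) (hK₃ : ContDiff ℝ ∞ K₃)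
    (e₁ : ∀ t, k t = k 0 + t * K₁ t) (e₂ : ∀ t, K₁ t = K₁ 0 + t * K₂ t)
    (e₃ : ∀ t, K₂ t = K₂ 0 + t * K₃ t) :
    k 0 = G (e 0) (fderiv ℝ e 0 u) (fderiv ℝ e 0 v) ∧ K₁ 0 = 0 ∧
    K₂ 0 = G (e 0) (riemann G (e 0) (fderiv ℝ e 0 x) (fderiv ℝ e 0 u) (fderiv ℝ e 0 x))
      (fderiv ℝ e 0 v) / 3 ∧
    K₃ 0 = G (e 0) (nablaRiemann G (e 0) (fderiv ℝ e 0 x) (fderiv ℝ e 0 x) (fderiv ℝ e 0 u)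
      (fderiv ℝ e 0 x)) (fderiv ℝ e 0 v) / 6 := by
  refine ⟨by simpa using hk.self_of_nhds, ?_⟩
  have hmem : ∀ᶠ t : ℝ in 𝓝 0, t • x ∈ B := by
    have : ContinuousAt (fun t : ℝ => t • x) 0 := by fun_prop
    exact this.eventually_mem (by simpa using he.isOpen.mem_nhds h0)
  have h0' : (0 : ℝ) • x ∈ B := by simpa using h0
  let γ : ℝ → V := fun t => e (t • x)
  let p : ℝ → V := fun t => fderiv ℝ e (t • x) x
  let j : X → ℝ → V := fun u t => fderiv ℝ e (t • x) u
  -- the first and second covariant derivatives of `j u` along the ray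
  let D : X → ℝ → V := fun u => covDeriv G e x u
  let DD : X → ℝ → V := fun u t => deriv (D u) t + christoffelL G (γ t) (p t) (D u t)
  have hD0 : ∀ u, D u 0 = 0 := by
    intro u
    obtain ⟨-, hj⟩ := he.jacobi hG h0' u
    simp only [zero_smul ℝ (_ : V), zero_add] at hj
    exact (smul_eq_zero.1 hj).resolve_left (by norm_num)
  have hj : ∀ u, ∀ t : ℝ, t • x ∈ B → HasDerivAt (j u) (fderiv ℝ (fderiv ℝ e) (t • x) x u) t :=
    fun u t ht => he.hasDerivAt₁ ht u
  let ψ : ℝ → ℝ := fun t => G (γ t) (riemannL G (γ t) (p t) (j u t) (p t)) (j v t) +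
    G (γ t) (D u t) (D v t)
  have hψ : HasDerivAt ψ (G (e 0) (nablaRiemann G (e 0) (fderiv ℝ e 0 x) (fderiv ℝ e 0 x)
      (fderiv ℝ e 0 u) (fderiv ℝ e 0 x)) (fderiv ℝ e 0 v)) 0 := by
    have h1 := hG.hasDerivAt_curvature (he.mapsTo _ h0') (he.hasDerivAt₀ h0')
      (he.hasDerivAt₁ h0' x) (he.hasDerivAt₁ h0' u) (he.hasDerivAt₁ h0' x)
      (he.hasDerivAt₁ h0' v) (hD0 x) (hD0 u) (hD0 x) (hD0 v)
    have h2 := hG.hasDerivAt_metric (he.mapsTo _ h0') (he.hasDerivAt₀ h0')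
      (he.jacobi hG h0' u).1 (he.jacobi hG h0' v).1
    convert! h1.add h2 using 1
    have hu := hD0 u
    have hv := hD0 v
    simp only [D] at hu hv
    rw [hu, hv]
    simp
  have main := taylor_of_singular_ode (k := k)
    (k' := fun t => G (γ t) (D u t) (j v t) + G (γ t) (j u t) (D v t))
    (k'' := fun t => G (γ t) (DD u t) (j v t) + G (γ t) (D u t) (D v t) +
      (G (γ t) (D u t) (D v t) + G (γ t) (j u t) (DD v t))) (ψ := ψ) ?_ ?_ ?_ hψ hK₁ hK₂ hK₃
      (Eventually.of_forall e₁) e₂ e₃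
  · obtain ⟨m1, m2, m3⟩ := main
    refine ⟨m1, ?_, m3⟩
    rw [m2, ← hG.riemannL_eq_riemann (he.mapsTo _ h0)]
    simp [ψ, hD0, γ, p, j]
  · filter_upwards [hmem, hk.eventually_nhds] with t ht hkt
    have h := hG.hasDerivAt_metric (he.mapsTo _ ht) (he.hasDerivAt₀ ht) (hj u t ht) (hj v t ht)
    exact h.congr_of_eventuallyEq hkt
  · filter_upwards [hmem] with t ht
    have h1 := hG.hasDerivAt_metric (he.mapsTo _ ht) (he.hasDerivAt₀ ht)
      (he.jacobi hG ht u).1 (hj v t ht)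
    have h2 := hG.hasDerivAt_metric (he.mapsTo _ ht) (he.hasDerivAt₀ ht)
      (hj u t ht) (he.jacobi hG ht v).1
    exact h1.add h2
  · filter_upwards [hmem] with t ht
    have hΩ := he.mapsTo _ ht
    have h1 := congrArg (fun w => G (γ t) w (j v t)) (he.jacobi hG ht u).2
    have h2 := congrArg (fun w => G (γ t) (j u t) w) (he.jacobi hG ht v).2
    have h3 : G (γ t) (j u t) (riemannL G (γ t) (p t) (j v t) (p t)) =
        G (γ t) (riemannL G (γ t) (p t) (j u t) (p t)) (j v t) := by
      rw [hG.symm _ hΩ, hG.riemannL_pair hΩ]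
    simp only [map_add, map_smul, add_apply, smul_apply, smul_eq_mul] at h1 h2
    simp only [DD, D, ψ, map_add, add_apply]
    change _ = t * G (γ t) (riemannL G (γ t) (p t) (j u t) (p t)) (j v t) at h1
    change _ = t * G (γ t) (j u t) (riemannL G (γ t) (p t) (j v t) (p t)) at h2
    rw [h3] at h2
    linear_combination h1 + h2

end Taylor

/-! ### Change of coordinates for the geodesic equation -/

section CoordinateChange

variable {V : Type*} [NormedAddCommGroup V] [NormedSpace ℝ V] [FiniteDimensional ℝ V]
  {G G' : V → V →L[ℝ] V →L[ℝ] ℝ} {Ω Ω' : Set V}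

/-- The transformation law of the Christoffel symbols under an isometry `φ`. -/
lemma IsLocalMetric.christoffel_comp (hG : IsLocalMetric G Ω) (hG' : IsLocalMetric G' Ω')
    {φ : V → V} {y : V} (hy : y ∈ Ω) (hφy : φ y ∈ Ω') (hφ : ContDiffAt ℝ ∞ φ y)
    (hiso : ∀ᶠ x in 𝓝 y, ∀ u v, G x u v = G' (φ x) (fderiv ℝ φ x u) (fderiv ℝ φ x v))
    (hsurj : Function.Surjective (fderiv ℝ φ y)) (u v : V) :
    fderiv ℝ (fderiv ℝ φ) y u v + christoffelL G' (φ y) (fderiv ℝ φ y u) (fderiv ℝ φ y v) =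
      fderiv ℝ φ y (christoffelL G y u v) := by
  have hφ1 : DifferentiableAt ℝ (fderiv ℝ φ) y :=
    (hφ.fderiv_right (m := ∞) (by exact_mod_cast le_top)).differentiableAt (by simp)
  have hsym : ∀ a b, fderiv ℝ (fderiv ℝ φ) y a b = fderiv ℝ (fderiv ℝ φ) y b a :=
    (hφ.of_le (ENat.LEInfty.out : (2 : ℕ∞ω) ≤ ∞)).isSymmSndFDerivAt (by simp)
  have hiso0 : ∀ u v, G y u v = G' (φ y) (fderiv ℝ φ y u) (fderiv ℝ φ y v) := hiso.self_of_nhds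
  have hd : ∀ a u v, fderiv ℝ G y a u v =
      fderiv ℝ G' (φ y) (fderiv ℝ φ y a) (fderiv ℝ φ y u) (fderiv ℝ φ y v) +
      G' (φ y) (fderiv ℝ (fderiv ℝ φ) y a u) (fderiv ℝ φ y v) +
      G' (φ y) (fderiv ℝ φ y u) (fderiv ℝ (fderiv ℝ φ) y a v) := by
    intro a u v
    have hl : HasDerivAt (fun s : ℝ => y + s • a) a 0 := by
      simpa using ((hasDerivAt_id (0 : ℝ)).smul_const a).const_add y
    have hy0 : y + (0 : ℝ) • a = y := by simp
    have h1 := hasDerivAt_apply (hasDerivAt_apply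
      ((hG.differentiableAt hy).hasFDerivAt.comp_hasDerivAt_of_eq (0 : ℝ) hl hy0.symm) u) v
    have h2 := fun w => hasDerivAt_apply
      (hφ1.hasFDerivAt.comp_hasDerivAt_of_eq (0 : ℝ) hl hy0.symm) w
    have h3 := (hφ.differentiableAt (by simp)).hasFDerivAt.comp_hasDerivAt_of_eq (0 : ℝ) hl hy0.symm
    have h4 := HasDerivAt.bilin (B := G') (γ := φ ∘ fun s : ℝ => y + s • a) (t := 0)
      (by simpa using hG'.differentiableAt hφy) h3 (h2 u) (h2 v)
    have heq : (fun s : ℝ => G (y + s • a) u v) =ᶠ[𝓝 0] fun s : ℝ =>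
        G' (φ (y + s • a)) (fderiv ℝ φ (y + s • a) u) (fderiv ℝ φ (y + s • a) v) := by
      have : ContinuousAt (fun s : ℝ => y + s • a) 0 := by fun_prop
      filter_upwards [this.eventually (by simpa using hiso)] with s hs using hs u v
    have h5 := h1.unique (h4.congr_of_eventuallyEq heq)
    simpa using h5
  refine hG'.eq_of_forall hφy fun w => ?_
  obtain ⟨z, rfl⟩ := hsurj w
  rw [← hiso0, hG.christoffel_spec hy, hd, hd, hd, map_add, add_apply, hG'.christoffel_spec hφy,
    hsym v u, hsym z u, hsym z v, hG'.symm _ hφy (fderiv ℝ φ y v),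
    hG'.symm _ hφy (fderiv ℝ φ y u)]
  ring

/-- An isometry maps the covariant acceleration of a curve to that of the image curve. -/
lemma IsLocalMetric.acceleration_comp (hG : IsLocalMetric G Ω) (hG' : IsLocalMetric G' Ω')
    {φ : V → V} {c : ℝ → V} {t : ℝ} (hy : c t ∈ Ω) (hφy : φ (c t) ∈ Ω')
    (hφ : ContDiffAt ℝ ∞ φ (c t))
    (hiso : ∀ᶠ x in 𝓝 (c t), ∀ u v, G x u v = G' (φ x) (fderiv ℝ φ x u) (fderiv ℝ φ x v))
    (hsurj : Function.Surjective (fderiv ℝ φ (c t))) (hc : ContDiffAt ℝ 2 c t) :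
    deriv (deriv (φ ∘ c)) t + christoffelL G' (φ (c t)) (deriv (φ ∘ c) t) (deriv (φ ∘ c) t) =
      fderiv ℝ φ (c t) (deriv (deriv c) t + christoffelL G (c t) (deriv c t) (deriv c t)) := by
  have hφe : ∀ᶠ x in 𝓝 (c t), DifferentiableAt ℝ φ x := by
    filter_upwards [(hφ.of_le (by simp : (1 : ℕ∞ω) ≤ ∞)).eventually (by simp)] with x hx
    exact hx.differentiableAt (by simp)
  have hce : ∀ᶠ s in 𝓝 t, DifferentiableAt ℝ c s := by
    filter_upwards [hc.eventually (by simp)] with s hs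
    exact hs.differentiableAt (by simp)
  have hd : ∀ᶠ s in 𝓝 t, deriv (φ ∘ c) s = fderiv ℝ φ (c s) (deriv c s) := by
    filter_upwards [hc.continuousAt.eventually hφe, hce] with s h1 h2
    exact (h1.hasFDerivAt.comp_hasDerivAt s h2.hasDerivAt).deriv
  have hc1 : DifferentiableAt ℝ (deriv c) t := by
    have h1 : DifferentiableAt ℝ (fderiv ℝ c) t :=
      (hc.fderiv_right (m := 1) (by norm_num)).differentiableAt (by simp)
    exact (hasDerivAt_apply h1.hasDerivAt 1).differentiableAt
  have hφ1 : DifferentiableAt ℝ (fderiv ℝ φ) (c t) :=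
    (hφ.fderiv_right (m := ∞) (by exact_mod_cast le_top)).differentiableAt (by simp)
  have h2 := (hφ1.hasFDerivAt.comp_hasDerivAt t hce.self_of_nhds.hasDerivAt).clm_apply
    hc1.hasDerivAt
  rw [hd.self_of_nhds, (h2.congr_of_eventuallyEq hd).deriv, map_add,
    ← hG.christoffel_comp hG' hy hφy hφ hiso hsurj]
  simp only [Function.comp_apply]
  abel

end CoordinateChange

/-! ### The metric in charts -/

section Charts

variable {n : ℕ} {M : Type*} [TopologicalSpace M] [ChartedSpace (Eu (n + 1)) M]
  [IsManifold (𝓡 (n + 1)) ∞ M]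

/-- The inner product `g` at `q`, on the model space to which the tangent space is identified. -/
noncomputable def metricAt (g : RiemMetric n M) (q : M) : Bil (n + 1) := g.inner q

variable {X : Type*} [NormedAddCommGroup X] [NormedSpace ℝ X]

/-- The derivative at `x` of a map from a vector space to `M`, with values in the model space. -/
noncomputable def mder (F : X → M) (x : X) : X →L[ℝ] Eu (n + 1) :=
  mfderiv 𝓘(ℝ, X) (𝓡 (n + 1)) F x

/-- The derivative at `q` of the preferred chart at `x₀`. -/
noncomputable def chartDeriv (n : ℕ) {M : Type*} [TopologicalSpace M]
    [ChartedSpace (Eu (n + 1)) M] (x₀ q : M) : Eu (n + 1) →L[ℝ] Eu (n + 1) :=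
  mfderiv (𝓡 (n + 1)) 𝓘(ℝ, Eu (n + 1)) (extChartAt (𝓡 (n + 1)) x₀) q

lemma chartMetric_apply (g : RiemMetric n M) (x₀ : M) (y u v : Eu (n + 1)) :
    chartMetric g x₀ y u v = metricAt g ((extChartAt (𝓡 (n + 1)) x₀).symm y)
      (mder (extChartAt (𝓡 (n + 1)) x₀).symm y u) (mder (extChartAt (𝓡 (n + 1)) x₀).symm y v) :=
  rfl

omit [IsManifold (𝓡 (n + 1)) ∞ M] in
lemma extChartAt_source_eq (x₀ : M) :
    (extChartAt (𝓡 (n + 1)) x₀).source = (chartAt (Eu (n + 1)) x₀).source :=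
  extChartAt_source _ _

lemma mdifferentiableAt_chart {x₀ q : M} (hq : q ∈ (extChartAt (𝓡 (n + 1)) x₀).source) :
    MDifferentiableAt (𝓡 (n + 1)) 𝓘(ℝ, Eu (n + 1)) (extChartAt (𝓡 (n + 1)) x₀) q :=
  mdifferentiableAt_extChartAt (by rwa [← extChartAt_source_eq])

lemma contMDiffAt_chart_symm {x₀ : M} {y : Eu (n + 1)}
    (hy : y ∈ (extChartAt (𝓡 (n + 1)) x₀).target) :
    ContMDiffAt 𝓘(ℝ, Eu (n + 1)) (𝓡 (n + 1)) ∞ (extChartAt (𝓡 (n + 1)) x₀).symm y :=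
  (contMDiffOn_extChartAt_symm x₀).contMDiffAt ((isOpen_extChartAt_target x₀).mem_nhds hy)

lemma mdifferentiableAt_chart_symm {x₀ : M} {y : Eu (n + 1)}
    (hy : y ∈ (extChartAt (𝓡 (n + 1)) x₀).target) :
    MDifferentiableAt 𝓘(ℝ, Eu (n + 1)) (𝓡 (n + 1)) (extChartAt (𝓡 (n + 1)) x₀).symm y :=
  (contMDiffAt_chart_symm hy).mdifferentiableAt (by simp)

lemma contMDiffAt_chart {x₀ q : M} (hq : q ∈ (extChartAt (𝓡 (n + 1)) x₀).source) :
    ContMDiffAt (𝓡 (n + 1)) 𝓘(ℝ, Eu (n + 1)) ∞ (extChartAt (𝓡 (n + 1)) x₀) q :=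
  contMDiffAt_extChartAt' (by rwa [← extChartAt_source_eq])

/-- The chain rule for a map into `M` followed by a chart. -/
lemma hasFDerivAt_chart_comp {F : X → M} {x : X} {x₀ : M}
    (hF : MDifferentiableAt 𝓘(ℝ, X) (𝓡 (n + 1)) F x)
    (hx : F x ∈ (extChartAt (𝓡 (n + 1)) x₀).source) :
    HasFDerivAt (fun x => extChartAt (𝓡 (n + 1)) x₀ (F x))
      ((chartDeriv n x₀ (F x)).comp (mder F x)) x :=
  hasMFDerivAt_iff_hasFDerivAt.1
    (HasMFDerivAt.comp x (mdifferentiableAt_chart hx).hasMFDerivAt hF.hasMFDerivAt)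

/-- The chain rule for a map into the target of a chart followed by the inverse of the chart. -/
lemma mder_chart_symm_comp {e : X → Eu (n + 1)} {x : X} {x₀ : M}
    (he : DifferentiableAt ℝ e x) (hx : e x ∈ (extChartAt (𝓡 (n + 1)) x₀).target) :
    mder (n := n) (fun x => (extChartAt (𝓡 (n + 1)) x₀).symm (e x)) x =
      (mder (extChartAt (𝓡 (n + 1)) x₀).symm (e x)).comp (fderiv ℝ e x) := by
  have h := HasMFDerivAt.comp x (mdifferentiableAt_chart_symm hx).hasMFDerivAt
    he.hasFDerivAt.hasMFDerivAt
  exact h.mfderiv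

omit [IsManifold (𝓡 (n + 1)) ∞ M] in
lemma mder_congr {F F' : X → M} {x : X} (h : F =ᶠ[𝓝 x] F') : mder (n := n) F x = mder F' x :=
  h.mfderiv_eq

lemma chartDeriv_mder_symm {x₀ : M} {y : Eu (n + 1)}
    (hy : y ∈ (extChartAt (𝓡 (n + 1)) x₀).target) (u : Eu (n + 1)) :
    chartDeriv n x₀ ((extChartAt (𝓡 (n + 1)) x₀).symm y)
      (mder (extChartAt (𝓡 (n + 1)) x₀).symm y u) = u := by
  have h := hasFDerivAt_chart_comp (mdifferentiableAt_chart_symm hy)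
    ((extChartAt (𝓡 (n + 1)) x₀).map_target hy)
  have heq : (fun y => extChartAt (𝓡 (n + 1)) x₀ ((extChartAt (𝓡 (n + 1)) x₀).symm y)) =ᶠ[𝓝 y]
      id := by
    filter_upwards [(isOpen_extChartAt_target x₀).mem_nhds hy] with z hz
    exact (extChartAt (𝓡 (n + 1)) x₀).right_inv hz
  have := (h.congr_of_eventuallyEq heq.symm).unique (hasFDerivAt_id y)
  exact congrArg (fun L : Eu (n + 1) →L[ℝ] Eu (n + 1) => L u) this

/-- The metric in the chart at `x₀`, on coordinate expressions of tangent vectors. -/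
lemma chartMetric_comp (g : RiemMetric n M) {F : X → M} {x : X} {x₀ : M}
    (hF : MDifferentiableAt 𝓘(ℝ, X) (𝓡 (n + 1)) F x)
    (hx : F x ∈ (extChartAt (𝓡 (n + 1)) x₀).source) (u v : X) :
    chartMetric g x₀ (extChartAt (𝓡 (n + 1)) x₀ (F x))
      (fderiv ℝ (fun x => extChartAt (𝓡 (n + 1)) x₀ (F x)) x u)
      (fderiv ℝ (fun x => extChartAt (𝓡 (n + 1)) x₀ (F x)) x v) =
    metricAt g (F x) (mder F x u) (mder F x v) := by
  have he := (hasFDerivAt_chart_comp hF hx).differentiableAt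
  have h := mder_chart_symm_comp (x₀ := x₀) he ((extChartAt (𝓡 (n + 1)) x₀).map_source hx)
  have heq : (fun x => (extChartAt (𝓡 (n + 1)) x₀).symm (extChartAt (𝓡 (n + 1)) x₀ (F x))) =ᶠ[𝓝 x]
      F := by
    filter_upwards [hF.continuousAt.eventually_mem
      ((isOpen_extChartAt_source x₀).mem_nhds hx)] with z hz
    exact (extChartAt (𝓡 (n + 1)) x₀).left_inv hz
  rw [mder_congr heq] at h
  rw [chartMetric_apply, h, (extChartAt (𝓡 (n + 1)) x₀).left_inv hx]
  rfl

theorem isLocalMetric_chartMetric (g : RiemMetric n M) (x₀ : M) :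
    IsLocalMetric (chartMetric g x₀) (extChartAt (𝓡 (n + 1)) x₀).target where
  isOpen := isOpen_extChartAt_target x₀
  symm y _ u v := g.symm _ _ _
  pos y hy v hv := by
    rw [chartMetric_apply]
    refine g.pos _ _ fun h => hv ?_
    have h1 := chartDeriv_mder_symm hy v
    rw [← h1]
    exact (congrArg (chartDeriv n x₀ _) h).trans (map_zero _)
  contDiffOn := by
    rw [contDiffOn_clm_apply]
    intro u
    rw [contDiffOn_clm_apply]
    intro v
    have hopen : IsOpen (extChartAt (𝓡 (n + 1)) x₀).target := isOpen_extChartAt_target x₀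
    have hsymm := contMDiffOn_extChartAt_symm (I := 𝓡 (n + 1)) (n := ∞) x₀
    have hsec : ∀ u : Eu (n + 1), ContMDiffOn 𝓘(ℝ, Eu (n + 1)) (𝓡 (n + 1)).tangent ∞
        (fun y => Bundle.TotalSpace.mk' (Eu (n + 1)) (E := fun x : M => TangentSpace (𝓡 (n + 1)) x)
          ((extChartAt (𝓡 (n + 1)) x₀).symm y)
          (mfderiv 𝓘(ℝ, Eu (n + 1)) (𝓡 (n + 1)) (extChartAt (𝓡 (n + 1)) x₀).symm y u))
        (extChartAt (𝓡 (n + 1)) x₀).target := by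
      intro u
      have hu : ContMDiffOn 𝓘(ℝ, Eu (n + 1)) 𝓘(ℝ, Eu (n + 1)).tangent ∞
          (fun y => (⟨y, u⟩ : TangentBundle 𝓘(ℝ, Eu (n + 1)) (Eu (n + 1))))
          (extChartAt (𝓡 (n + 1)) x₀).target :=
        contMDiffOn_vectorSpace_iff_contDiffOn.2 contDiffOn_const
      have ht := hsymm.contMDiffOn_tangentMapWithin (m := ∞) (by simp) hopen.uniqueMDiffOn
      refine (ht.comp hu fun y hy => hy).congr fun y hy => ?_
      simp only [Function.comp_apply, tangentMapWithin]
      rw [mfderivWithin_of_isOpen hopen hy]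
    have hg : ContMDiffOn 𝓘(ℝ, Eu (n + 1))
        ((𝓡 (n + 1)).prod 𝓘(ℝ, Eu (n + 1) →L[ℝ] Eu (n + 1) →L[ℝ] ℝ)) ∞
        (fun y => Bundle.TotalSpace.mk' (Eu (n + 1) →L[ℝ] Eu (n + 1) →L[ℝ] ℝ)
          (E := fun x : M => TangentSpace (𝓡 (n + 1)) x →L[ℝ] TangentSpace (𝓡 (n + 1)) x →L[ℝ] ℝ)
          ((extChartAt (𝓡 (n + 1)) x₀).symm y) (g.inner ((extChartAt (𝓡 (n + 1)) x₀).symm y)))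
        (extChartAt (𝓡 (n + 1)) x₀).target :=
      g.contMDiff.comp_contMDiffOn hsymm
    have h : ContMDiffOn 𝓘(ℝ, Eu (n + 1)) ((𝓡 (n + 1)).prod 𝓘(ℝ)) ∞
        (fun y => Bundle.TotalSpace.mk' ℝ (E := Bundle.Trivial M ℝ)
          ((extChartAt (𝓡 (n + 1)) x₀).symm y) (chartMetric g x₀ y u v))
        (extChartAt (𝓡 (n + 1)) x₀).target :=
      ContMDiffOn.clm_bundle_apply₂ (F₁ := Eu (n + 1)) (F₂ := Eu (n + 1)) hg (hsec u) (hsec v)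
    intro y hy
    have h1 := h y hy
    simp only [Bundle.contMDiffWithinAt_totalSpace] at h1
    exact contMDiffWithinAt_iff_contDiffWithinAt.1 h1.2

end Charts

/-! ### Geodesics and their uniqueness -/

section GeodesicUniqueness

variable {V : Type*} [NormedAddCommGroup V] [NormedSpace ℝ V] [FiniteDimensional ℝ V]
  {G : V → V →L[ℝ] V →L[ℝ] ℝ} {Ω : Set V}

/-- The geodesic equation as a first order system on `V × V`. -/
noncomputable def geodesicField (G : V → V →L[ℝ] V →L[ℝ] ℝ) (p : V × V) : V × V :=
  (p.2, -christoffelL G p.1 p.2 p.2)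

lemma IsLocalMetric.contDiffAt_geodesicField (hG : IsLocalMetric G Ω) {p : V × V}
    (hp : p.1 ∈ Ω) : ContDiffAt ℝ ∞ (geodesicField G) p := by
  have h := (hG.contDiffAt_christoffelL hp).comp p contDiffAt_fst
  exact contDiffAt_snd.prodMk ((h.clm_apply contDiffAt_snd).clm_apply contDiffAt_snd).neg

omit [FiniteDimensional ℝ V] in
lemma hasDerivAt_deriv_of_contDiffAt_two {c : ℝ → V} {t : ℝ} (hc : ContDiffAt ℝ 2 c t) :
    HasDerivAt (deriv c) (deriv (deriv c) t) t := by
  have h1 : DifferentiableAt ℝ (fderiv ℝ c) t :=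
    (hc.fderiv_right (m := 1) (by norm_num)).differentiableAt (by simp)
  exact (hasDerivAt_apply h1.hasDerivAt 1).differentiableAt.hasDerivAt

lemma IsLocalMetric.geodesic_unique (hG : IsLocalMetric G Ω) {c₁ c₂ : ℝ → V} {t : ℝ}
    (ht : c₁ t ∈ Ω) (h₁ : ContDiffAt ℝ 2 c₁ t) (h₂ : ContDiffAt ℝ 2 c₂ t)
    (e₁ : ∀ᶠ s in 𝓝 t, deriv (deriv c₁) s + christoffelL G (c₁ s) (deriv c₁ s) (deriv c₁ s) = 0)
    (e₂ : ∀ᶠ s in 𝓝 t, deriv (deriv c₂) s + christoffelL G (c₂ s) (deriv c₂ s) (deriv c₂ s) = 0)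
    (h0 : c₁ t = c₂ t) (h0' : deriv c₁ t = deriv c₂ t) : c₁ =ᶠ[𝓝 t] c₂ := by
  have hp : ContDiffAt ℝ 1 (geodesicField G) (c₁ t, deriv c₁ t) :=
    (hG.contDiffAt_geodesicField ht).of_le (by simp)
  obtain ⟨K, N, hN, hK⟩ := hp.exists_lipschitzOnWith
  have hsol : ∀ c : ℝ → V, ContDiffAt ℝ 2 c t →
      (∀ᶠ s in 𝓝 t, deriv (deriv c) s + christoffelL G (c s) (deriv c s) (deriv c s) = 0) →
      c₁ t = c t → deriv c₁ t = deriv c t →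
      ∀ᶠ s in 𝓝 t, HasDerivAt (fun s => (c s, deriv c s)) (geodesicField G (c s, deriv c s)) s ∧
        (c s, deriv c s) ∈ N := by
    intro c hc he h0 h0'
    have hcont : ContinuousAt (fun s => (c s, deriv c s)) t :=
      hc.continuousAt.prodMk (hasDerivAt_deriv_of_contDiffAt_two hc).continuousAt
    filter_upwards [he, hc.eventually (by simp), hcont.eventually_mem (by rwa [← h0, ← h0'])]
      with s hs hcs hm
    refine ⟨?_, hm⟩
    have h := (hcs.differentiableAt (by simp)).hasDerivAt.prodMk
      (hasDerivAt_deriv_of_contDiffAt_two hcs)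
    rw [eq_neg_of_add_eq_zero_left hs] at h
    exact h
  have h := ODE_solution_unique_of_eventually (v := fun _ => geodesicField G) (s := fun _ => N)
    (Eventually.of_forall fun _ => hK) (hsol c₁ h₁ e₁ rfl rfl) (hsol c₂ h₂ e₂ h0 h0')
    (by rw [h0, h0'])
  filter_upwards [h] with s hs using (Prod.ext_iff.1 hs).1

end GeodesicUniqueness

section Geodesics

variable {n : ℕ} {M : Type*} [TopologicalSpace M] [ChartedSpace (Eu (n + 1)) M]
  [IsManifold (𝓡 (n + 1)) ∞ M] {g : RiemMetric n M}

/-- The geodesic equation at time `t` for a curve in `M`, written in the preferred chart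
at `x₀`. -/
def GeodesicEqAt (g : RiemMetric n M) (x₀ : M) (γ : ℝ → M) (t : ℝ) : Prop :=
  deriv (deriv fun r => extChartAt (𝓡 (n + 1)) x₀ (γ r)) t +
    christoffelL (chartMetric g x₀) (extChartAt (𝓡 (n + 1)) x₀ (γ t))
      (deriv (fun r => extChartAt (𝓡 (n + 1)) x₀ (γ r)) t)
      (deriv (fun r => extChartAt (𝓡 (n + 1)) x₀ (γ r)) t) = 0

lemma contDiffAt_chart_comp {X : Type*} [NormedAddCommGroup X] [NormedSpace ℝ X] {F : X → M}
    {x : X} {k : ℕ∞ω} (hk : k ≤ ∞) {x₀ : M} (hF : ContMDiffAt 𝓘(ℝ, X) (𝓡 (n + 1)) k F x)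
    (hx : F x ∈ (extChartAt (𝓡 (n + 1)) x₀).source) :
    ContDiffAt ℝ k (fun x => extChartAt (𝓡 (n + 1)) x₀ (F x)) x :=
  contMDiffAt_iff_contDiffAt.1 (((contMDiffAt_chart hx).of_le hk).comp x hF)

/-- The geodesic equation does not depend on the chart. -/
lemma GeodesicEqAt.change {γ : ℝ → M} {t : ℝ} {x₀ x₁ : M} (h : GeodesicEqAt g x₀ γ t)
    (hγ : ContMDiffAt 𝓘(ℝ, ℝ) (𝓡 (n + 1)) 2 γ t)
    (h₀ : γ t ∈ (extChartAt (𝓡 (n + 1)) x₀).source)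
    (h₁ : γ t ∈ (extChartAt (𝓡 (n + 1)) x₁).source) : GeodesicEqAt g x₁ γ t := by
  let φ : Eu (n + 1) → Eu (n + 1) := fun y =>
    extChartAt (𝓡 (n + 1)) x₁ ((extChartAt (𝓡 (n + 1)) x₀).symm y)
  let c : ℝ → Eu (n + 1) := fun r => extChartAt (𝓡 (n + 1)) x₀ (γ r)
  have hleft : (extChartAt (𝓡 (n + 1)) x₀).symm (c t) = γ t :=
    (extChartAt (𝓡 (n + 1)) x₀).left_inv h₀
  have hy : c t ∈ (extChartAt (𝓡 (n + 1)) x₀).target := (extChartAt (𝓡 (n + 1)) x₀).map_source h₀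
  have hφt : φ (c t) = extChartAt (𝓡 (n + 1)) x₁ (γ t) := by simp only [φ, hleft]
  have hφy : φ (c t) ∈ (extChartAt (𝓡 (n + 1)) x₁).target := by
    rw [hφt]
    exact (extChartAt (𝓡 (n + 1)) x₁).map_source h₁
  have hφ : ContDiffAt ℝ ∞ φ (c t) :=
    contDiffAt_chart_comp le_rfl (contMDiffAt_chart_symm hy) (by rwa [hleft])
  have hG := isLocalMetric_chartMetric g x₀
  have hiso : ∀ᶠ x in 𝓝 (c t), ∀ u v, chartMetric g x₀ x u v =
      chartMetric g x₁ (φ x) (fderiv ℝ φ x u) (fderiv ℝ φ x v) := by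
    have hcont : ContinuousAt (extChartAt (𝓡 (n + 1)) x₀).symm (c t) :=
      (contMDiffAt_chart_symm hy).continuousAt
    filter_upwards [(isOpen_extChartAt_target x₀).mem_nhds hy, hcont.eventually_mem
      ((isOpen_extChartAt_source x₁).mem_nhds (by rwa [hleft]))] with y hy hy1 u v
    rw [chartMetric_apply]
    exact (chartMetric_comp g (mdifferentiableAt_chart_symm hy) hy1 u v).symm
  have hinj : Function.Injective (fderiv ℝ φ (c t)) := by
    refine (injective_iff_map_eq_zero _).2 fun u hu => ?_
    by_contra hne
    have := hG.pos _ hy u hne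
    rw [hiso.self_of_nhds, hu] at this
    simp at this
  have hsurj : Function.Surjective (fderiv ℝ φ (c t)) :=
    LinearMap.surjective_of_injective
      (f := (fderiv ℝ φ (c t) : Eu (n + 1) →ₗ[ℝ] Eu (n + 1))) hinj
  have hacc := hG.acceleration_comp (isLocalMetric_chartMetric g x₁) (c := c) hy hφy hφ hiso hsurj
    (contDiffAt_chart_comp ENat.LEInfty.out hγ h₀)
  have heq : φ ∘ c =ᶠ[𝓝 t] fun r => extChartAt (𝓡 (n + 1)) x₁ (γ r) := by
    filter_upwards [hγ.continuousAt.eventually_mem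
      ((isOpen_extChartAt_source x₀).mem_nhds h₀)] with s hs
    simp only [φ, c, Function.comp_apply]
    rw [(extChartAt (𝓡 (n + 1)) x₀).left_inv hs]
  have h' : deriv (deriv c) t + christoffelL (chartMetric g x₀) (c t) (deriv c t) (deriv c t) = 0 :=
    h
  rw [h', map_zero, heq.deriv.deriv_eq, heq.deriv_eq, hφt] at hacc
  exact hacc

lemma isGeodesicOn_iff {γ : ℝ → M} {s : Set ℝ} :
    IsGeodesicOn g γ s ↔ ContMDiffOn 𝓘(ℝ, ℝ) (𝓡 (n + 1)) 2 γ s ∧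
      ∀ t ∈ s, GeodesicEqAt g (γ t) γ t := by
  simp only [IsGeodesicOn, GeodesicEqAt, christoffelL_apply]

lemma IsGeodesicOn.contMDiffAt {γ : ℝ → M} {s : Set ℝ} (h : IsGeodesicOn g γ s) (hs : IsOpen s)
    {t : ℝ} (ht : t ∈ s) : ContMDiffAt 𝓘(ℝ, ℝ) (𝓡 (n + 1)) 2 γ t :=
  h.1.contMDiffAt (hs.mem_nhds ht)

lemma IsGeodesicOn.geodesicEqAt {γ : ℝ → M} {s : Set ℝ} (h : IsGeodesicOn g γ s) (hs : IsOpen s)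
    {t : ℝ} (ht : t ∈ s) {x₀ : M} (hx : γ t ∈ (extChartAt (𝓡 (n + 1)) x₀).source) :
    GeodesicEqAt g x₀ γ t :=
  ((isGeodesicOn_iff.1 h).2 t ht).change (h.contMDiffAt hs ht) (mem_extChartAt_source _) hx

lemma IsGeodesicOn.mono {γ : ℝ → M} {s s' : Set ℝ} (h : IsGeodesicOn g γ s) (hs : s' ⊆ s) :
    IsGeodesicOn g γ s' :=
  ⟨h.1.mono hs, fun t ht => h.2 t (hs ht)⟩

/-- A solution of the geodesic equation in a chart is a geodesic. -/
lemma isGeodesicOn_of_chart {x₀ : M} {c : ℝ → Eu (n + 1)} {s : Set ℝ} (hs : IsOpen s)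
    (hc : ContDiffOn ℝ 2 c s) (hcs : ∀ t ∈ s, c t ∈ (extChartAt (𝓡 (n + 1)) x₀).target)
    (heq : ∀ t ∈ s, deriv (deriv c) t +
      christoffelL (chartMetric g x₀) (c t) (deriv c t) (deriv c t) = 0) :
    IsGeodesicOn g (fun t => (extChartAt (𝓡 (n + 1)) x₀).symm (c t)) s := by
  have hsm : ContMDiffOn 𝓘(ℝ, ℝ) (𝓡 (n + 1)) 2
      (fun t => (extChartAt (𝓡 (n + 1)) x₀).symm (c t)) s := fun t ht =>
    (((contMDiffAt_chart_symm (hcs t ht)).of_le ENat.LEInfty.out).comp t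
      (hc.contDiffAt (hs.mem_nhds ht)).contMDiffAt).contMDiffWithinAt
  refine isGeodesicOn_iff.2 ⟨hsm, fun t ht => ?_⟩
  have hsrc := (extChartAt (𝓡 (n + 1)) x₀).map_target (hcs t ht)
  have hev : (fun r => extChartAt (𝓡 (n + 1)) x₀ ((extChartAt (𝓡 (n + 1)) x₀).symm (c r)))
      =ᶠ[𝓝 t] c := by
    filter_upwards [hs.mem_nhds ht] with r hr
    exact (extChartAt (𝓡 (n + 1)) x₀).right_inv (hcs r hr)
  have h0 : GeodesicEqAt g x₀ (fun t => (extChartAt (𝓡 (n + 1)) x₀).symm (c t)) t := by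
    rw [GeodesicEqAt, hev.deriv.deriv_eq, hev.deriv_eq,
      (extChartAt (𝓡 (n + 1)) x₀).right_inv (hcs t ht)]
    exact heq t ht
  exact h0.change (hsm.contMDiffAt (hs.mem_nhds ht)) hsrc (mem_extChartAt_source _)

/-- Geodesics with the same position and the same velocity at time `t` agree near `t`. -/
lemma IsGeodesicOn.eventuallyEq {γ₁ γ₂ : ℝ → M} {s : Set ℝ} (hs : IsOpen s)
    (h₁ : IsGeodesicOn g γ₁ s) (h₂ : IsGeodesicOn g γ₂ s) {t : ℝ} (ht : t ∈ s)
    (h0 : γ₁ t = γ₂ t)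
    (h0' : deriv (fun r => extChartAt (𝓡 (n + 1)) (γ₁ t) (γ₁ r)) t =
      deriv (fun r => extChartAt (𝓡 (n + 1)) (γ₁ t) (γ₂ r)) t) : γ₁ =ᶠ[𝓝 t] γ₂ := by
  have hsrc := (isOpen_extChartAt_source (I := 𝓡 (n + 1)) (γ₁ t)).mem_nhds
    (mem_extChartAt_source (γ₁ t))
  have m₁ := (h₁.contMDiffAt hs ht).continuousAt.eventually_mem hsrc
  have m₂ : ∀ᶠ r in 𝓝 t, γ₂ r ∈ (extChartAt (𝓡 (n + 1)) (γ₁ t)).source :=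
    (h₂.contMDiffAt hs ht).continuousAt.eventually_mem (by rwa [← h0])
  have key := (isLocalMetric_chartMetric g (γ₁ t)).geodesic_unique
    (c₁ := fun r => extChartAt (𝓡 (n + 1)) (γ₁ t) (γ₁ r))
    (c₂ := fun r => extChartAt (𝓡 (n + 1)) (γ₁ t) (γ₂ r)) (t := t)
    (mem_extChartAt_target _)
    (contDiffAt_chart_comp ENat.LEInfty.out (h₁.contMDiffAt hs ht) m₁.self_of_nhds)
    (contDiffAt_chart_comp ENat.LEInfty.out (h₂.contMDiffAt hs ht) m₂.self_of_nhds)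
    (by filter_upwards [m₁, hs.mem_nhds ht] with r hr hrs using h₁.geodesicEqAt hs hrs hr)
    (by filter_upwards [m₂, hs.mem_nhds ht] with r hr hrs using h₂.geodesicEqAt hs hrs hr)
    (by rw [h0]) h0'
  filter_upwards [key, m₁, m₂] with r hr hr1 hr2
  exact (extChartAt (𝓡 (n + 1)) (γ₁ t)).injOn hr1 hr2 hr

/-- A geodesic is determined by its initial velocity. -/
theorem IsGeodesicOn.eqOn [T2Space M] {γ₁ γ₂ : ℝ → M} {ε : ℝ} (hε : 0 < ε)
    (h₁ : IsGeodesicOn g γ₁ (Ioo (-ε) (1 + ε))) (h₂ : IsGeodesicOn g γ₂ (Ioo (-ε) (1 + ε)))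
    (h0 : γ₁ 0 = γ₂ 0) (h0' : mder (n := n) γ₁ 0 (1 : ℝ) = mder γ₂ 0 (1 : ℝ)) :
    EqOn γ₁ γ₂ (Icc 0 1) := by
  have hmem : ∀ t ∈ Icc (0 : ℝ) 1, t ∈ Ioo (-ε) (1 + ε) := fun t ht =>
    ⟨by linarith [ht.1], by linarith [ht.2]⟩
  have hlim : ∀ t ∈ Icc (0 : ℝ) 1, (∀ r ∈ Ico 0 t, γ₁ r = γ₂ r) → γ₁ t = γ₂ t := by
    intro t ht hr
    rcases ht.1.eq_or_lt with rfl | hpos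
    · exact h0
    · refine tendsto_nhds_unique_of_eventuallyEq (l := 𝓝[<] t)
        ((h₁.contMDiffAt isOpen_Ioo (hmem t ht)).continuousAt.tendsto.mono_left
          nhdsWithin_le_nhds)
        ((h₂.contMDiffAt isOpen_Ioo (hmem t ht)).continuousAt.tendsto.mono_left
          nhdsWithin_le_nhds) ?_
      filter_upwards [Ioo_mem_nhdsLT hpos] with r hr' using hr r ⟨hr'.1.le, hr'.2⟩
  have hd : ∀ {γ : ℝ → M} {t : ℝ}, IsGeodesicOn g γ (Ioo (-ε) (1 + ε)) → t ∈ Icc (0 : ℝ) 1 →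
      ∀ x₀, γ t ∈ (extChartAt (𝓡 (n + 1)) x₀).source →
      HasDerivAt (fun r => extChartAt (𝓡 (n + 1)) x₀ (γ r))
        (chartDeriv n x₀ (γ t) (mder γ t 1)) t := by
    intro γ t h ht x₀ hx
    exact (hasFDerivAt_chart_comp ((h.contMDiffAt isOpen_Ioo (hmem t ht)).mdifferentiableAt
      (by simp)) hx).hasDerivAt
  -- the set of times up to which the geodesics agree is closed and open to the right
  let S : Set ℝ := {t | ∀ r ∈ Ico 0 t, γ₁ r = γ₂ r}
  have hS : Icc (0 : ℝ) 1 ⊆ S := by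
    refine IsClosed.Icc_subset_of_forall_exists_gt ?_ ?_ ?_
    · refine isClosed_of_closure_subset fun t ht => ⟨fun r hr => ?_, ?_⟩
      · obtain ⟨t', ht', hS', -⟩ := mem_closure_iff.1 ht (Ioi r) isOpen_Ioi hr.2
        exact hS' r ⟨hr.1, ht'⟩
      · exact (closure_minimal inter_subset_right isClosed_Icc) ht
    · intro r hr
      exact absurd hr.2 (not_lt.2 hr.1)
    · rintro t ⟨hSt, ht⟩ y hy
      have ht' := Ico_subset_Icc_self ht
      have heq := hlim t ht' hSt
      have hsrc := mem_extChartAt_source (I := 𝓡 (n + 1)) (γ₁ t)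
      have d₁ := hd h₁ ht' _ hsrc
      have d₂ := hd h₂ ht' (γ₁ t) (heq ▸ hsrc)
      have hderiv : deriv (fun r => extChartAt (𝓡 (n + 1)) (γ₁ t) (γ₁ r)) t =
          deriv (fun r => extChartAt (𝓡 (n + 1)) (γ₁ t) (γ₂ r)) t := by
        rcases ht.1.eq_or_lt with rfl | hpos
        · rw [d₁.deriv, d₂.deriv, h0', ← heq]
        · rw [d₁.deriv, d₂.deriv]
          refine (uniqueDiffWithinAt_Iic t).eq_deriv _ d₁.hasDerivWithinAt ?_
          refine d₂.hasDerivWithinAt.congr_of_eventuallyEq ?_ (by rw [heq])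
          filter_upwards [Icc_mem_nhdsLE hpos] with r hr
          rcases hr.2.eq_or_lt with rfl | hlt
          · rw [heq]
          · rw [hSt r ⟨hr.1, hlt⟩]
      obtain ⟨b, hb, hbS⟩ := mem_nhds_iff_exists_Ioo_subset.1
        (h₁.eventuallyEq isOpen_Ioo h₂ (hmem t ht') heq hderiv)
      refine ⟨min y ((t + hb) / 2), ?_, ?_, min_le_left _ _⟩
      · intro r hr
        rcases lt_or_ge r t with hrt | hrt
        · exact hSt r ⟨hr.1, hrt⟩
        · refine hbS.2 ⟨hbS.1.1.trans_le hrt, ?_⟩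
          have h3 := hr.2.trans_le (min_le_right _ _)
          linarith [hbS.1.2]
      · refine lt_min hy ?_
        linarith [hbS.1.2]
  exact fun t ht => hlim t ht (hS ht)

/-- The endpoint in the definition of the exponential map is unique. -/
theorem IsExp.unique [T2Space M] {p : M} {v : TangentSpace (𝓡 (n + 1)) p} {q₁ q₂ : M}
    (h₁ : IsExp g p v q₁) (h₂ : IsExp g p v q₂) : q₁ = q₂ := by
  obtain ⟨ε₁, hε₁, γ₁, hγ₁, ht₁, rfl⟩ := h₁
  obtain ⟨ε₂, hε₂, γ₂, hγ₂, ht₂, rfl⟩ := h₂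
  have ht := ht₁.trans ht₂.symm
  have hp : γ₁ 0 = γ₂ 0 := congrArg (fun w : TangentBundle (𝓡 (n + 1)) M => w.1) ht
  have hv : mder (n := n) γ₁ 0 (1 : ℝ) = mder γ₂ 0 (1 : ℝ) :=
    congrArg (fun w : TangentBundle (𝓡 (n + 1)) M => (show Eu (n + 1) from w.2)) ht
  refine IsGeodesicOn.eqOn (lt_min hε₁ hε₂) (hγ₁.mono ?_) (hγ₂.mono ?_) hp hv
    ⟨zero_le_one, le_rfl⟩
  · exact Ioo_subset_Ioo (neg_le_neg (min_le_left _ _)) (by gcongr; exact min_le_left _ _)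
  · exact Ioo_subset_Ioo (neg_le_neg (min_le_right _ _)) (by gcongr; exact min_le_right _ _)

lemma IsExp.expMap_eq [T2Space M] {p : M} {v : TangentSpace (𝓡 (n + 1)) p} {q : M}
    (h : IsExp g p v q) : expMap g p v = q := by
  have hex : ∃ q, IsExp g p v q := ⟨q, h⟩
  rw [expMap, dif_pos hex]
  exact hex.choose_spec.unique h

omit [IsManifold (𝓡 (n + 1)) ∞ M] in
/-- Equality of points of the tangent bundle, with the fibres compared in the model space to which
all of them are definitionally equal. -/
lemma tangentBundle_mk_eq {p q : M} {v : TangentSpace (𝓡 (n + 1)) p}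
    {w : TangentSpace (𝓡 (n + 1)) q} (h : q = p) (hw : (w : Eu (n + 1)) = v) :
    (⟨q, w⟩ : TangentBundle (𝓡 (n + 1)) M) = ⟨p, v⟩ := by
  subst h
  exact congrArg _ hw

lemma mder_symm_chartDeriv {x₀ p : M} (hp : p ∈ (extChartAt (𝓡 (n + 1)) x₀).source)
    (v : Eu (n + 1)) :
    mder (extChartAt (𝓡 (n + 1)) x₀).symm (extChartAt (𝓡 (n + 1)) x₀ p)
      (chartDeriv n x₀ p v) = v := by
  have h := mfderivWithin_extChartAt_symm_comp_mfderiv_extChartAt' (I := 𝓡 (n + 1)) hp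
  rw [ModelWithCorners.range_eq_univ, mfderivWithin_univ] at h
  exact congrArg (fun L : TangentSpace (𝓡 (n + 1)) p →L[ℝ] TangentSpace (𝓡 (n + 1)) p => L v) h

/-- A geodesic computed in a chart gives the exponential map. -/
lemma isExp_of_chart {x₀ p : M} (hp : p ∈ (extChartAt (𝓡 (n + 1)) x₀).source)
    {v : TangentSpace (𝓡 (n + 1)) p} {c : ℝ → Eu (n + 1)} {ε : ℝ} (hε : 0 < ε)
    (hc : ContDiffOn ℝ 2 c (Ioo (-ε) (1 + ε)))
    (hcs : ∀ t ∈ Ioo (-ε) (1 + ε), c t ∈ (extChartAt (𝓡 (n + 1)) x₀).target)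
    (heq : ∀ t ∈ Ioo (-ε) (1 + ε), deriv (deriv c) t +
      christoffelL (chartMetric g x₀) (c t) (deriv c t) (deriv c t) = 0)
    (h0 : c 0 = extChartAt (𝓡 (n + 1)) x₀ p) (h0' : deriv c 0 = chartDeriv n x₀ p v) :
    IsExp g p v ((extChartAt (𝓡 (n + 1)) x₀).symm (c 1)) := by
  refine ⟨ε, hε, _, isGeodesicOn_of_chart isOpen_Ioo hc hcs heq, ?_, rfl⟩
  have hmem : (0 : ℝ) ∈ Ioo (-ε) (1 + ε) := ⟨by linarith, by linarith⟩
  have hd : DifferentiableAt ℝ c 0 :=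
    (hc.contDiffAt (isOpen_Ioo.mem_nhds hmem)).differentiableAt (by simp)
  have h00 : (extChartAt (𝓡 (n + 1)) x₀).symm (c 0) = p := by
    rw [h0, (extChartAt (𝓡 (n + 1)) x₀).left_inv hp]
  refine tangentBundle_mk_eq h00 ?_
  have h1 := mder_chart_symm_comp hd (hcs 0 hmem)
  have h2 := congrArg (fun L : ℝ →L[ℝ] Eu (n + 1) => L 1) h1
  refine h2.trans ?_
  change mder (extChartAt (𝓡 (n + 1)) x₀).symm (c 0) (fderiv ℝ c 0 1) = _
  rw [fderiv_apply_one_eq_deriv, h0', h0]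
  exact mder_symm_chartDeriv hp v

end Geodesics

/-! ### Short geodesics in a chart -/

section LocalExp

lemma contDiff_bump_smul {E F : Type*} [NormedAddCommGroup E] [NormedSpace ℝ E]
    [FiniteDimensional ℝ E] [NormedAddCommGroup F] [NormedSpace ℝ F] {c : E}
    (χ : ContDiffBump c) {f : E → F} (hf : ∀ x ∈ Metric.closedBall c χ.rOut, ContDiffAt ℝ ∞ f x) :
    ContDiff ℝ ∞ (fun x => χ x • f x) := by
  rw [contDiff_iff_contDiffAt]
  intro x
  by_cases hx : x ∈ Metric.closedBall c χ.rOut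
  · exact χ.contDiffAt.smul (hf x hx)
  · have h0 : (fun x => χ x • f x) =ᶠ[𝓝 x] fun _ => 0 := by
      filter_upwards [Metric.isClosed_closedBall.isOpen_compl.mem_nhds hx] with z hz
      rw [χ.zero_of_le_dist (le_of_lt (by simpa using hz)), zero_smul]
    exact contDiffAt_const.congr_of_eventuallyEq h0

lemma contDiffOn_of_hasDerivAt_field {E : Type*} [NormedAddCommGroup E] [NormedSpace ℝ E]
    {f : E → E} (hf : ContDiff ℝ ∞ f) {α : ℝ → E} {s : Set ℝ} (hs : IsOpen s)
    (h : ∀ t ∈ s, HasDerivAt α (f (α t)) t) (k : ℕ) : ContDiffOn ℝ k α s := by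
  induction k with
  | zero => exact contDiffOn_zero.2 fun t ht => (h t ht).continuousAt.continuousWithinAt
  | succ k ih =>
    push_cast
    rw [contDiffOn_succ_iff_deriv_of_isOpen hs]
    refine ⟨fun t ht => (h t ht).differentiableAt.differentiableWithinAt, by simp, ?_⟩
    exact ((hf.of_le (by exact_mod_cast le_top)).comp_contDiffOn ih).congr
      fun t ht => (h t ht).deriv

variable {V : Type} [NormedAddCommGroup V] [NormedSpace ℝ V] [FiniteDimensional ℝ V]
  {G : V → V →L[ℝ] V →L[ℝ] ℝ} {Ω : Set V}

/-- Near a point `y₀`, geodesics with small initial velocity exist on `(-1, 2)`, and their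
position at time `1` is a smooth function of the initial data. The function `ê` is defined and
smooth everywhere, as is the cut-off metric `G₁`. -/
theorem IsLocalMetric.exists_local_exp (hG : IsLocalMetric G Ω) {y₀ : V} (hy₀ : y₀ ∈ Ω) :
    ∃ r > (0 : ℝ), ∃ η > (0 : ℝ), ∃ ê : V × V → V, ContDiff ℝ ∞ ê ∧
      Metric.closedBall y₀ (2 * r) ⊆ Ω ∧
      (∃ G₁ : V → V →L[ℝ] V →L[ℝ] ℝ, ContDiff ℝ ∞ G₁ ∧
        ∀ y ∈ Metric.closedBall y₀ (2 * r), G₁ y = G y) ∧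
      ∀ y ∈ Metric.closedBall y₀ r, ∀ ξ : V, ‖ξ‖ ≤ η → ∃ c : ℝ → V,
        ContDiffOn ℝ 2 c (Ioo (-1) 2) ∧ (∀ t ∈ Ioo (-1 : ℝ) 2, c t ∈ Metric.closedBall y₀ (2 * r)) ∧
        (∀ t ∈ Ioo (-1 : ℝ) 2,
          deriv (deriv c) t + christoffelL G (c t) (deriv c t) (deriv c t) = 0) ∧
        c 0 = y ∧ deriv c 0 = ξ ∧ c 1 = ê (y, ξ) := by
  obtain ⟨R, hR, hRΩ⟩ := Metric.nhds_basis_closedBall.mem_iff.1 (hG.isOpen.mem_nhds hy₀)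
  obtain ⟨r, hr, rfl⟩ : ∃ r > (0 : ℝ), R = 3 * r := ⟨R / 3, by positivity, by ring⟩
  have hlt : 2 * r < 3 * r := by linarith
  let χ₁ : ContDiffBump y₀ := ⟨2 * r, 3 * r, by positivity, hlt⟩
  let χ : ContDiffBump ((y₀, 0) : V × V) := ⟨2 * r, 3 * r, by positivity, hlt⟩
  let f : V × V → V × V := fun p => χ p • geodesicField G p
  have hf : ContDiff ℝ ∞ f := contDiff_bump_smul χ fun p hp =>
    hG.contDiffAt_geodesicField (hRΩ (by
      rw [← closedBall_prod_same] at hp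
      exact hp.1))
  have hsupp : HasCompactSupport f := χ.hasCompactSupport.smul_right
  obtain ⟨L, hL⟩ := ContDiff.lipschitzWith_of_hasCompactSupport hsupp hf (by simp)
  obtain ⟨C, hC⟩ := hsupp.exists_bound_of_continuous hf.continuous
  obtain ⟨δ, hδ, Φ, hΦ, hΦ0, hΦd, hΦb⟩ := exists_smooth_flow hf hL hC hr
  refine ⟨r, hr, δ * r, by positivity, fun p => (Φ (p.1, δ⁻¹ • p.2) 1).1, ?_,
    (Metric.closedBall_subset_closedBall hlt.le).trans hRΩ,
    ⟨fun y => χ₁ y • G y, contDiff_bump_smul χ₁ fun y hy => hG.contDiffAt (hRΩ hy), fun y hy => by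
      simp only [χ₁.one_of_mem_closedBall hy, one_smul]⟩, ?_⟩
  · exact contDiff_fst.comp ((hΦ 1).comp (by fun_prop))
  intro y hy ξ hξ
  set x : V × V := (y, δ⁻¹ • ξ) with hx
  have hxb : dist x (y₀, 0) ≤ r := by
    rw [Prod.dist_eq]
    refine max_le hy ?_
    rw [dist_zero_right, norm_smul, norm_inv, Real.norm_of_nonneg hδ.le]
    calc δ⁻¹ * ‖ξ‖ ≤ δ⁻¹ * (δ * r) := by gcongr
      _ = r := by field_simp
  have hmem : ∀ t, Φ x t ∈ Metric.closedBall ((y₀, 0) : V × V) (2 * r) := by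
    intro t
    have h1 : dist (Φ x t) x ≤ r := by
      rw [dist_eq_norm]
      exact hΦb x t
    calc dist (Φ x t) (y₀, 0) ≤ dist (Φ x t) x + dist x (y₀, 0) := dist_triangle _ _ _
      _ ≤ 2 * r := by linarith
  have hmem1 : ∀ t, (Φ x t).1 ∈ Metric.closedBall y₀ (2 * r) := by
    intro t
    have := hmem t
    rw [← closedBall_prod_same] at this
    exact this.1
  have hd : ∀ t ∈ Ioo (-1 : ℝ) 2, HasDerivAt (Φ x) (δ • geodesicField G (Φ x t)) t := by
    intro t ht
    have := hΦd x t ht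
    simp only [f, χ.one_of_mem_closedBall (hmem t), one_smul] at this
    exact this
  have hd1 : ∀ t ∈ Ioo (-1 : ℝ) 2, HasDerivAt (fun t => (Φ x t).1) (δ • (Φ x t).2) t :=
    fun t ht => (hd t ht).fst
  have hd2 : ∀ t ∈ Ioo (-1 : ℝ) 2, HasDerivAt (fun t => (Φ x t).2)
      (δ • -christoffelL G (Φ x t).1 (Φ x t).2 (Φ x t).2) t :=
    fun t ht => (hd t ht).snd
  have hsm : ContDiffOn ℝ (2 : ℕ) (Φ x) (Ioo (-1) 2) :=
    contDiffOn_of_hasDerivAt_field (hf.const_smul δ) isOpen_Ioo (fun t ht => hΦd x t ht) 2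
  have h0mem : (0 : ℝ) ∈ Ioo (-1 : ℝ) 2 := by constructor <;> norm_num
  refine ⟨fun t => (Φ x t).1, contDiff_fst.comp_contDiffOn hsm, fun t _ => hmem1 t, fun t ht => ?_,
    by simp [hΦ0, hx], ?_, rfl⟩
  · have hev : deriv (fun t => (Φ x t).1) =ᶠ[𝓝 t] fun t => δ • (Φ x t).2 := by
      filter_upwards [isOpen_Ioo.mem_nhds ht] with s hs using (hd1 s hs).deriv
    have h2 : HasDerivAt (fun t => δ • (Φ x t).2) _ t := (hd2 t ht).const_smul δ
    rw [hev.deriv_eq, (hd1 t ht).deriv, h2.deriv]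
    simp
  · rw [(hd1 0 h0mem).deriv, hΦ0, hx, smul_inv_smul₀ hδ.ne']

/-- On a compact set the metric dominates the norm. -/
lemma IsLocalMetric.exists_norm_sq_le (hG : IsLocalMetric G Ω) {S : Set V} (hS : IsCompact S)
    (hSΩ : S ⊆ Ω) : ∃ C > (0 : ℝ), ∀ y ∈ S, ∀ v, ‖v‖ ^ 2 ≤ C * G y v v := by
  have hcont : ContinuousOn (fun p : V × V => G p.1 p.2 p.2) (S ×ˢ Metric.sphere 0 1) := by
    have h1 : ContinuousOn (fun p : V × V => G p.1) (S ×ˢ Metric.sphere 0 1) :=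
      (hG.contDiffOn.continuousOn.mono hSΩ).comp continuousOn_fst fun p hp => hp.1
    exact (h1.clm_apply continuousOn_snd).clm_apply continuousOn_snd
  obtain ⟨m, hm, hmin⟩ := (hS.prod (isCompact_sphere (0 : V) 1)).exists_forall_le' hcont
    (a := 0) fun p hp => hG.pos p.1 (hSΩ hp.1) p.2 (by
      rintro h
      have := hp.2
      simp [h] at this)
  refine ⟨m⁻¹, by positivity, fun y hy v => ?_⟩
  rcases eq_or_ne v 0 with rfl | hv
  · simp
  have hn : 0 < ‖v‖ := norm_pos_iff.2 hv
  have h := hmin (y, ‖v‖⁻¹ • v) ⟨hy, by simp [norm_smul, hn.ne']⟩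
  simp only [map_smul, smul_apply, smul_eq_mul] at h
  rw [← div_eq_inv_mul, le_div_iff₀ hm]
  calc ‖v‖ ^ 2 * m ≤ ‖v‖ ^ 2 * (‖v‖⁻¹ * (‖v‖⁻¹ * G y v v)) := by gcongr
    _ = G y v v := by field_simp

end LocalExp

/-! ### Normal coordinates -/

section NormalCoordinates

variable {n : ℕ} {M : Type*} [TopologicalSpace M] [ChartedSpace (Eu (n + 1)) M]
  [IsManifold (𝓡 (n + 1)) ∞ M] {g : RiemMetric n M}

/-- The map `x ↦ ∑ x_i E_i` as a continuous linear map to the model space. -/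
noncomputable def Frame.tangentL (P : Frame g) : Eu (n + 1) →L[ℝ] Eu (n + 1) :=
  ∑ i, (EuclideanSpace.proj i : Eu (n + 1) →L[ℝ] ℝ).smulRight (P.vec i : Eu (n + 1))

lemma Frame.tangentL_apply (P : Frame g) (x : Eu (n + 1)) : P.tangentL x = P.tangent x := by
  simp only [Frame.tangentL, sum_apply]
  rfl

lemma Frame.metricAt_tangentL (P : Frame g) (u v : Eu (n + 1)) :
    metricAt g P.pt (P.tangentL u) (P.tangentL v) = inner ℝ u v := by
  let E : Fin (n + 1) → Eu (n + 1) := P.vec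
  have h : ∀ i j, metricAt g P.pt (E i) (E j) = if i = j then 1 else 0 := P.orthonormal
  have e : ∀ x : Eu (n + 1), P.tangentL x = ∑ i, x i • E i := fun x => by
    simp only [Frame.tangentL, sum_apply]
    rfl
  rw [e, e, map_sum]
  simp only [sum_apply, map_sum, map_smul, smul_apply, h, smul_eq_mul]
  rw [PiLp.inner_apply]
  refine Finset.sum_congr rfl fun i _ => ?_
  simp [mul_comm]

/-- The metric in the normal coordinates of a frame. -/
noncomputable def Frame.normalMetric (P : Frame g) (x : Eu (n + 1)) : Bil (n + 1) :=
  (metricAt g (P.normalCoord x)).bilinearComp (mder P.normalCoord x) (mder P.normalCoord x)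

lemma Frame.normalMetric_apply (P : Frame g) (x u v : Eu (n + 1)) :
    P.normalMetric x u v =
      metricAt g (P.normalCoord x) (mder P.normalCoord x u) (mder P.normalCoord x v) := rfl

/-- The normal coordinates of the frame `P` are well behaved on the ball of radius `R`: they are
smooth, with the expected derivative at the origin, and map rays to geodesics. -/
structure Frame.IsNormalOn (P : Frame g) (R : ℝ) : Prop where
  pos : 0 < R
  contMDiffOn : ContMDiffOn 𝓘(ℝ, Eu (n + 1)) (𝓡 (n + 1)) ∞ P.normalCoord (Metric.ball 0 R)
  map_zero : P.normalCoord 0 = P.pt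
  mder_zero : ∀ x, mder P.normalCoord 0 x = P.tangentL x
  ray : ∀ x ∈ Metric.ball 0 R, ∃ γ : ℝ → M, IsGeodesicOn g γ (Ioo (-1) 2) ∧
    ∀ s ∈ Ioo (-1 : ℝ) 2, P.normalCoord (s • x) = γ s

omit [IsManifold (𝓡 (n + 1)) ∞ M] in
lemma deriv_deriv_comp_mul {c : ℝ → Eu (n + 1)} (a t : ℝ) :
    deriv (fun r => c (a * r)) t = a • deriv c (a * t) ∧
      deriv (deriv fun r => c (a * r)) t = a • a • deriv (deriv c) (a * t) := by
  have h : (deriv fun r => c (a * r)) = fun t => a • deriv c (a * t) := by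
    funext t
    exact deriv_comp_mul_left a c t
  refine ⟨congrFun h t, ?_⟩
  rw [h, deriv_fun_const_smul_field]
  congr 1
  exact deriv_comp_mul_left a (deriv c) t

lemma GeodesicEqAt.comp_mul {γ : ℝ → M} {x₀ : M} {a t : ℝ} (h : GeodesicEqAt g x₀ γ (a * t)) :
    GeodesicEqAt g x₀ (fun r => γ (a * r)) t := by
  obtain ⟨h1, h2⟩ := deriv_deriv_comp_mul (c := fun r => extChartAt (𝓡 (n + 1)) x₀ (γ r)) a t
  rw [GeodesicEqAt, h1, h2]
  simp only [map_smul, smul_apply, ← smul_add]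
  rw [h, smul_zero, smul_zero]

lemma GeodesicEqAt.congr {γ γ' : ℝ → M} {x₀ : M} {t : ℝ} (h : GeodesicEqAt g x₀ γ t)
    (heq : γ' =ᶠ[𝓝 t] γ) : GeodesicEqAt g x₀ γ' t := by
  have h1 : (fun r => extChartAt (𝓡 (n + 1)) x₀ (γ' r)) =ᶠ[𝓝 t]
      fun r => extChartAt (𝓡 (n + 1)) x₀ (γ r) := by
    filter_upwards [heq] with r hr using by rw [hr]
  rw [GeodesicEqAt, h1.deriv.deriv_eq, h1.deriv_eq, heq.self_of_nhds]
  exact h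

lemma Frame.IsNormalOn.contMDiffAt {P : Frame g} {R : ℝ} (h : P.IsNormalOn R) {x : Eu (n + 1)}
    (hx : x ∈ Metric.ball 0 R) : ContMDiffAt 𝓘(ℝ, Eu (n + 1)) (𝓡 (n + 1)) ∞ P.normalCoord x :=
  h.contMDiffOn.contMDiffAt (Metric.isOpen_ball.mem_nhds hx)

/-- In every chart, normal coordinates send rays to geodesics. -/
lemma Frame.IsNormalOn.isRadialMap {P : Frame g} {R : ℝ} (h : P.IsNormalOn R) (x₁ : M) :
    IsRadialMap (chartMetric g x₁) (extChartAt (𝓡 (n + 1)) x₁).target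
      (fun x => extChartAt (𝓡 (n + 1)) x₁ (P.normalCoord x))
      (Metric.ball 0 R ∩ P.normalCoord ⁻¹' (extChartAt (𝓡 (n + 1)) x₁).source) := by
  have hopen : IsOpen (Metric.ball 0 R ∩
      P.normalCoord ⁻¹' (extChartAt (𝓡 (n + 1)) x₁).source) :=
    h.contMDiffOn.continuousOn.isOpen_inter_preimage Metric.isOpen_ball
      (isOpen_extChartAt_source x₁)
  have hsm : ∀ x ∈ Metric.ball 0 R ∩ P.normalCoord ⁻¹' (extChartAt (𝓡 (n + 1)) x₁).source,
      ContDiffAt ℝ ∞ (fun x => extChartAt (𝓡 (n + 1)) x₁ (P.normalCoord x)) x := fun x hx =>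
    contDiffAt_chart_comp le_rfl (h.contMDiffAt hx.1) hx.2
  refine ⟨hopen, fun x hx => (hsm x hx).contDiffWithinAt,
    fun x hx => (extChartAt (𝓡 (n + 1)) x₁).map_source hx.2, fun x t ht => ?_⟩
  -- for `a ≠ 0` with `a • x` in the ball, `s ↦ F (s • x)` is a reparametrized geodesic near `t`
  obtain ⟨a, ha, hax, hta⟩ : ∃ a : ℝ, a ≠ 0 ∧ a • x ∈ Metric.ball (0 : Eu (n + 1)) R ∧
      a⁻¹ * t ∈ Ioo (-1 : ℝ) 2 := by
    rcases eq_or_ne t 0 with rfl | ht0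
    · have hc : ContinuousAt (fun a : ℝ => a • x) 0 := by fun_prop
      have hev : ∀ᶠ a : ℝ in 𝓝[≠] 0, a • x ∈ Metric.ball (0 : Eu (n + 1)) R :=
        (hc.eventually_mem (by simpa using Metric.ball_mem_nhds _ h.pos)).filter_mono
          nhdsWithin_le_nhds
      obtain ⟨a, ha, hne⟩ := (hev.and self_mem_nhdsWithin).exists
      exact ⟨a, hne, ha, by norm_num⟩
    · exact ⟨t, ht0, ht.1, by rw [inv_mul_cancel₀ ht0]; norm_num⟩
  obtain ⟨γ, hγ, hray⟩ := h.ray _ hax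
  have hev : (fun s : ℝ => P.normalCoord (s • x)) =ᶠ[𝓝 t] fun s => γ (a⁻¹ * s) := by
    have hc : ContinuousAt (fun s : ℝ => a⁻¹ * s) t := by fun_prop
    filter_upwards [hc.eventually_mem (isOpen_Ioo.mem_nhds hta)] with s hs
    rw [← hray _ hs, smul_smul, mul_assoc, mul_comm s a, inv_mul_cancel_left₀ ha]
  have hγt : γ (a⁻¹ * t) ∈ (extChartAt (𝓡 (n + 1)) x₁).source := by
    have h1 : P.normalCoord (t • x) = γ (a⁻¹ * t) := hev.self_of_nhds
    rw [← h1]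
    exact ht.2
  have hgeo := ((hγ.geodesicEqAt isOpen_Ioo hta hγt).comp_mul).congr hev
  set e : Eu (n + 1) → Eu (n + 1) := fun x => extChartAt (𝓡 (n + 1)) x₁ (P.normalCoord x) with he
  have hd1 : (deriv fun s : ℝ => e (s • x)) =ᶠ[𝓝 t] fun s => fderiv ℝ e (s • x) x := by
    have hc : ContinuousAt (fun s : ℝ => s • x) t := by fun_prop
    filter_upwards [hc.eventually_mem (hopen.mem_nhds ht)] with s hs
    exact (hasDerivAt_comp_smul ((hsm _ hs).differentiableAt (by simp))).deriv
  have hd2 : deriv (fun s : ℝ => fderiv ℝ e (s • x) x) t =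
      fderiv ℝ (fderiv ℝ e) (t • x) x x :=
    (hasDerivAt_apply (hasDerivAt_comp_smul (((hsm _ ht).fderiv_right (m := ∞)
      (by exact_mod_cast le_top)).differentiableAt (by simp))) x).deriv
  have hgeo' : deriv (deriv fun s : ℝ => e (s • x)) t + christoffelL (chartMetric g x₁) (e (t • x))
      (deriv (fun s : ℝ => e (s • x)) t) (deriv (fun s : ℝ => e (s • x)) t) = 0 := hgeo
  rw [hd1.deriv_eq, hd1.self_of_nhds, hd2] at hgeo'
  exact hgeo'

/-- The Gauss lemma in normal coordinates. -/
lemma Frame.IsNormalOn.gauss {P : Frame g} {R : ℝ} (h : P.IsNormalOn R) {x₁ : M}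
    (hsrc : ∀ x ∈ Metric.ball 0 R, P.normalCoord x ∈ (extChartAt (𝓡 (n + 1)) x₁).source)
    {x : Eu (n + 1)} (hx : x ∈ Metric.ball 0 R) (u : Eu (n + 1)) :
    P.normalMetric x x u = inner ℝ x u := by
  have h0 : (0 : Eu (n + 1)) ∈ Metric.ball 0 R := Metric.mem_ball_self h.pos
  have hm := (h.isRadialMap x₁).gauss (isLocalMetric_chartMetric g x₁) (x := x)
    (fun t ht => by
      have hb : t • x ∈ Metric.ball (0 : Eu (n + 1)) R := by
        rw [mem_ball_zero_iff] at hx ⊢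
        rw [norm_smul, Real.norm_of_nonneg ht.1]
        exact (mul_le_of_le_one_left (norm_nonneg _) ht.2).trans_lt hx
      exact ⟨hb, hsrc _ hb⟩) u
  rw [chartMetric_comp g ((h.contMDiffAt hx).mdifferentiableAt (by simp)) (hsrc x hx),
    chartMetric_comp g ((h.contMDiffAt h0).mdifferentiableAt (by simp)) (hsrc 0 h0),
    h.mder_zero, h.mder_zero, h.map_zero, P.metricAt_tangentL] at hm
  exact hm

/-- The third order expansion of the metric in normal coordinates along a ray, with coefficients
given by the curvature and its covariant derivative at the center. -/
lemma Frame.IsNormalOn.taylor {P : Frame g} {R : ℝ} (h : P.IsNormalOn R) (x u v : Eu (n + 1))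
    {k K₁ K₂ K₃ : ℝ → ℝ}
    (hk : ∀ t : ℝ, t • x ∈ Metric.ball (0 : Eu (n + 1)) R → k t = P.normalMetric (t • x) u v)
    (hK₁ : ContDiff ℝ ∞ K₁) (hK₂ : ContDiff ℝ ∞ K₂) (hK₃ : ContDiff ℝ ∞ K₃)
    (e₁ : ∀ t, k t = k 0 + t * K₁ t) (e₂ : ∀ t, K₁ t = K₁ 0 + t * K₂ t)
    (e₃ : ∀ t, K₂ t = K₂ 0 + t * K₃ t) :
    k 0 = inner ℝ u v ∧ K₁ 0 = 0 ∧
    K₂ 0 = curv g P.pt (P.tangent x) (P.tangent u) (P.tangent x) (P.tangent v) / 3 ∧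
    K₃ 0 = nablaCurv g P.pt (P.tangent x) (P.tangent x) (P.tangent u) (P.tangent x)
      (P.tangent v) / 6 := by
  have h0 : (0 : Eu (n + 1)) ∈ Metric.ball 0 R := Metric.mem_ball_self h.pos
  have hsrc : P.normalCoord 0 ∈ (extChartAt (𝓡 (n + 1)) P.pt).source := by
    rw [h.map_zero]
    exact mem_extChartAt_source _
  have hrad := h.isRadialMap P.pt
  have hev : ∀ᶠ t : ℝ in 𝓝 0, t • x ∈
      Metric.ball 0 R ∩ P.normalCoord ⁻¹' (extChartAt (𝓡 (n + 1)) P.pt).source := by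
    have hc : ContinuousAt (fun t : ℝ => t • x) 0 := by fun_prop
    exact hc.eventually_mem (by simpa using hrad.isOpen.mem_nhds ⟨h0, hsrc⟩)
  have hder : ∀ w, fderiv ℝ (fun x => extChartAt (𝓡 (n + 1)) P.pt (P.normalCoord x)) 0 w =
      toChart P.pt (P.tangent w) := by
    intro w
    rw [(hasFDerivAt_chart_comp ((h.contMDiffAt h0).mdifferentiableAt (by simp)) hsrc).fderiv,
      ContinuousLinearMap.comp_apply, h.mder_zero, h.map_zero, P.tangentL_apply]
    rfl
  have hT := hrad.taylor (isLocalMetric_chartMetric g P.pt) ⟨h0, hsrc⟩ x u v (k := k) ?_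
    hK₁ hK₂ hK₃ e₁ e₂ e₃
  · obtain ⟨t0, t1, t2, t3⟩ := hT
    refine ⟨?_, t1, ?_, ?_⟩
    · have := hk 0 (by simpa using h0)
      rw [this, zero_smul, P.normalMetric_apply, h.mder_zero, h.mder_zero, h.map_zero,
        P.metricAt_tangentL]
    · rw [t2, hder, hder, hder, h.map_zero]
      rfl
    · rw [t3, hder, hder, hder, h.map_zero]
      rfl
  · filter_upwards [hev] with t ht
    rw [hk t ht.1, chartMetric_comp g ((h.contMDiffAt ht.1).mdifferentiableAt (by simp)) ht.2]
    rfl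

end NormalCoordinates

/-! ### Normal coordinates near a point -/

section UniformNormalCoordinates

variable {n : ℕ} {M : Type*} [TopologicalSpace M] [ChartedSpace (Eu (n + 1)) M]
  [IsManifold (𝓡 (n + 1)) ∞ M] {g : RiemMetric n M}

lemma chartMetric_chartDeriv (g : RiemMetric n M) {x₀ p : M}
    (hp : p ∈ (extChartAt (𝓡 (n + 1)) x₀).source) (v w : Eu (n + 1)) :
    chartMetric g x₀ (extChartAt (𝓡 (n + 1)) x₀ p) (chartDeriv n x₀ p v) (chartDeriv n x₀ p w) =
      metricAt g p v w := by
  rw [chartMetric_apply, mder_symm_chartDeriv hp, mder_symm_chartDeriv hp,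
    (extChartAt (𝓡 (n + 1)) x₀).left_inv hp]

/-- The curve `c` is the coordinate expression, in the preferred chart at `x₀` and with values in
`S`, of the geodesic with initial velocity `v` at `p`. -/
structure IsChartGeodesic (g : RiemMetric n M) (x₀ : M) (S : Set (Eu (n + 1))) (p : M)
    (v : Eu (n + 1)) (c : ℝ → Eu (n + 1)) : Prop where
  contDiffOn : ContDiffOn ℝ 2 c (Ioo (-1) 2)
  mapsTo : ∀ t ∈ Ioo (-1 : ℝ) 2, c t ∈ S
  eqn : ∀ t ∈ Ioo (-1 : ℝ) 2,
    deriv (deriv c) t + christoffelL (chartMetric g x₀) (c t) (deriv c t) (deriv c t) = 0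
  zero : c 0 = extChartAt (𝓡 (n + 1)) x₀ p
  deriv_zero : deriv c 0 = chartDeriv n x₀ p v

/-- Reparametrizing a geodesic gives the exponential map on a segment. -/
lemma IsChartGeodesic.isExp {x₀ p : M} {S : Set (Eu (n + 1))} {v : Eu (n + 1)}
    {c : ℝ → Eu (n + 1)} (h : IsChartGeodesic g x₀ S p v c)
    (hS : S ⊆ (extChartAt (𝓡 (n + 1)) x₀).target)
    (hp : p ∈ (extChartAt (𝓡 (n + 1)) x₀).source) {s : ℝ} (hs : s ∈ Ioo (-1 : ℝ) 2) :
    IsExp g p (s • v : Eu (n + 1)) ((extChartAt (𝓡 (n + 1)) x₀).symm (c s)) := by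
  obtain ⟨ε, hε, hmem⟩ : ∃ ε > 0, ∀ t ∈ Ioo (-ε) (1 + ε), s * t ∈ Ioo (-1 : ℝ) 2 := by
    obtain ⟨h1, h2⟩ := hs
    refine ⟨min (1 / 2) (min ((2 - s) / 2) (s + 1)), by
      refine lt_min (by norm_num) (lt_min (by linarith) (by linarith)), fun t ht => ?_⟩
    have e1 := min_le_left (1 / 2) (min ((2 - s) / 2) (s + 1))
    have e2 := (min_le_right (1 / 2) (min ((2 - s) / 2) (s + 1))).trans (min_le_left _ _)
    have e3 := (min_le_right (1 / 2) (min ((2 - s) / 2) (s + 1))).trans (min_le_right _ _)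
    generalize min (1 / 2) (min ((2 - s) / 2) (s + 1)) = ε at ht e1 e2 e3
    obtain ⟨t1, t2⟩ := ht
    constructor
    · rcases le_or_gt 0 s with h0 | h0 <;> nlinarith
    · rcases le_or_gt 0 s with h0 | h0 <;> nlinarith
  have hc : ContDiffOn ℝ 2 (fun t => c (s * t)) (Ioo (-ε) (1 + ε)) :=
    h.contDiffOn.comp (by fun_prop) hmem
  have key := isExp_of_chart (g := g) (v := (s • v : Eu (n + 1))) hp hε hc
    (fun t ht => hS (h.mapsTo _ (hmem t ht))) (fun t ht => ?_) (by rw [mul_zero, h.zero]) ?_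
  · simpa using key
  · obtain ⟨h1, h2⟩ := deriv_deriv_comp_mul (c := c) s t
    rw [h1, h2]
    simp only [map_smul, smul_apply, ← smul_add]
    rw [h.eqn _ (hmem t ht), smul_zero, smul_zero]
  · rw [(deriv_deriv_comp_mul (c := c) s 0).1, mul_zero, h.deriv_zero]
    exact (map_smul _ _ _).symm

/-- Near each point, the geodesics of speed less than a fixed `R` exist for a definite time, and
their endpoints depend smoothly on the initial data. -/
theorem exists_uniform_exp (g : RiemMetric n M) (x₀ : M) :
    ∃ N ∈ 𝓝 x₀, ∃ S ⊆ (extChartAt (𝓡 (n + 1)) x₀).target, IsCompact S ∧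
      ∃ R > (0 : ℝ), ∃ C : ℝ, ∃ ê : Eu (n + 1) × Eu (n + 1) → Eu (n + 1), ContDiff ℝ ∞ ê ∧
      ∃ G₁ : Eu (n + 1) → Bil (n + 1), ContDiff ℝ ∞ G₁ ∧ (∀ y ∈ S, G₁ y = chartMetric g x₀ y) ∧
      ∀ p ∈ N, p ∈ (extChartAt (𝓡 (n + 1)) x₀).source ∧ extChartAt (𝓡 (n + 1)) x₀ p ∈ S ∧
        ∀ v : Eu (n + 1), ‖chartDeriv n x₀ p v‖ ^ 2 ≤ C * metricAt g p v v ∧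
          (metricAt g p v v < R ^ 2 → ∃ c, IsChartGeodesic g x₀ S p v c ∧
            c 1 = ê (extChartAt (𝓡 (n + 1)) x₀ p, chartDeriv n x₀ p v)) := by
  have hG := isLocalMetric_chartMetric g x₀
  obtain ⟨r, hr, η, hη, ê, hê, hsub, ⟨G₁, hG₁, hG₁e⟩, hcurve⟩ :=
    hG.exists_local_exp (mem_extChartAt_target x₀)
  have hK := isCompact_closedBall (extChartAt (𝓡 (n + 1)) x₀ x₀) (2 * r)
  obtain ⟨C, hC, hCb⟩ := hG.exists_norm_sq_le hK hsub
  refine ⟨_, inter_mem ((isOpen_extChartAt_source (I := 𝓡 (n + 1)) x₀).mem_nhds (mem_extChartAt_source x₀))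
    ((continuousAt_extChartAt (I := 𝓡 (n + 1)) x₀).preimage_mem_nhds
      (Metric.closedBall_mem_nhds _ hr)), _, hsub, hK,
    η / (C + 1), by positivity, C, ê, hê, G₁, hG₁, hG₁e, fun p hp => ?_⟩
  have hpS : extChartAt (𝓡 (n + 1)) x₀ p ∈
      Metric.closedBall (extChartAt (𝓡 (n + 1)) x₀ x₀) (2 * r) :=
    Metric.closedBall_subset_closedBall (by linarith) hp.2
  refine ⟨hp.1, hpS, fun v => ?_⟩
  have hle := hCb _ hpS (chartDeriv n x₀ p v)
  rw [chartMetric_chartDeriv g hp.1] at hle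
  refine ⟨hle, fun hv => ?_⟩
  have hξ : ‖chartDeriv n x₀ p v‖ ≤ η := by
    refine abs_le_of_sq_le_sq' ?_ hη.le |>.2
    calc _ ≤ C * (η / (C + 1)) ^ 2 := hle.trans (by gcongr)
      _ = η ^ 2 * (C / (C + 1) ^ 2) := by field_simp
      _ ≤ η ^ 2 * 1 := by
        gcongr
        rw [div_le_one (by positivity)]
        nlinarith
      _ = η ^ 2 := mul_one _
  obtain ⟨c, h1, h2, h3, h4, h5, h6⟩ := hcurve _ hp.2 _ hξ
  exact ⟨c, ⟨h1, h2, h3, h4, h5⟩, h6⟩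

/-- Near each point, normal coordinates are defined on balls of a fixed radius, and the metric in
these coordinates is a smooth function of the point and of parameters in a compact set. The
parameters `c P` of a frame are the coordinates of its base point and the linear map sending `x`
to the coordinates of `∑ x_i E_i`. -/
theorem exists_uniform_normalMetric [T2Space M] (g : RiemMetric n M) (x₀ : M) :
    ∃ N ∈ 𝓝 x₀, ∃ R > (0 : ℝ),
      (∀ p ∈ N, ∀ v : Eu (n + 1), metricAt g p v v < R ^ 2 → ∃ q, IsExp g p v q) ∧
      ∃ 𝒦 : Set (Eu (n + 1) × (Eu (n + 1) →L[ℝ] Eu (n + 1))), IsCompact 𝒦 ∧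
      ∃ Ĥ : (Eu (n + 1) × (Eu (n + 1) →L[ℝ] Eu (n + 1))) × Eu (n + 1) → Bil (n + 1),
        ContDiff ℝ ∞ Ĥ ∧
      ∃ c : Frame g → Eu (n + 1) × (Eu (n + 1) →L[ℝ] Eu (n + 1)),
        ∀ P : Frame g, P.pt ∈ N → c P ∈ 𝒦 ∧ P.IsNormalOn R ∧
          ∀ x ∈ Metric.ball 0 R, P.normalCoord x ∈ (extChartAt (𝓡 (n + 1)) x₀).source ∧
            Ĥ (c P, x) = P.normalMetric x := by
  obtain ⟨N, hN, S, hST, hS, R, hR, C, ê, hê, G₁, hG₁, hG₁e, hexp⟩ := exists_uniform_exp g x₀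
  refine ⟨N, hN, R, hR, fun p hp v hv => ?_, S ×ˢ Metric.closedBall 0 √C,
    hS.prod (isCompact_closedBall _ _), ?_⟩
  · obtain ⟨hsrc, -, h⟩ := hexp p hp
    obtain ⟨c, hc, -⟩ := (h v).2 hv
    have := hc.isExp hST hsrc (s := 1) (by norm_num)
    rw [one_smul] at this
    exact ⟨_, this⟩
  -- normal coordinates, in the chart at `x₀`, for the frame with parameters `z.1`
  let Ê : (Eu (n + 1) × (Eu (n + 1) →L[ℝ] Eu (n + 1))) × Eu (n + 1) → Eu (n + 1) :=
    fun z => ê (z.1.1, z.1.2 z.2)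
  have hÊ : ContDiff ℝ ∞ Ê := hê.comp (by fun_prop)
  let D : (Eu (n + 1) × (Eu (n + 1) →L[ℝ] Eu (n + 1))) × Eu (n + 1) →
      Eu (n + 1) →L[ℝ] Eu (n + 1) :=
    fun z => (fderiv ℝ Ê z).comp (ContinuousLinearMap.inr ℝ _ _)
  have hD : ContDiff ℝ ∞ D :=
    (hÊ.fderiv_right (m := ∞) (by exact_mod_cast le_top)).clm_comp contDiff_const
  refine ⟨fun z => (G₁ (Ê z)).bilinearComp (D z) (D z), ?_,
    fun P => (extChartAt (𝓡 (n + 1)) x₀ P.pt, (chartDeriv n x₀ P.pt).comp P.tangentL),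
    fun P hP => ?_⟩
  · rw [contDiff_clm_apply_iff]
    intro u
    rw [contDiff_clm_apply_iff]
    intro v
    exact ((hG₁.comp hÊ).clm_apply (hD.clm_apply contDiff_const)).clm_apply
      (hD.clm_apply contDiff_const)
  obtain ⟨hsrc, hpS, hv⟩ := hexp P.pt hP
  set A := (chartDeriv n x₀ P.pt).comp P.tangentL with hA
  set y := extChartAt (𝓡 (n + 1)) x₀ P.pt with hy
  have hm : ∀ x, metricAt g P.pt (P.tangentL x) (P.tangentL x) = ‖x‖ ^ 2 := fun x => by
    rw [P.metricAt_tangentL, real_inner_self_eq_norm_sq]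
  have hcurve : ∀ x ∈ Metric.ball (0 : Eu (n + 1)) R, ∃ c,
      IsChartGeodesic g x₀ S P.pt (P.tangentL x) c ∧ c 1 = ê (y, A x) ∧
      ∀ s ∈ Ioo (-1 : ℝ) 2, P.normalCoord (s • x) = (extChartAt (𝓡 (n + 1)) x₀).symm (c s) := by
    intro x hx
    rw [mem_ball_zero_iff] at hx
    obtain ⟨c, hc, hc1⟩ := (hv (P.tangentL x)).2 (by rw [hm]; gcongr)
    refine ⟨c, hc, hc1, fun s hs => ?_⟩
    have h1 := hc.isExp hST hsrc hs
    rw [← map_smul] at h1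
    rw [P.tangentL_apply] at h1
    exact h1.expMap_eq
  have hcoord : ∀ x ∈ Metric.ball (0 : Eu (n + 1)) R, ê (y, A x) ∈ S ∧
      P.normalCoord x = (extChartAt (𝓡 (n + 1)) x₀).symm (ê (y, A x)) := by
    intro x hx
    obtain ⟨c, hc, hc1, hs⟩ := hcurve x hx
    rw [← hc1]
    have h1 := hs 1 (by norm_num)
    rw [one_smul] at h1
    exact ⟨hc.mapsTo 1 (by norm_num), h1⟩
  have he : ContDiff ℝ ∞ fun x => ê (y, A x) := hê.comp (by fun_prop)
  have hmder : ∀ x ∈ Metric.ball (0 : Eu (n + 1)) R, mder (n := n) P.normalCoord x =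
      (mder (extChartAt (𝓡 (n + 1)) x₀).symm (ê (y, A x))).comp
        (fderiv ℝ (fun x => ê (y, A x)) x) := by
    intro x hx
    have h1 : P.normalCoord =ᶠ[𝓝 x]
        fun x => (extChartAt (𝓡 (n + 1)) x₀).symm (ê (y, A x)) := by
      filter_upwards [Metric.isOpen_ball.mem_nhds hx] with z hz using (hcoord z hz).2
    rw [mder_congr h1]
    exact mder_chart_symm_comp (he.differentiable (by simp) x) (hST (hcoord x hx).1)
  have h0 : (0 : Eu (n + 1)) ∈ Metric.ball 0 R := Metric.mem_ball_self hR
  have hê0 : ê (y, A 0) = y ∧ P.normalCoord 0 = P.pt := by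
    obtain ⟨c, hc, hc1, hs⟩ := hcurve 0 h0
    have h1 := hs 0 (by norm_num)
    have h2 := hcoord 0 h0
    rw [zero_smul, hc.zero, (extChartAt (𝓡 (n + 1)) x₀).left_inv hsrc] at h1
    refine ⟨?_, h1⟩
    have h3 := (extChartAt (𝓡 (n + 1)) x₀).right_inv (hST h2.1)
    rw [← h2.2, h1] at h3
    exact h3.symm
  have hfd : ∀ x, fderiv ℝ (fun x => ê (y, A x)) 0 x = A x := by
    -- the derivative along the ray through a small vector is the velocity of a geodesic
    have hsmall : ∀ x ∈ Metric.ball (0 : Eu (n + 1)) R,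
        fderiv ℝ (fun x => ê (y, A x)) 0 x = A x := by
      intro x hx
      obtain ⟨c, hc, hc1, hs⟩ := hcurve x hx
      have hcont : ContinuousAt (fun s : ℝ => s • x) 0 := by fun_prop
      have hev : (fun s : ℝ => ê (y, A (s • x))) =ᶠ[𝓝 0] c := by
        filter_upwards [isOpen_Ioo.mem_nhds (show (0 : ℝ) ∈ Ioo (-1) 2 by norm_num),
          hcont.eventually_mem (by simpa using Metric.isOpen_ball.mem_nhds h0)] with s hs1 hs2
        have h2 := hcoord _ hs2
        rw [hs s hs1] at h2
        exact ((extChartAt (𝓡 (n + 1)) x₀).symm.injOn (hST (hc.mapsTo s hs1)) (hST h2.1)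
          h2.2).symm
      have h3 := hasDerivAt_comp_smul (f := fun x => ê (y, A x)) (x := x) (t := 0)
        ((he.differentiable (by simp)) _)
      have h4 := (h3.congr_of_eventuallyEq hev.symm).deriv
      rw [hc.deriv_zero, zero_smul] at h4
      exact h4.symm
    intro x
    obtain ⟨a, ha, hax⟩ : ∃ a : ℝ, a ≠ 0 ∧ a • x ∈ Metric.ball (0 : Eu (n + 1)) R := by
      have hc : ContinuousAt (fun a : ℝ => a • x) 0 := by fun_prop
      have hev : ∀ᶠ a : ℝ in 𝓝[≠] 0, a • x ∈ Metric.ball (0 : Eu (n + 1)) R :=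
        (hc.eventually_mem (by simpa using Metric.ball_mem_nhds _ hR)).filter_mono
          nhdsWithin_le_nhds
      obtain ⟨a, ha, hne⟩ := (hev.and self_mem_nhdsWithin).exists
      exact ⟨a, hne, ha⟩
    have := hsmall _ hax
    rw [map_smul, map_smul] at this
    exact smul_right_injective _ ha this
  refine ⟨⟨hpS, ?_⟩, ⟨hR, fun x hx => ?_, hê0.2, fun x => ?_, fun x hx => ?_⟩, fun x hx => ?_⟩
  · rw [mem_closedBall_zero_iff]
    refine ContinuousLinearMap.opNorm_le_bound _ (Real.sqrt_nonneg _) fun x => ?_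
    have h1 := (hv (P.tangentL x)).1
    rw [hm] at h1
    rw [← Real.sqrt_sq (norm_nonneg x), ← Real.sqrt_mul' _ (sq_nonneg _)]
    exact Real.le_sqrt_of_sq_le h1
  · have h1 : ContMDiffAt 𝓘(ℝ, Eu (n + 1)) (𝓡 (n + 1)) ∞
        (fun x => (extChartAt (𝓡 (n + 1)) x₀).symm (ê (y, A x))) x :=
      (contMDiffAt_chart_symm (hST (hcoord x hx).1)).comp x he.contDiffAt.contMDiffAt
    refine (h1.congr_of_eventuallyEq ?_).contMDiffWithinAt
    filter_upwards [Metric.isOpen_ball.mem_nhds hx] with z hz using (hcoord z hz).2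
  · rw [hmder 0 h0, hê0.1, ContinuousLinearMap.comp_apply, hfd]
    exact mder_symm_chartDeriv hsrc _
  · obtain ⟨c, hc, hc1, hs⟩ := hcurve x hx
    exact ⟨_, isGeodesicOn_of_chart isOpen_Ioo hc.contDiffOn
      (fun t ht => hST (hc.mapsTo t ht)) hc.eqn, hs⟩
  · obtain ⟨h1, h2⟩ := hcoord x hx
    refine ⟨h2 ▸ (extChartAt (𝓡 (n + 1)) x₀).map_target (hST h1), ?_⟩
    have hDx : D ((y, A), x) = fderiv ℝ (fun x => ê (y, A x)) x := by
      have h3 : HasFDerivAt (fun x => (((y, A), x) : (Eu (n + 1) ×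
          (Eu (n + 1) →L[ℝ] Eu (n + 1))) × Eu (n + 1))) (ContinuousLinearMap.inr ℝ _ _) x :=
        hasFDerivAt_prodMk_right _ _
      exact ((hÊ.differentiable (by simp) _).hasFDerivAt.comp x h3).fderiv.symm
    refine ContinuousLinearMap.ext fun u => ContinuousLinearMap.ext fun v => ?_
    rw [P.normalMetric_apply, hmder x hx, h2]
    change G₁ (ê (y, A x)) (D ((y, A), x) u) (D ((y, A), x) v) = _
    rw [hDx, hG₁e _ h1]
    rfl

end UniformNormalCoordinates

/-! ### Uniform expansion of the metric in normal coordinates -/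

section Families

variable {ι X W : Type*} [NormedAddCommGroup X] [NormedSpace ℝ X]
  [NormedAddCommGroup W] [NormedSpace ℝ W] {S S' : Set ι} {A : Set X} {b : ι → ℝ}

lemma SmoothBounded.mono {f : ι → X → W} (hf : SmoothBounded S A f b) (h : S' ⊆ S) :
    SmoothBounded S' A f b := by
  refine ⟨fun k hk => hf.1 k (h hk), fun m => ?_⟩
  obtain ⟨B, hB⟩ := hf.2 m
  exact ⟨B, fun k hk => hB k (h hk)⟩

open Classical in
lemma SmoothBounded.ite {f f' : ι → X → W} (hf : SmoothBounded S A f fun _ => 1)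
    (hf' : SmoothBounded S' A f' fun _ => 1) :
    SmoothBounded (S ∪ S') A (fun k => if k ∈ S then f k else f' k) fun _ => 1 := by
  refine ⟨fun k hk => ?_, fun m => ?_⟩
  · by_cases h : k ∈ S
    · simpa only [if_pos h] using hf.1 k h
    · simpa only [if_neg h] using hf'.1 k (hk.resolve_left h)
  · obtain ⟨B, hB⟩ := hf.2 m
    obtain ⟨B', hB'⟩ := hf'.2 m
    refine ⟨max B B', fun k hk x hx => ?_⟩
    by_cases h : k ∈ S
    · simp only [if_pos h]
      exact (hB k h x hx).trans (by simp)
    · simp only [if_neg h]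
      exact (hB' k (hk.resolve_left h) x hx).trans (by simp)

end Families

section Expansion

variable {n : ℕ} {M : Type*} [TopologicalSpace M] [ChartedSpace (Eu (n + 1)) M]
  [IsManifold (𝓡 (n + 1)) ∞ M] {g : RiemMetric n M}

/-- The functions `b₀`, `b₁`, `q` of `(ρ, P)` give the fourth order remainder of the metric in
normal coordinates at the point `ρ (1 - s) θ`, arranged by powers of `s`. -/
structure IsRemainder (T : Set (ℝ × Frame g)) (b₀ b₁ : ℝ × Frame g → Eu (n + 1) → Bil (n + 1))
    (q : ℝ × Frame g → Eu (n + 1) × ℝ → Bil (n + 1)) : Prop where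
  bounded₀ : SmoothBounded T (Metric.sphere 0 1) b₀ fun _ => 1
  bounded₁ : SmoothBounded T (Metric.sphere 0 1) b₁ fun _ => 1
  bounded : SmoothBounded T (Metric.sphere 0 1 ×ˢ Ioo (-1) 1) q fun _ => 1
  zero : ∀ k ∈ T, ∀ θ, q k (θ, 0) = 0 ∧ deriv (fun s : ℝ => q k (θ, s)) 0 = 0
  expansion : ∀ k ∈ T, ∀ θ ∈ Metric.sphere (0 : Eu (n + 1)) 1, ∀ s ∈ Ioo (-1 : ℝ) 1, ∀ u v,
    k.2.normalMetric ((k.1 * (1 - s)) • θ) u v = inner ℝ u v +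
      1 / 3 * curv g k.2.pt (k.2.tangent θ) (k.2.tangent u) (k.2.tangent θ) (k.2.tangent v) *
        (k.1 * (1 - s)) ^ 2 +
      1 / 6 * nablaCurv g k.2.pt (k.2.tangent θ) (k.2.tangent θ) (k.2.tangent u)
        (k.2.tangent θ) (k.2.tangent v) * (k.1 * (1 - s)) ^ 3 +
      k.1 ^ 4 * (b₀ k θ u v + s * b₁ k θ u v + q k (θ, s) u v)

/-- At the points of `S`, normal coordinates are well behaved on the ball of radius `2 ρ₁`, and
the metric in these coordinates has a uniform expansion on the ball. -/
structure HasExpansion (g : RiemMetric n M) (ρ₁ : ℝ) (S : Set M) : Prop where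
  exists_isExp : ∀ p ∈ S, ∀ v : Eu (n + 1), metricAt g p v v < (2 * ρ₁) ^ 2 → ∃ q, IsExp g p v q
  contMDiffOn : ∀ P : Frame g, P.pt ∈ S →
    ContMDiffOn 𝓘(ℝ, Eu (n + 1)) (𝓡 (n + 1)) ∞ P.normalCoord (Metric.ball 0 (2 * ρ₁))
  gauss : ∀ P : Frame g, P.pt ∈ S → ∀ x ∈ Metric.ball (0 : Eu (n + 1)) (2 * ρ₁), ∀ u,
    P.normalMetric x x u = inner ℝ x u
  exists_isRemainder : ∃ b₀ b₁ q,
    IsRemainder (g := g) (Ioo 0 ρ₁ ×ˢ {P | P.pt ∈ S}) b₀ b₁ q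

lemma IsRemainder.mono {T T' : Set (ℝ × Frame g)}
    {b₀ b₁ : ℝ × Frame g → Eu (n + 1) → Bil (n + 1)}
    {q : ℝ × Frame g → Eu (n + 1) × ℝ → Bil (n + 1)} (h : IsRemainder T b₀ b₁ q) (hT : T' ⊆ T) :
    IsRemainder T' b₀ b₁ q :=
  ⟨h.bounded₀.mono hT, h.bounded₁.mono hT, h.bounded.mono hT, fun k hk => h.zero k (hT hk),
    fun k hk => h.expansion k (hT hk)⟩

open Classical in
lemma IsRemainder.ite {T T' : Set (ℝ × Frame g)}
    {b₀ b₁ b₀' b₁' : ℝ × Frame g → Eu (n + 1) → Bil (n + 1)}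
    {q q' : ℝ × Frame g → Eu (n + 1) × ℝ → Bil (n + 1)} (h : IsRemainder T b₀ b₁ q)
    (h' : IsRemainder T' b₀' b₁' q') :
    IsRemainder (T ∪ T') (fun k => if k ∈ T then b₀ k else b₀' k)
      (fun k => if k ∈ T then b₁ k else b₁' k) (fun k => if k ∈ T then q k else q' k) := by
  refine ⟨h.bounded₀.ite h'.bounded₀, h.bounded₁.ite h'.bounded₁, h.bounded.ite h'.bounded,
    fun k hk => ?_, fun k hk => ?_⟩
  · by_cases hkT : k ∈ T
    · simpa only [if_pos hkT] using h.zero k hkT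
    · simpa only [if_neg hkT] using h'.zero k (hk.resolve_left hkT)
  · by_cases hkT : k ∈ T
    · simpa only [if_pos hkT] using h.expansion k hkT
    · simpa only [if_neg hkT] using h'.expansion k (hk.resolve_left hkT)

lemma HasExpansion.mono {ρ₁ ρ₂ : ℝ} {S S' : Set M} (h : HasExpansion g ρ₁ S) (h0 : 0 ≤ ρ₂)
    (hρ : ρ₂ ≤ ρ₁) (hS : S' ⊆ S) : HasExpansion g ρ₂ S' := by
  have hball : Metric.ball (0 : Eu (n + 1)) (2 * ρ₂) ⊆ Metric.ball 0 (2 * ρ₁) :=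
    Metric.ball_subset_ball (by linarith)
  obtain ⟨b₀, b₁, q, hR⟩ := h.exists_isRemainder
  refine ⟨fun p hp v hv => h.exists_isExp p (hS hp) v (hv.trans_le (by gcongr)),
    fun P hP => (h.contMDiffOn P (hS hP)).mono hball,
    fun P hP x hx => h.gauss P (hS hP) x (hball hx), b₀, b₁, q,
    hR.mono (prod_mono (Ioo_subset_Ioo le_rfl hρ) fun P hP => hS hP)⟩

lemma HasExpansion.union {ρ₁ : ℝ} {S S' : Set M} (h : HasExpansion g ρ₁ S)
    (h' : HasExpansion g ρ₁ S') : HasExpansion g ρ₁ (S ∪ S') := by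
  obtain ⟨b₀, b₁, q, hR⟩ := h.exists_isRemainder
  obtain ⟨b₀', b₁', q', hR'⟩ := h'.exists_isRemainder
  refine ⟨fun p hp => hp.elim (h.exists_isExp p) (h'.exists_isExp p),
    fun P hP => hP.elim (h.contMDiffOn P) (h'.contMDiffOn P),
    fun P hP => hP.elim (h.gauss P) (h'.gauss P), _, _, _, (hR.ite hR').mono ?_⟩
  rw [← prod_union]
  exact Subset.rfl

lemma HasExpansion.empty : HasExpansion g 1 (∅ : Set M) := by
  refine ⟨fun p hp => hp.elim, fun P hP => hP.elim, fun P hP => hP.elim, 0, 0, 0, ?_⟩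
  have h : Ioo (0 : ℝ) 1 ×ˢ {P : Frame g | P.pt ∈ (∅ : Set M)} = ∅ := by simp
  rw [h]
  exact ⟨⟨fun k hk => hk.elim, fun m => ⟨0, fun k hk => hk.elim⟩⟩,
    ⟨fun k hk => hk.elim, fun m => ⟨0, fun k hk => hk.elim⟩⟩,
    ⟨fun k hk => hk.elim, fun m => ⟨0, fun k hk => hk.elim⟩⟩, fun k hk => hk.elim,
    fun k hk => hk.elim⟩

/-- If the metric in normal coordinates is a smooth function of parameters in a compact set, then
the remainder of its third order expansion is uniformly bounded. Hadamard's lemma, applied four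
times in `t = ρ (1 - s)`, writes the remainder as `t ^ 4` times a smooth function of all
variables; it is then expanded to first order in `s`. -/
theorem exists_isRemainder {C : Type} [NormedAddCommGroup C] [NormedSpace ℝ C] {𝒦 : Set C}
    (h𝒦 : IsCompact 𝒦) {Ĥ : C × Eu (n + 1) → Bil (n + 1)} (hĤ : ContDiff ℝ ∞ Ĥ) {c : Frame g → C}
    {S : Set M} {R ρ₁ : ℝ} (hR : 2 * ρ₁ ≤ R)
    (hc : ∀ P : Frame g, P.pt ∈ S → c P ∈ 𝒦 ∧ P.IsNormalOn R ∧
      ∀ x ∈ Metric.ball (0 : Eu (n + 1)) R, Ĥ (c P, x) = P.normalMetric x) :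
    ∃ b₀ b₁ q, IsRemainder (g := g) (Ioo 0 ρ₁ ×ˢ {P | P.pt ∈ S}) b₀ b₁ q := by
  have hK : ContDiff ℝ ∞ fun p : (C × Eu (n + 1)) × ℝ => Ĥ (p.1.1, p.2 • p.1.2) :=
    hĤ.comp (by fun_prop)
  obtain ⟨K₁, hK₁, e₁⟩ := exists_contDiff_eq_add_smul hK
  obtain ⟨K₂, hK₂, e₂⟩ := exists_contDiff_eq_add_smul hK₁
  obtain ⟨K₃, hK₃, e₃⟩ := exists_contDiff_eq_add_smul hK₂
  obtain ⟨K₄, hK₄, e₄⟩ := exists_contDiff_eq_add_smul hK₃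
  -- the remainder as a function of the parameters `(c, ρ)` and of `(θ, s)`
  let Ψ : (C × ℝ) × (Eu (n + 1) × ℝ) → Bil (n + 1) := fun p =>
    (1 - p.2.2) ^ 4 • K₄ ((p.1.1, p.2.1), p.1.2 * (1 - p.2.2))
  have hΨ : ContDiff ℝ ∞ Ψ := by
    have h1 : ContDiff ℝ ∞ fun p : (C × ℝ) × (Eu (n + 1) × ℝ) =>
        K₄ ((p.1.1, p.2.1), p.1.2 * (1 - p.2.2)) := hK₄.comp (by fun_prop)
    have h2 : ContDiff ℝ ∞ fun p : (C × ℝ) × (Eu (n + 1) × ℝ) => (1 - p.2.2) ^ 4 := by fun_prop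
    exact h2.smul h1
  let Ψ₀ : (C × ℝ) × Eu (n + 1) → Bil (n + 1) := fun p => Ψ (p.1, (p.2, 0))
  have hΨ₀ : ContDiff ℝ ∞ Ψ₀ := hΨ.comp (by fun_prop)
  let Ψ₁ : (C × ℝ) × Eu (n + 1) → Bil (n + 1) := fun p =>
    fderiv ℝ Ψ (p.1, (p.2, 0)) (0, (0, 1))
  have hΨ₁ : ContDiff ℝ ∞ Ψ₁ :=
    ((hΨ.fderiv_right (m := ∞) (by exact_mod_cast le_top)).comp
      (by fun_prop : ContDiff ℝ ∞ fun p : (C × ℝ) × Eu (n + 1) => (p.1, (p.2, (0 : ℝ))))).clm_apply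
      contDiff_const
  let Ψ₂ : (C × ℝ) × (Eu (n + 1) × ℝ) → Bil (n + 1) := fun p =>
    Ψ p - Ψ₀ (p.1, p.2.1) - p.2.2 • Ψ₁ (p.1, p.2.1)
  have hΨ₂ : ContDiff ℝ ∞ Ψ₂ := by
    have h0 : ContDiff ℝ ∞ fun p : (C × ℝ) × (Eu (n + 1) × ℝ) => Ψ₀ (p.1, p.2.1) :=
      hΨ₀.comp (by fun_prop)
    have h1 : ContDiff ℝ ∞ fun p : (C × ℝ) × (Eu (n + 1) × ℝ) => Ψ₁ (p.1, p.2.1) :=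
      hΨ₁.comp (by fun_prop)
    have h2 : ContDiff ℝ ∞ fun p : (C × ℝ) × (Eu (n + 1) × ℝ) => p.2.2 := by fun_prop
    exact (hΨ.sub h0).sub (h2.smul h1)
  have hpar : IsCompact (𝒦 ×ˢ Icc 0 ρ₁) := h𝒦.prod isCompact_Icc
  have hmem : ∀ k ∈ Ioo 0 ρ₁ ×ˢ {P : Frame g | P.pt ∈ S}, (c k.2, k.1) ∈ 𝒦 ×ˢ Icc 0 ρ₁ :=
    fun k hk => ⟨(hc k.2 hk.2).1, Ioo_subset_Icc_self hk.1⟩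
  refine ⟨fun k θ => Ψ₀ ((c k.2, k.1), θ), fun k θ => Ψ₁ ((c k.2, k.1), θ),
    fun k x => Ψ₂ ((c k.2, k.1), x),
    smoothBounded_of_isCompact hΨ₀ hpar (isCompact_sphere _ _) Subset.rfl hmem,
    smoothBounded_of_isCompact hΨ₁ hpar (isCompact_sphere _ _) Subset.rfl hmem,
    smoothBounded_of_isCompact hΨ₂ hpar ((isCompact_sphere _ _).prod isCompact_Icc)
      (prod_mono_right Ioo_subset_Icc_self) hmem, fun k hk θ => ⟨by simp [Ψ₂, Ψ₀], ?_⟩,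
    fun k hk θ hθ s hs u v => ?_⟩
  · have h1 : HasDerivAt (fun s : ℝ => ((c k.2, k.1), (θ, s))) (0, (0, 1)) 0 :=
      (hasDerivAt_const _ _).prodMk ((hasDerivAt_const _ _).prodMk (hasDerivAt_id _))
    have h2 := (hΨ.differentiable (by simp) _).hasFDerivAt.comp_hasDerivAt (0 : ℝ) h1
    have h3 := (h2.sub_const (Ψ₀ ((c k.2, k.1), θ))).sub
      ((hasDerivAt_id (0 : ℝ)).smul_const (Ψ₁ ((c k.2, k.1), θ)))
    refine h3.deriv.trans ?_
    simp [Ψ₁]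
  · obtain ⟨-, hN, hH⟩ := hc k.2 hk.2
    set t := k.1 * (1 - s) with ht
    have hball : t • θ ∈ Metric.ball (0 : Eu (n + 1)) R := by
      rw [mem_sphere_zero_iff_norm] at hθ
      rw [mem_ball_zero_iff, norm_smul, hθ, mul_one, Real.norm_of_nonneg
        (mul_nonneg hk.1.1.le (by linarith [hs.2]))]
      nlinarith [hk.1.1, hk.1.2, hs.1, hs.2]
    have hsm : ∀ {K : (C × Eu (n + 1)) × ℝ → Bil (n + 1)}, ContDiff ℝ ∞ K →
        ContDiff ℝ ∞ fun t : ℝ => K ((c k.2, θ), t) u v := fun hK =>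
      ((hK.comp (by fun_prop : ContDiff ℝ ∞ fun t : ℝ => ((c k.2, θ), t))).clm_apply
        contDiff_const).clm_apply contDiff_const
    have hadd : ∀ {A B D : Bil (n + 1)} {r : ℝ}, A = B + r • D → A u v = B u v + r * D u v := by
      rintro A B D r rfl
      rfl
    obtain ⟨t0, t1, t2, t3⟩ := hN.taylor θ u v (k := fun t => Ĥ (c k.2, t • θ) u v)
      (fun t ht => by rw [hH _ ht]) (hsm hK₁) (hsm hK₂) (hsm hK₃)
      (fun t => hadd (e₁ (c k.2, θ) t)) (fun t => hadd (e₂ (c k.2, θ) t))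
      (fun t => hadd (e₃ (c k.2, θ) t))
    have hΨs : Ψ₀ ((c k.2, k.1), θ) u v + s * Ψ₁ ((c k.2, k.1), θ) u v +
        Ψ₂ ((c k.2, k.1), θ, s) u v = (1 - s) ^ 4 * K₄ ((c k.2, θ), t) u v := by
      change _ + _ + (Ψ ((c k.2, k.1), θ, s) u v - Ψ₀ ((c k.2, k.1), θ) u v -
        s * Ψ₁ ((c k.2, k.1), θ) u v) = _
      change _ + _ + ((1 - s) ^ 4 * K₄ ((c k.2, θ), t) u v - Ψ₀ ((c k.2, k.1), θ) u v -
        s * Ψ₁ ((c k.2, k.1), θ) u v) = _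
      ring
    rw [hΨs, ← hH _ hball]
    have a1 := hadd (e₁ (c k.2, θ) t)
    have a2 := hadd (e₂ (c k.2, θ) t)
    have a3 := hadd (e₃ (c k.2, θ) t)
    have a4 := hadd (e₄ (c k.2, θ) t)
    simp only at a1 t0
    rw [a1, a2, a3, a4, t0, t1, t2, t3, ht]
    ring

/-- The uniform expansion holds on a compact set, since it holds locally. -/
theorem exists_hasExpansion [T2Space M] (g : RiemMetric n M) {K : Set M} (hK : IsCompact K) :
    ∃ ρ₁ > (0 : ℝ), HasExpansion g ρ₁ K := by
  refine hK.induction_on (p := fun S => ∃ ρ₁ > (0 : ℝ), HasExpansion g ρ₁ S)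
    ⟨1, one_pos, .empty⟩ ?_ ?_ fun x₀ _ => ?_
  · rintro S S' hS ⟨ρ₁, hρ, h⟩
    exact ⟨ρ₁, hρ, h.mono hρ.le le_rfl hS⟩
  · rintro S S' ⟨ρ₁, hρ, h⟩ ⟨ρ₂, hρ', h'⟩
    exact ⟨min ρ₁ ρ₂, lt_min hρ hρ', (h.mono (lt_min hρ hρ').le (min_le_left _ _) Subset.rfl).union
      (h'.mono (lt_min hρ hρ').le (min_le_right _ _) Subset.rfl)⟩
  · obtain ⟨N, hN, R, hR, hexp, 𝒦, h𝒦, Ĥ, hĤ, c, hc⟩ := exists_uniform_normalMetric g x₀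
    have h2 : 2 * (R / 2) = R := by ring
    refine ⟨N, mem_nhdsWithin_of_mem_nhds hN, R / 2, by positivity, ⟨?_, ?_, ?_, ?_⟩⟩
    · rwa [h2]
    · rw [h2]
      exact fun P hP => (hc P hP).2.1.contMDiffOn
    · rw [h2]
      exact fun P hP x hx u => (hc P hP).2.1.gauss (fun y hy => ((hc P hP).2.2 y hy).1) hx u
    · exact exists_isRemainder h𝒦 hĤ h2.le fun P hP =>
        ⟨(hc P hP).1, (hc P hP).2.1, fun x hx => ((hc P hP).2.2 x hx).2⟩

end Expansion

/-! ### The perturbed geodesic spheres -/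

section Spheres

variable {n : ℕ} {M : Type*} [TopologicalSpace M] [ChartedSpace (Eu (n + 1)) M]
  [IsManifold (𝓡 (n + 1)) ∞ M] {g : RiemMetric n M}

/-- The differential of the polar map `z ↦ ρ (1 - w(z)) θ(z)`. -/
lemma hasFDerivAt_polar {θ : Eu n → Eu (n + 1)} {w : Eu n → ℝ} {z : Eu n} (ρ : ℝ)
    (hθ : DifferentiableAt ℝ θ z) (hw : DifferentiableAt ℝ w z) :
    HasFDerivAt (fun z => (ρ * (1 - w z)) • θ z)
      ((ρ * (1 - w z)) • fderiv ℝ θ z - (ρ • fderiv ℝ w z).smulRight (θ z)) z := by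
  have h := ((hw.hasFDerivAt.const_sub 1).const_mul ρ).smul hθ.hasFDerivAt
  have e : (ρ * (1 - w z)) • fderiv ℝ θ z - (ρ • fderiv ℝ w z).smulRight (θ z) =
      (ρ * (1 - w z)) • fderiv ℝ θ z + (ρ • -fderiv ℝ w z).smulRight (θ z) := by
    ext v
    simp [sub_eq_add_neg]
  rw [e]
  exact h

lemma inner_fderiv_of_norm_eq_one {θ : Eu n → Eu (n + 1)} {z : Eu n}
    (hθ : DifferentiableAt ℝ θ z) (h1 : ∀ z, ‖θ z‖ = 1) (v : Eu n) :
    inner ℝ (θ z) (fderiv ℝ θ z v) = 0 := by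
  have h := hθ.hasFDerivAt.norm_sq
  simp only [h1] at h
  have h2 := congrArg (fun L : Eu n →L[ℝ] ℝ => L v) (h.unique (hasFDerivAt_const _ _))
  simpa using h2

/-- The first fundamental form of a perturbed sphere: by the Gauss lemma, the radial and the
spherical directions are orthogonal. -/
lemma metricAt_polar {P : Frame g} {r ρ W : ℝ} (hr : r = ρ * (1 - W)) (hρ : 0 < ρ) (hW : W < 1)
    {θ a b : Eu (n + 1)} (hθ : ‖θ‖ = 1) (ha : inner ℝ θ a = 0) (hb : inner ℝ θ b = 0)
    (hg : ∀ u, P.normalMetric (r • θ) (r • θ) u = inner ℝ (r • θ) u) (α β : ℝ) :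
    (ρ ^ 2)⁻¹ * ((1 - W) ^ 2)⁻¹ *
        P.normalMetric (r • θ) (r • a - (ρ * α) • θ) (r • b - (ρ * β) • θ) =
      P.normalMetric (r • θ) a b + ((1 - W) ^ 2)⁻¹ * α * β := by
  have hW' : 0 < 1 - W := by linarith
  have hr0 : r ≠ 0 := by
    rw [hr]
    positivity
  have hg' : ∀ u, P.normalMetric (r • θ) θ u = inner ℝ θ u := fun u => by
    have := hg u
    rw [map_smul, smul_apply, real_inner_smul_left, smul_eq_mul] at this
    exact mul_left_cancel₀ hr0 this
  have hsymm : P.normalMetric (r • θ) a θ = P.normalMetric (r • θ) θ a := g.symm _ _ _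
  have h1 : P.normalMetric (r • θ) θ θ = 1 := by rw [hg', real_inner_self_eq_norm_sq, hθ, one_pow]
  simp only [map_sub, map_smul, sub_apply, smul_apply, smul_eq_mul, h1, hsymm]
  rw [hg', hg', ha, hb, hr]
  field_simp
  ring

end Spheres

end PerturbedSphere

open PerturbedSphere Set in
theorem mainTheorem3 {n : ℕ} {M : Type*} [TopologicalSpace M] [T2Space M]
    [ChartedSpace (PerturbedSphere.Eu (n + 1)) M] [IsManifold (𝓡 (n + 1)) ∞ M]
    (g : PerturbedSphere.RiemMetric n M) (K : Set M) (hK : IsCompact K) :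
    ∃ ρ₀ > (0 : ℝ),
      (∀ p ∈ K, ∀ v : TangentSpace (𝓡 (n + 1)) p, g.inner p v v < (2 * ρ₀) ^ 2 →
        ∃! q, PerturbedSphere.IsExp g p v q) ∧
      (∀ P : PerturbedSphere.Frame g, P.pt ∈ K →
        ContMDiffOn 𝓘(ℝ, PerturbedSphere.Eu (n + 1)) (𝓡 (n + 1)) ∞ P.normalCoord
          (Metric.ball 0 (2 * ρ₀))) ∧
      ∃ (O : ℝ × PerturbedSphere.Frame g → PerturbedSphere.Sph n → PerturbedSphere.Bil (n + 1))
        (L Q : ℝ × PerturbedSphere.Frame g → (PerturbedSphere.Sph n → ℝ) →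
          PerturbedSphere.Sph n → PerturbedSphere.Bil (n + 1)),
        PerturbedSphere.IsOTerm (Set.Ioo 0 ρ₀ ×ˢ {P | P.pt ∈ K}) (fun k => k.1 ^ 4) O ∧
        PerturbedSphere.IsLTerm (Set.Ioo 0 ρ₀ ×ˢ {P | P.pt ∈ K}) L ∧
        PerturbedSphere.IsQTerm (Set.Ioo 0 ρ₀ ×ˢ {P | P.pt ∈ K}) Q ∧
        ∀ ρ ∈ Set.Ioo 0 ρ₀, ∀ P : PerturbedSphere.Frame g, P.pt ∈ K →
        ∀ w : PerturbedSphere.Sph n → ℝ, ContMDiff (𝓡 n) 𝓘(ℝ, ℝ) 1 w → (∀ θ, |w θ| < 1) →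
        ∀ U : Set (PerturbedSphere.Eu n), IsOpen U →
        ∀ Θ : PerturbedSphere.Eu n → PerturbedSphere.Sph n,
          ContMDiffOn 𝓘(ℝ, PerturbedSphere.Eu n) (𝓡 n) ∞ Θ U →
        ∀ z ∈ U, ∀ i j : Fin n,
          let W : ℝ := w (Θ z)
          let dw : Fin n → ℝ := fun k => PerturbedSphere.pd k (fun z' => w (Θ z')) z
          let dΘ : Fin n → PerturbedSphere.Eu (n + 1) :=
            fun k => PerturbedSphere.pd k (fun z' => (Θ z' : PerturbedSphere.Eu (n + 1))) z
          let T : TangentSpace (𝓡 (n + 1)) P.pt := P.tangent (Θ z)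
          let Ti : Fin n → TangentSpace (𝓡 (n + 1)) P.pt := fun k => P.tangent (dΘ k)
          (ρ ^ 2)⁻¹ * ((1 - W) ^ 2)⁻¹ *
              g.inner (PerturbedSphere.param P ρ w Θ z)
                (PerturbedSphere.tangentZ P ρ w Θ i z) (PerturbedSphere.tangentZ P ρ w Θ j z) =
            g.inner P.pt (Ti i) (Ti j)
              + 1 / 3 * PerturbedSphere.curv g P.pt T (Ti i) T (Ti j) * ρ ^ 2 * (1 - W) ^ 2
              + 1 / 6 * PerturbedSphere.nablaCurv g P.pt T T (Ti i) T (Ti j)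
                  * ρ ^ 3 * (1 - W) ^ 3
              + ((1 - W) ^ 2)⁻¹ * dw i * dw j
              + O (ρ, P) (Θ z) (dΘ i) (dΘ j)
              + ρ ^ 4 * L (ρ, P) w (Θ z) (dΘ i) (dΘ j)
              + ρ ^ 4 * Q (ρ, P) w (Θ z) (dΘ i) (dΘ j) := by
  obtain ⟨ρ₀, hρ₀, h⟩ := exists_hasExpansion g hK
  obtain ⟨b₀, b₁, q, hR⟩ := h.exists_isRemainder
  refine ⟨ρ₀, hρ₀, fun p hp v hv => ?_, h.contMDiffOn,
    fun k θ => k.1 ^ 4 • b₀ k θ, fun k w θ => w θ • b₁ k θ, fun k w θ => q k (θ, w θ),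
    ⟨fun k θ => k.1 ^ 4 • b₀ k θ, hR.bounded₀.const_smul_left _ fun k hk => ?_,
      fun _ _ _ => rfl⟩,
    ⟨fun k θ => b₁ k θ, ⟨b₁, hR.bounded₁, fun _ _ _ => rfl⟩, fun _ _ _ _ => rfl⟩,
    ⟨q, hR.bounded, fun k hk θ => hR.zero k hk θ, fun _ _ _ _ _ => rfl⟩, ?_⟩
  · obtain ⟨q, hq⟩ := h.exists_isExp p hp v hv
    exact ⟨q, hq, fun q' hq' => hq'.unique hq⟩
  · exact pow_nonneg hk.1.1.le 4
  intro ρ hρ P hP w hw hw1 U hU Θ hΘ z hz i j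
  have hΘz : ContMDiffAt 𝓘(ℝ, Eu n) (𝓡 n) ∞ Θ z := hΘ.contMDiffAt (hU.mem_nhds hz)
  let θ : Eu n → Eu (n + 1) := fun z' => Θ z'
  let wΘ : Eu n → ℝ := fun z' => w (Θ z')
  have : Fact (Module.finrank ℝ (Eu (n + 1)) = n + 1) := ⟨finrank_euclideanSpace_fin⟩
  have hcoe : ContMDiff (𝓡 n) 𝓘(ℝ, Eu (n + 1)) ∞ ((↑) : Sph n → Eu (n + 1)) :=
    contMDiff_coe_sphere
  have hθ : DifferentiableAt ℝ θ z :=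
    (contMDiffAt_iff_contDiffAt.1 (hcoe.contMDiffAt.comp z hΘz)).differentiableAt (by simp)
  have hwΘ : DifferentiableAt ℝ wΘ z :=
    (contMDiffAt_iff_contDiffAt.1 (hw.contMDiffAt.comp z
      (hΘz.of_le (by simp : (1 : ℕ∞ω) ≤ ∞)))).differentiableAt (by simp)
  have hθ1 : ∀ z, ‖θ z‖ = 1 := fun z => mem_sphere_zero_iff_norm.1 (Θ z).2
  have hW := abs_lt.1 (hw1 (Θ z))
  set r : ℝ := ρ * (1 - wΘ z) with hr
  have hx : r • θ z ∈ Metric.ball (0 : Eu (n + 1)) (2 * ρ₀) := by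
    rw [mem_ball_zero_iff, norm_smul, hθ1, mul_one, Real.norm_of_nonneg
      (mul_nonneg hρ.1.le (by linarith [hW.2]))]
    nlinarith [hρ.1, hρ.2, hW.1, hW.2]
  have hF : MDifferentiableAt 𝓘(ℝ, Eu (n + 1)) (𝓡 (n + 1)) P.normalCoord (r • θ z) :=
    ((h.contMDiffOn P hP).contMDiffAt (Metric.isOpen_ball.mem_nhds hx)).mdifferentiableAt (by simp)
  have hZ : ∀ k, (tangentZ P ρ w Θ k z : Eu (n + 1)) =
      mder P.normalCoord (r • θ z) (r • pd k θ z - (ρ * pd k wΘ z) • θ z) := fun k =>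
    congrArg (fun L : Eu n →L[ℝ] Eu (n + 1) => L (EuclideanSpace.single k 1))
      (HasMFDerivAt.comp z hF.hasMFDerivAt (hasFDerivAt_polar ρ hθ hwΘ).hasMFDerivAt).mfderiv
  have hmain := metricAt_polar (P := P) hr hρ.1 hW.2 (hθ1 z)
    (inner_fderiv_of_norm_eq_one hθ hθ1 (EuclideanSpace.single i 1))
    (inner_fderiv_of_norm_eq_one hθ hθ1 (EuclideanSpace.single j 1))
    (h.gauss P hP _ hx) (pd i wΘ z) (pd j wΘ z)
  have hexp := hR.expansion (ρ, P) ⟨hρ, hP⟩ (θ z) (Θ z).2 (wΘ z) hW (pd i θ z) (pd j θ z)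
  have hinner : g.inner P.pt (P.tangent (pd i θ z)) (P.tangent (pd j θ z)) =
      inner ℝ (pd i θ z) (pd j θ z) := by
    rw [← P.metricAt_tangentL, P.tangentL_apply, P.tangentL_apply]
    rfl
  have hlhs : g.inner (param P ρ w Θ z) (tangentZ P ρ w Θ i z) (tangentZ P ρ w Θ j z) =
      P.normalMetric (r • θ z) (r • pd i θ z - (ρ * pd i wΘ z) • θ z)
        (r • pd j θ z - (ρ * pd j wΘ z) • θ z) := by
    rw [P.normalMetric_apply, ← hZ, ← hZ]
    rfl
  intro W dw dΘ T Ti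
  rw [hlhs]
  refine hmain.trans ?_
  change P.normalMetric ((ρ * (1 - wΘ z)) • θ z) (pd i θ z) (pd j θ z) + _ = _
  rw [hexp]
  simp only [Ti]
  rw [hinner]
  simp only [smul_apply, smul_eq_mul, T, dΘ, W, dw]
  ring
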